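/- Let $d\ge 1$, $\mathbb{N}_0=\{0,1,2,\dots\}$, $\mathbb{R}^d_+=(0,\infty)^d$, $\mathbf{1}=(1,\dots,1)$ and $\mathbf{D}=\{w\in\mathbb{C}^d: |w_j|<1,\ j=1,\dots,d\}$. Use standard multi-index notation for $n,p,k\in\mathbb{N}_0^d$: $|n|=n_1+\dots+n_d$, $w^n=\prod_j w_j^{n_j}$, $p^{rp}=\prod_j p_j^{r p_j}$ for real $r$ (with $0^0=1$), and $D^p=\partial_1^{p_1}\cdots\partial_d^{p_d}$. For $n\in\mathbb{N}_0^d$ let $$\mathcal{L}_n(t)=\prod_{j=1}^d L_{n_j}(t_j)e^{-t_j/2},\qquad L_m(s)=\frac{e^s}{m!}\frac{d^m}{ds^m}\left(e^{-s}s^m\right).$$ Let $\mathcal{S}(\mathbb{R}^d_+)$ be the set of all $f\in C^\infty(\mathbb{R}^d_+;\mathbb{C})$ such that every derivative $D^pf$ extends continuously to $[0,\infty)^d$ and $\sup_{t\in\mathbb{R}^d_+}t^k|D^pf(t)|<\infty$ for all $k,p\in\mathbb{N}_0^d$. For $\alpha\ge 1$ let $G^\alpha_\alpha(\mathbb{R}^d_+)$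 be the set of all $f\in\mathcal{S}(\mathbb{R}^d_+)$ for which there is $A>0$ with $$\sup_{p,k\in\mathbb{N}_0^d}\frac{\|t^{(p+k)/2}D^pf(t)\|_{L^2(\mathbb{R}^d_+)}}{A^{|p+k|}\,k^{(\alpha/2)k}\,p^{(\alpha/2)p}}<\infty.$$ For $f\in L^2(\mathbb{R}^d_+)$ put $a_n(f)=\int_{\mathbb{R}^d_+}f(t)\mathcal{L}_n(t)\,dt$ and $$\mathcal{F}_{\mathbf{D}}(f)(w)=\int_{\mathbb{R}^d_+}f(t)\prod_{j=1}^d e^{-\frac12\frac{1+w_j}{1-w_j}t_j}\,dt,\qquad w\in\mathbf{D}.$$ **Theorem.** Let $\alpha\ge 1$. (a) For every $f\in L^2(\mathbb{R}^d_+)$ the function $\mathcal{F}_{\mathbf{D}}(f)$ is analytic on $\mathbf{D}$, and $\mathcal{F}_{\mathbf{D}}(f)(w)=\prod_{j=1}^d(1-w_j)\sum_{n\in\mathbb{N}_0^d}a_n(f)w^n$ for $w\in\mathbf{D}$, the series being absolutely convergent. Moreover, the following conditions are equivalent: (i) there exist $c>0$ and $a>1$ such that $|a_n(f)|\le c\,a^{-|n|^{1/\alpha}}$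 for all $n\in\mathbb{N}_0^d$; (ii) $f\in G^\alpha_\alpha(\mathbb{R}^d_+)$, i.e. $f$ coincides almost everywhere on $\mathbb{R}^d_+$ with an element of $G^\alpha_\alpha(\mathbb{R}^d_+)$; (iii) there exist $C,A>0$ such that $|D^p\mathcal{F}_{\mathbf{D}}(f)(w)|\le CA^{|p|}p^{\alpha p}$ for all $p\in\mathbb{N}_0^d$ and $w\in\mathbf{D}$, and $\lim_{w\to\mathbf{1},\,w\in\mathbf{D}}\mathcal{F}_{\mathbf{D}}(f)(w)=0$. (b) Conversely, let $(a_n)_{n\in\mathbb{N}_0^d}$ be a complex sequence for which there exist $c>0$ and $a>1$ with $|a_n|\le c\,a^{-|n|^{1/\alpha}}$ for all $n$. Then there exists $f\in G^\alpha_\alpha(\mathbb{R}^d_+)$ such that $a_n=a_n(f)$ for all $n$ and $\mathcal{F}_{\mathbf{D}}(f)(w)=\prod_{j=1}^d(1-w_j)\sum_{n}a_nw^n$ for all $w\in\mathbf{D}$. (c) Likewise, let $F$ be an analytic function on $\mathbf{D}$ of the form $F(w)=\prod_{j=1}^d(1-w_j)\sum_{n\in\mathbb{N}_0^d}a_nw^n$,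 where $a_n\in\mathbb{C}$ and $a_n\to0$ as $|n|\to\infty$, and suppose that there exist $C,A>0$ with $|D^pF(w)|\le CA^{|p|}p^{\alpha p}$ for all $p\in\mathbb{N}_0^d$ and $w\in\mathbf{D}$. Then there exists $f\in G^\alpha_\alpha(\mathbb{R}^d_+)$ such that $a_n=a_n(f)$ for all $n$ and $\mathcal{F}_{\mathbf{D}}(f)(w)=F(w)$ for all $w\in\mathbf{D}$. -/

import Mathlib

open Set Filter Topology MeasureTheory
open scoped ContDiff

noncomputable section

namespace LaguerreG

/-- The open orthant `(0, ∞)^d` in `ℝ^d`. -/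
def orthant (d : ℕ) : Set (Fin d → ℝ) := {t | ∀ l, 0 < t l}

/-- The closed orthant `[0, ∞)^d`. -/
def closedOrthant (d : ℕ) : Set (Fin d → ℝ) := {t | ∀ l, 0 ≤ t l}

/-- The open unit polydisc in `ℂ^d`. -/
def polydisc (d : ℕ) : Set (Fin d → ℂ) := {w | ∀ l, ‖w l‖ < 1}

/-- Lebesgue measure on the open orthant. -/
def orthantMeasure (d : ℕ) : Measure (Fin d → ℝ) := volume.restrict (orthant d)

/-- The length `|n| = n_1 + ... + n_d` of a multi-index. -/
def len {d : ℕ} (n : Fin d → ℕ) : ℕ := ∑ l, n l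

/-- The power `x^s = x_1^{s_1} ... x_d^{s_d}` with real exponents (with `0^0 = 1`). -/
def mpow {d : ℕ} (x s : Fin d → ℝ) : ℝ := ∏ l, x l ^ s l

/-- The quantity `p^{r p} = p_1^{r p_1} ... p_d^{r p_d}` for a multi-index `p` and a real `r`. -/
def selfPow {d : ℕ} (r : ℝ) (p : Fin d → ℕ) : ℝ :=
  mpow (fun l => (p l : ℝ)) (fun l => r * (p l : ℝ))

/-- The partial derivative in the `l`-th variable, real or complex according to `𝕜`. -/
def pderiv (𝕜 : Type) [NontriviallyNormedField 𝕜] [NormedSpace 𝕜 ℂ] {d : ℕ} (l : Fin d)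
    (f : (Fin d → 𝕜) → ℂ) : (Fin d → 𝕜) → ℂ :=
  fun x => lineDeriv 𝕜 f x (Pi.single l 1)

/-- The iterated partial derivative `D^p = ∂_1^{p_1} ... ∂_d^{p_d}`. -/
def mderiv (𝕜 : Type) [NontriviallyNormedField 𝕜] [NormedSpace 𝕜 ℂ] {d : ℕ} (p : Fin d → ℕ)
    (f : (Fin d → 𝕜) → ℂ) : (Fin d → 𝕜) → ℂ :=
  (List.finRange d).foldr (fun l g => (pderiv 𝕜 l)^[p l] g) f

/-- The Laguerre polynomial (of order zero) `L_j(t) = (e^t / j!) (d/dt)^j (e^{-t} t^j)`. -/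
def laguerrePoly (j : ℕ) (t : ℝ) : ℝ :=
  Real.exp t / (j.factorial : ℝ) * iteratedDeriv j (fun s => Real.exp (-s) * s ^ j) t

/-- The `d`-dimensional Laguerre function, the product of the `L_{n_l}(t_l) e^{-t_l/2}`. -/
def laguerreFun {d : ℕ} (n : Fin d → ℕ) (t : Fin d → ℝ) : ℝ :=
  ∏ l, laguerrePoly (n l) (t l) * Real.exp (-(t l) / 2)

/-- The Laguerre coefficient `a_n(f) = ∫ f 𝓛_n` over the orthant. -/
def laguerreCoeff {d : ℕ} (f : (Fin d → ℝ) → ℂ) (n : Fin d → ℕ) : ℂ :=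
  ∫ t, f t * (laguerreFun n t : ℂ) ∂(orthantMeasure d)

/-- The Schwartz space of the orthant: smooth functions on the open orthant all of whose
derivatives extend continuously to the closed orthant and are rapidly decreasing.
Only the values of `f` on the open orthant matter. -/
structure IsSchwartz {d : ℕ} (f : (Fin d → ℝ) → ℂ) : Prop where
  smooth : ContDiffOn ℝ ∞ f (orthant d)
  extends_cont : ∀ p : Fin d → ℕ, ∃ g : (Fin d → ℝ) → ℂ,
    ContinuousOn g (closedOrthant d) ∧ EqOn g (mderiv ℝ p f) (orthant d)
  decay : ∀ k p : Fin d → ℕ, ∃ C : ℝ, ∀ t ∈ orthant d,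
    (∏ l, t l ^ k l) * ‖mderiv ℝ p f t‖ ≤ C

/-- The space `G^β_α` of the orthant: the functions `f` in the Schwartz space of the orthant with
`sup_{p,k} ‖t^{(p+k)/2} D^p f‖_{L²} / (A^{|p+k|} k^{(α/2)k} p^{(β/2)p}) < ∞` for some `A > 0`. -/
structure IsG {d : ℕ} (α β : ℝ) (f : (Fin d → ℝ) → ℂ) : Prop where
  schwartz : IsSchwartz f
  bound : ∃ A : ℝ, 0 < A ∧ ∃ C : ℝ, ∀ p k : Fin d → ℕ,
    eLpNorm (fun t => (mpow t (fun l => ((p l : ℝ) + (k l : ℝ)) / 2) : ℂ) * mderiv ℝ p f t) 2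
        (orthantMeasure d)
      ≤ ENNReal.ofReal (C * (A ^ len (p + k) * selfPow (α / 2) k * selfPow (β / 2) p))

/-- The transform `F_𝐃(f)(w) = ∫ f(t) ∏_l exp(-(1/2) ((1 + w_l)/(1 - w_l)) t_l) dt`. -/
def FD {d : ℕ} (f : (Fin d → ℝ) → ℂ) (w : Fin d → ℂ) : ℂ :=
  ∫ t, f t * ∏ l, Complex.exp (-(1 / 2) * ((1 + w l) / (1 - w l)) * (t l : ℂ))
    ∂(orthantMeasure d)

/-- The function `(𝟏 - w)^𝟏 ∑_n a_n w^n`. -/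
def laguerreGen {d : ℕ} (a : (Fin d → ℕ) → ℂ) (w : Fin d → ℂ) : ℂ :=
  (∏ l, (1 - w l)) * ∑' n : Fin d → ℕ, a n * ∏ l, w l ^ n l

/-- `|a_n| ≤ c a^{-|n|^{1/α}}` for some `c > 0` and `a > 1`. -/
def CoeffDecay {d : ℕ} (α : ℝ) (a : (Fin d → ℕ) → ℂ) : Prop :=
  ∃ c b : ℝ, 0 < c ∧ 1 < b ∧ ∀ n : Fin d → ℕ, ‖a n‖ ≤ c * b ^ (-((len n : ℝ) ^ (1 / α)))

/-- `|D^p F(w)| ≤ C A^{|p|} p^{α p}` on the polydisc, for some `C, A > 0`. -/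
def DerivBound {d : ℕ} (α : ℝ) (F : (Fin d → ℂ) → ℂ) : Prop :=
  ∃ C A : ℝ, 0 < C ∧ 0 < A ∧ ∀ p : Fin d → ℕ, ∀ w ∈ polydisc d,
    ‖mderiv ℂ p F w‖ ≤ C * A ^ len p * selfPow α p

end LaguerreG

end

/-! ### Elementary inequalities: stretched exponentials against powers `p^{αp}`. -/

namespace LaguerreG

/-! Every condition is compared with the decay of the Laguerre coefficients. Two numerical facts
translate between decay and growth: the supremum over `x ≥ 0` of `x^p e^{-c x^{1/α}}` is at most
`B^p p^{αp}`, and conversely, if `x (n)_p ≤ C A^p p^{αp}` for all `p ≤ n`, where `(n)_p =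
n!/(n-p)!`, then taking `p ≈ ε n^{1/α}` gives exponential smallness of `x` in `n^{1/α}`
(`exists_exp_decay_of_descFactorial_bound`).

The transform: summing the Laguerre generating function identifies the kernel of `FD` with `∏ (1 -
w_l) ∑ 𝓛_n(t) w^n`, and Cauchy–Schwarz permits termwise integration (`FD_eq_laguerreGen`).
Multiplication by `1 - w_l` is a backward difference of coefficients, so `FD f` is a power series in
the mixed differences of the `a_n(f)`. Differencing preserves the decay, and telescoping undoes it
for sequences tending to zero, which Laguerre coefficients do by Bessel's inequality. Decay gives
derivative bounds by termwise differentiation; derivative bounds give decay by Cauchy's inequality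
for `w_l^p ∂_l^p F`, whose coefficients carry the factor `(n_l)_p`.

The space `G`: the Laguerre equation in divergence form yields `∫ t^p (L_n^{(p)})² e^{-t} dt =
(n)_p` (`expInt_X_pow_mul_sq`). With the identity `L_n = L_n' - L_{n+1}'`, which raises the order of
differentiation to match the power of the weight, this bounds all weighted norms of derivatives of
Laguerre functions. Hence a Laguerre series with decaying coefficients lies in `G`
(`isG_lagSeries`). Conversely, repeated integration by parts of `∫ f 𝓛_n` against `t^p L_n^{(p)}`
bounds `|a_n| √(n_l)_P` by the norms defining `G` (`coeffDecay_of_isG`).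

A function is recovered from its coefficients because the Laguerre functions are complete: for
suitable `w` the kernel of `FD` becomes `e^{-t/2}` times a Fourier character, and Fourier uniqueness
applies. -/

/-- Raise `u ≤ e^u`, with `u = cy/s`, to the power `s`. -/
lemma rpow_mul_exp_neg_le {y s c : ℝ} (hy : 0 ≤ y) (hs : 0 ≤ s) (hc : 0 < c) :
    y ^ s * Real.exp (-c * y) ≤ (s / c) ^ s := by
  rcases hs.eq_or_lt with rfl | hs
  · simp only [Real.rpow_zero, one_mul]
    exact Real.exp_le_one_iff.2 (by nlinarith)
  have h1 : c * y / s ≤ Real.exp (c * y / s) := by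
    linarith [Real.add_one_le_exp (c * y / s)]
  have h2 : (c * y / s) ^ s ≤ Real.exp (c * y) := by
    calc (c * y / s) ^ s ≤ (Real.exp (c * y / s)) ^ s :=
          Real.rpow_le_rpow (by positivity) h1 hs.le
      _ = Real.exp (c * y) := by
          rw [← Real.exp_mul]; congr 1; field_simp
  have h3 : y ^ s = (s / c) ^ s * (c * y / s) ^ s := by
    rw [← Real.mul_rpow (by positivity) (by positivity)]
    congr 1; field_simp
  rw [h3, mul_assoc]
  refine mul_le_of_le_one_right (by positivity) ?_
  calc (c * y / s) ^ s * Real.exp (-c * y) ≤ Real.exp (c * y) * Real.exp (-c * y) := by gcongr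
    _ = 1 := by rw [← Real.exp_add]; simp

/-- The previous bound at `y = x^{1/α}`, `s = αq`. This is the passage from coefficient decay to
Gevrey growth `q^{αq}`. -/
lemma pow_mul_exp_neg_rpow_le {α c x : ℝ} (hα : 0 < α) (hc : 0 < c) (hx : 0 ≤ x) (q : ℕ) :
    x ^ q * Real.exp (-c * x ^ (1 / α)) ≤ ((α / c) ^ α) ^ q * (q : ℝ) ^ (α * q) := by
  have h := rpow_mul_exp_neg_le (y := x ^ (1 / α)) (s := α * q) (c := c) (by positivity)
    (by positivity) hc
  have h1 : (x ^ (1 / α)) ^ (α * q) = x ^ q := by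
    rw [← Real.rpow_mul hx, ← Real.rpow_natCast]
    congr 1; field_simp
  have h2 : (α * q / c) ^ (α * q) = ((α / c) ^ α) ^ q * (q : ℝ) ^ (α * q) := by
    rw [show α * q / c = α / c * q by ring, Real.mul_rpow (by positivity) (by positivity),
      Real.rpow_mul (by positivity) α, Real.rpow_natCast]
  rwa [h1, h2] at h

lemma summable_pow_mul_exp_neg_rpow {α c : ℝ} (hα : 0 < α) (hc : 0 < c) (N : ℕ) :
    Summable (fun n : ℕ => ((n : ℝ) + 1) ^ N * Real.exp (-c * (n : ℝ) ^ (1 / α))) := by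
  have h2 : Summable (fun n : ℕ => (((n : ℝ) + 1) ^ 2)⁻¹) := by
    have := (summable_nat_add_iff 1).2 (Real.summable_nat_pow_inv.2 (one_lt_two))
    simpa using this
  have hbd : ∃ K : ℝ, ∀ n : ℕ,
      ((n : ℝ) + 1) ^ (N + 2) * Real.exp (-c * (n : ℝ) ^ (1 / α)) ≤ K := by
    -- The factor `2^(N+2)` comes from `n + 1 ≤ 2n` for `n ≥ 1`; the second summand covers `n = 0`.
    -- Two extra powers of `n + 1` leave the summable `(n + 1)⁻²`.
    refine ⟨2 ^ (N + 2) * (((α / c) ^ α) ^ (N + 2) * ((N + 2 : ℕ) : ℝ) ^ (α * (N + 2 : ℕ)))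
      + 2 ^ (N + 2), fun n => ?_⟩
    have h := pow_mul_exp_neg_rpow_le hα hc (Nat.cast_nonneg n) (N + 2)
    rcases Nat.eq_zero_or_pos n with rfl | hn
    · have h0 : (0 : ℝ) ^ (1 / α) = 0 := Real.zero_rpow (by positivity)
      simp only [Nat.cast_zero, zero_add, one_pow, h0, mul_zero, Real.exp_zero, mul_one]
      have : (1 : ℝ) ≤ 2 ^ (N + 2) := one_le_pow₀ (by norm_num)
      have h3 : 0 ≤ 2 ^ (N + 2) * (((α / c) ^ α) ^ (N + 2) *
        ((N + 2 : ℕ) : ℝ) ^ (α * (N + 2 : ℕ))) := by positivity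
      linarith
    · have hn' : (1 : ℝ) ≤ n := by exact_mod_cast hn
      calc ((n : ℝ) + 1) ^ (N + 2) * Real.exp (-c * (n : ℝ) ^ (1 / α))
          ≤ (2 * (n : ℝ)) ^ (N + 2) * Real.exp (-c * (n : ℝ) ^ (1 / α)) := by
            gcongr; linarith
        _ = 2 ^ (N + 2) * ((n : ℝ) ^ (N + 2) * Real.exp (-c * (n : ℝ) ^ (1 / α))) := by
            rw [mul_pow]; ring
        _ ≤ 2 ^ (N + 2) * (((α / c) ^ α) ^ (N + 2) *
            ((N + 2 : ℕ) : ℝ) ^ (α * (N + 2 : ℕ))) := by gcongr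
        _ ≤ _ := by linarith [show (0 : ℝ) ≤ 2 ^ (N + 2) by positivity]
  obtain ⟨K, hK⟩ := hbd
  refine Summable.of_nonneg_of_le (fun n => by positivity) (fun n => ?_) (h2.mul_left K)
  rw [← div_eq_mul_inv, le_div_iff₀ (by positivity)]
  calc _ = ((n : ℝ) + 1) ^ (N + 2) * Real.exp (-c * (n : ℝ) ^ (1 / α)) := by ring
    _ ≤ K := hK n

lemma summable_exp_neg_rpow {α c : ℝ} (hα : 0 < α) (hc : 0 < c) :
    Summable (fun n : ℕ => Real.exp (-c * (n : ℝ) ^ (1 / α))) := by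
  simpa using summable_pow_mul_exp_neg_rpow hα hc 0

/-- A factorial-type bound valid for every order forces exponential decay. -/
lemma exists_exp_decay_of_descFactorial_bound {α C A : ℝ} (hα : 1 ≤ α) (hC : 0 ≤ C)
    (hA : 0 < A) :
    ∃ c : ℝ, 0 < c ∧ ∀ (n : ℕ) (x : ℝ), 0 ≤ x →
      (∀ p ≤ n, x * (n.descFactorial p : ℝ) ≤ C * A ^ p * (p : ℝ) ^ (α * p)) →
      x ≤ C * Real.exp 1 * Real.exp (-c * (n : ℝ) ^ (1 / α)) := by
  have hα0 : 0 < α := by linarith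
  -- The order used is `p = ⌊ε n^{1/α}⌋`. The value of `δ` makes `A p^α ≤ A δ n = e⁻¹ (n/2)`, while
  -- `ε ≤ 1/2` and `α ≥ 1` give `p ≤ n/2`, hence `(n)_p ≥ (n/2)^p`. The quotient is `e^{-p}`, and
  -- the floor costs the factor `e`.
  set δ : ℝ := 1 / (2 * Real.exp 1 * A) with hδ
  have hδ0 : 0 < δ := by positivity
  set ε : ℝ := min (1 / 2) (δ ^ (1 / α)) with hε
  have hε0 : 0 < ε := lt_min (by norm_num) (by positivity)
  have hεα : ε ^ α ≤ δ := by
    calc ε ^ α ≤ (δ ^ (1 / α)) ^ α := Real.rpow_le_rpow hε0.le (min_le_right _ _) hα0.le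
      _ = δ := by rw [← Real.rpow_mul hδ0.le]; simp [hα0.ne']
  refine ⟨ε, hε0, fun n x hx h => ?_⟩
  set p : ℕ := ⌊ε * (n : ℝ) ^ (1 / α)⌋₊ with hp
  have hp1 : (p : ℝ) ≤ ε * (n : ℝ) ^ (1 / α) := Nat.floor_le (by positivity)
  have hp2 : ε * (n : ℝ) ^ (1 / α) - 1 ≤ p := by
    linarith [Nat.lt_floor_add_one (ε * (n : ℝ) ^ (1 / α))]
  have hnn : (n : ℝ) ^ (1 / α) ≤ n := by
    rcases Nat.eq_zero_or_pos n with rfl | hn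
    · simp [Real.zero_rpow (show α⁻¹ ≠ 0 by positivity)]
    · conv_rhs => rw [← Real.rpow_one (n : ℝ)]
      exact Real.rpow_le_rpow_of_exponent_le (by exact_mod_cast hn)
        (by rw [div_le_one hα0]; exact hα)
  have hp3 : (p : ℝ) ≤ n / 2 := by
    calc (p : ℝ) ≤ ε * (n : ℝ) ^ (1 / α) := hp1
      _ ≤ 1 / 2 * n := by
        gcongr
        exact min_le_left _ _
      _ = n / 2 := by ring
  have hpn : p ≤ n := by
    have : (p : ℝ) ≤ n := by linarith [show (0 : ℝ) ≤ n by positivity]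
    exact_mod_cast this
  have hpα : (p : ℝ) ^ α ≤ δ * n := by
    calc (p : ℝ) ^ α ≤ (ε * (n : ℝ) ^ (1 / α)) ^ α := Real.rpow_le_rpow (by positivity) hp1 hα0.le
      _ = ε ^ α * n := by
        rw [Real.mul_rpow hε0.le (by positivity), ← Real.rpow_mul (by positivity)]
        simp [hα0.ne']
      _ ≤ δ * n := by gcongr
  have hdf : ((n : ℝ) / 2) ^ p ≤ (n.descFactorial p : ℝ) := by
    have h1 : ((n + 1 - p : ℕ) : ℝ) ^ p ≤ (n.descFactorial p : ℝ) := by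
      exact_mod_cast Nat.pow_sub_le_descFactorial n p
    refine le_trans ?_ h1
    gcongr
    rw [Nat.cast_sub (by omega)]
    push_cast
    linarith
  have key : x ≤ C * Real.exp (-(p : ℝ)) := by
    have h2 := h p hpn
    rcases Nat.eq_zero_or_pos p with hp0 | hp0
    · rw [hp0] at h2 ⊢
      simpa using h2
    have hn0 : (0 : ℝ) < n := by
      have : (0 : ℝ) < p := by exact_mod_cast hp0
      linarith
    have h3 : x * ((n : ℝ) / 2) ^ p ≤ C * (A * (δ * n)) ^ p := by
      calc x * ((n : ℝ) / 2) ^ p ≤ x * (n.descFactorial p : ℝ) := by gcongr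
        _ ≤ C * A ^ p * (p : ℝ) ^ (α * p) := h2
        _ = C * (A * (p : ℝ) ^ α) ^ p := by
          rw [mul_pow, Real.rpow_mul (by positivity), Real.rpow_natCast]; ring
        _ ≤ C * (A * (δ * n)) ^ p := by gcongr
    have h4 : (A * (δ * n)) ^ p = Real.exp (-(p : ℝ)) * ((n : ℝ) / 2) ^ p := by
      have : A * (δ * n) = Real.exp (-1) * (n / 2) := by
        rw [hδ, Real.exp_neg]; field_simp
      rw [this, mul_pow, ← Real.exp_nat_mul]
      congr 2; ring
    rw [h4, ← mul_assoc] at h3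
    exact le_of_mul_le_mul_right h3 (by positivity)
  calc x ≤ C * Real.exp (-(p : ℝ)) := key
    _ ≤ C * Real.exp (1 + -ε * (n : ℝ) ^ (1 / α)) := by
      gcongr; linarith
    _ = _ := by rw [Real.exp_add]; ring

lemma coeffDecay_iff_exp {d : ℕ} {α : ℝ} {a : (Fin d → ℕ) → ℂ} :
    CoeffDecay α a ↔ ∃ C c : ℝ, 0 < c ∧
      ∀ n, ‖a n‖ ≤ C * Real.exp (-c * (len n : ℝ) ^ (1 / α)) := by
  constructor
  · rintro ⟨C, b, hC, hb, h⟩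
    refine ⟨C, Real.log b, Real.log_pos hb, fun n => (h n).trans_eq ?_⟩
    rw [Real.rpow_def_of_pos (by linarith)]
    congr 2; ring
  · rintro ⟨C, c, hc, h⟩
    refine ⟨|C| + 1, Real.exp c, by positivity, Real.one_lt_exp_iff.2 hc, fun n => ?_⟩
    refine (h n).trans ?_
    rw [← Real.exp_mul]
    have : C ≤ |C| + 1 := by linarith [le_abs_self C]
    calc _ ≤ (|C| + 1) * Real.exp (-c * (len n : ℝ) ^ (1 / α)) := by gcongr
      _ = _ := by congr 2; ring

/-- Exponential decay in each coordinate implies exponential decay in the length. -/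
lemma coeffDecay_of_forall_coord {d : ℕ} (hd : 1 ≤ d) {α C c : ℝ} (hα : 0 < α) (hC : 0 ≤ C)
    (hc : 0 < c) {a : (Fin d → ℕ) → ℂ}
    (h : ∀ n l, ‖a n‖ ≤ C * Real.exp (-c * (n l : ℝ) ^ (1 / α))) : CoeffDecay α a := by
  have hd0 : (0 : ℝ) < d := by exact_mod_cast hd
  refine coeffDecay_iff_exp.2 ⟨C, c * (1 / d : ℝ) ^ (1 / α), by positivity, fun n => ?_⟩
  have : Nonempty (Fin d) := ⟨⟨0, hd⟩⟩
  -- The largest coordinate is at least `|n|/d`, which costs the factor `d^{-1/α}` in the rate.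
  obtain ⟨l, hl⟩ := Finite.exists_max n
  have h1 : (len n : ℝ) ≤ d * n l := by
    have : len n ≤ d * n l := by
      calc len n ≤ ∑ _i : Fin d, n l := Finset.sum_le_sum fun i _ => hl i
        _ = d * n l := by simp
    exact_mod_cast this
  refine (h n l).trans ?_
  gcongr C * Real.exp ?_
  have h2 : (1 / d : ℝ) ^ (1 / α) * (len n : ℝ) ^ (1 / α) ≤ (n l : ℝ) ^ (1 / α) := by
    rw [← Real.mul_rpow (by positivity) (by positivity)]
    refine Real.rpow_le_rpow (by positivity) ?_ (by positivity)
    rw [one_div, inv_mul_le_iff₀ hd0]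
    exact h1
  nlinarith

/-- Each `n_l ≤ |n|`, so the average of the `n_l^{1/α}` is at most `|n|^{1/α}`. The product form
lets sums over multi-indices factor into one-dimensional sums. -/
lemma exp_neg_len_rpow_le_prod {d : ℕ} (hd : 1 ≤ d) {α c : ℝ} (hα : 0 < α) (hc : 0 < c)
    (n : Fin d → ℕ) :
    Real.exp (-c * (len n : ℝ) ^ (1 / α)) ≤
      ∏ l, Real.exp (-(c / d) * (n l : ℝ) ^ (1 / α)) := by
  have hd0 : (0 : ℝ) < d := by exact_mod_cast hd
  rw [← Real.exp_sum]
  refine Real.exp_le_exp.2 ?_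
  rw [← Finset.mul_sum]
  have h1 : ∑ l, (n l : ℝ) ^ (1 / α) ≤ d * (len n : ℝ) ^ (1 / α) := by
    calc ∑ l, (n l : ℝ) ^ (1 / α) ≤ ∑ _l : Fin d, (len n : ℝ) ^ (1 / α) := by
          refine Finset.sum_le_sum fun l _ => Real.rpow_le_rpow (by positivity) ?_ (by positivity)
          exact_mod_cast Finset.single_le_sum (f := n) (fun _ _ => Nat.zero_le _)
            (Finset.mem_univ l)
      _ = _ := by simp
  have h2 : c / d * ∑ l, (n l : ℝ) ^ (1 / α) ≤ c / d * (d * (len n : ℝ) ^ (1 / α)) := by gcongr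
  have h3 : c / d * (d * (len n : ℝ) ^ (1 / α)) = c * (len n : ℝ) ^ (1 / α) := by field_simp
  linarith

/-- Tail sums of an exponentially decaying sequence decay exponentially. -/
lemma exp_neg_add_rpow_le {α c x : ℝ} (hα : 0 < α) (hc : 0 < c) (hx : 0 ≤ x) (m : ℕ) :
    Real.exp (-c * (x + m) ^ (1 / α)) ≤
      Real.exp (-(c / 2) * x ^ (1 / α)) * Real.exp (-(c / 2) * (m : ℝ) ^ (1 / α)) := by
  rw [← Real.exp_add]
  refine Real.exp_le_exp.2 ?_
  have h1 : x ^ (1 / α) ≤ (x + m) ^ (1 / α) :=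
    Real.rpow_le_rpow hx (by linarith [show (0 : ℝ) ≤ m by positivity]) (by positivity)
  have h2 : (m : ℝ) ^ (1 / α) ≤ (x + m) ^ (1 / α) :=
    Real.rpow_le_rpow (by positivity) (by linarith) (by positivity)
  nlinarith

/-- Pass through factorials: `m^m ≤ e^m m!` for `m = p + k`, and `(p+k)! = binom(p+k,p) p! k! ≤ 2^m
p^p k^k`. -/
lemma add_pow_self_le (p k : ℕ) :
    ((p + k : ℕ) : ℝ) ^ (p + k) ≤ (2 * Real.exp 1) ^ (p + k) * ((p : ℝ) ^ p * (k : ℝ) ^ k) := by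
  have h1 : ((p + k : ℕ) : ℝ) ^ (p + k) ≤ Real.exp 1 ^ (p + k) * ((p + k).factorial : ℝ) := by
    have := Real.pow_div_factorial_le_exp ((p + k : ℕ) : ℝ) (by positivity) (p + k)
    rw [div_le_iff₀ (by positivity)] at this
    refine this.trans_eq ?_
    rw [← Real.exp_nat_mul, mul_one]
  have h2 : ((p + k).factorial : ℝ) ≤ 2 ^ (p + k) * ((p : ℝ) ^ p * (k : ℝ) ^ k) := by
    have : (p + k).factorial ≤ 2 ^ (p + k) * (p ^ p * k ^ k) := by
      rw [← Nat.add_choose_mul_factorial_mul_factorial, mul_assoc]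
      exact Nat.mul_le_mul (Nat.choose_le_two_pow _ _)
        (Nat.mul_le_mul (Nat.factorial_le_pow _) (Nat.factorial_le_pow _))
    exact_mod_cast this
  calc _ ≤ Real.exp 1 ^ (p + k) * ((p + k).factorial : ℝ) := h1
    _ ≤ Real.exp 1 ^ (p + k) * (2 ^ (p + k) * ((p : ℝ) ^ p * (k : ℝ) ^ k)) := by gcongr
    _ = _ := by rw [mul_pow]; ring

lemma natCast_rpow_mul_eq (α : ℝ) (q : ℕ) : (q : ℝ) ^ (α * q) = ((q : ℝ) ^ q) ^ α := by
  rw [← Real.rpow_natCast, ← Real.rpow_mul (by positivity), mul_comm]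

lemma sqrt_natCast_rpow (α : ℝ) (q : ℕ) :
    √((q : ℝ) ^ (α * q)) = (q : ℝ) ^ (α / 2 * q) := by
  rw [Real.sqrt_eq_rpow, ← Real.rpow_mul (by positivity)]
  congr 1; ring

lemma natCast_rpow_add_le {α : ℝ} (hα : 0 < α) (p k : ℕ) :
    ((p + k : ℕ) : ℝ) ^ (α * (p + k : ℕ)) ≤
      ((2 * Real.exp 1) ^ α) ^ (p + k) * ((p : ℝ) ^ (α * p) * (k : ℝ) ^ (α * k)) := by
  rw [natCast_rpow_mul_eq, natCast_rpow_mul_eq α p, natCast_rpow_mul_eq α k]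
  calc _ ≤ ((2 * Real.exp 1) ^ (p + k) * ((p : ℝ) ^ p * (k : ℝ) ^ k)) ^ α :=
        Real.rpow_le_rpow (by positivity) (add_pow_self_le p k) hα.le
    _ = _ := by
      rw [Real.mul_rpow (by positivity) (by positivity),
        Real.mul_rpow (by positivity) (by positivity), Real.rpow_pow_comm (by positivity)]

lemma pow_self_le_rpow {α : ℝ} (hα : 1 ≤ α) (q : ℕ) : (q : ℝ) ^ q ≤ (q : ℝ) ^ (α * q) := by
  rcases Nat.eq_zero_or_pos q with rfl | hq
  · simp
  rw [← Real.rpow_natCast]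
  refine Real.rpow_le_rpow_of_exponent_le (by exact_mod_cast hq) ?_
  nlinarith [show (0 : ℝ) < q by exact_mod_cast hq]

/-- The square root is the bound for one-dimensional weighted norms proved in
`expInt_sq_twistDeriv_le`. After squaring, `(n+q)^q ≤ 2^q (n^q + q^q)` with `q = p + k`; the
exponential absorbs `n^q`, while `q^q ≤ q^{αq}` because `α ≥ 1`, and `q^{αq}` splits into `p^{αp}
k^{αk}` up to a geometric factor. -/
lemma exists_exp_mul_sqrt_le {α c : ℝ} (hα : 1 ≤ α) (hc : 0 < c) :
    ∃ B : ℝ, 0 < B ∧ ∀ n p k : ℕ,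
      Real.exp (-c * (n : ℝ) ^ (1 / α)) * √(4 ^ k * ((n : ℝ) + p + k) ^ (p + k)) ≤
        2 * B ^ (p + k) * ((p : ℝ) ^ (α / 2 * p) * (k : ℝ) ^ (α / 2 * k)) := by
  have hα0 : 0 < α := by linarith
  set B₀ : ℝ := (α / (2 * c)) ^ α with hB₀
  have hB0 : 0 < B₀ := by positivity
  -- `8 = 4 · 2` collects `4^k ≤ 4^q` and the `2^q` from splitting `(n+q)^q`; `B₀ + 1` dominates
  -- both `B₀` and `1`.
  set R : ℝ := 8 * (B₀ + 1) * (2 * Real.exp 1) ^ α with hR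
  have hR0 : 0 < R := by positivity
  refine ⟨√R, by positivity, fun n p k => ?_⟩
  set q := p + k with hq
  have h1 : ((n : ℝ) + q) ^ q ≤ 2 ^ q * ((n : ℝ) ^ q + (q : ℝ) ^ q) := by
    rcases le_total n q with h | h
    · have h' : (n : ℝ) ≤ q := by exact_mod_cast h
      calc ((n : ℝ) + q) ^ q ≤ (2 * (q : ℝ)) ^ q := by gcongr; linarith
        _ = 2 ^ q * (0 + (q : ℝ) ^ q) := by rw [mul_pow, zero_add]
        _ ≤ _ := by gcongr; positivity
    · have h' : (q : ℝ) ≤ n := by exact_mod_cast h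
      calc ((n : ℝ) + q) ^ q ≤ (2 * (n : ℝ)) ^ q := by gcongr; linarith
        _ = 2 ^ q * ((n : ℝ) ^ q + 0) := by rw [mul_pow, add_zero]
        _ ≤ _ := by gcongr; positivity
  have h2 : Real.exp (-c * (n : ℝ) ^ (1 / α)) ^ 2 * (4 ^ k * ((n : ℝ) + p + k) ^ q) ≤
      4 * R ^ q * ((p : ℝ) ^ (α * p) * (k : ℝ) ^ (α * k)) := by
    have e1 : Real.exp (-c * (n : ℝ) ^ (1 / α)) ^ 2 = Real.exp (-(2 * c) * (n : ℝ) ^ (1 / α)) := by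
      rw [← Real.exp_nat_mul]; congr 1; push_cast; ring
    have e2 : Real.exp (-(2 * c) * (n : ℝ) ^ (1 / α)) ≤ 1 :=
      Real.exp_le_one_iff.2 (by nlinarith [show (0 : ℝ) ≤ (n : ℝ) ^ (1 / α) by positivity])
    have e3 := pow_mul_exp_neg_rpow_le hα0 (show 0 < 2 * c by positivity) (Nat.cast_nonneg n) q
    have e4 : (n : ℝ) + p + k = n + q := by rw [hq]; push_cast; ring
    have e5 := natCast_rpow_add_le hα0 p k
    have e6 : (4 : ℝ) ^ k ≤ 4 ^ q := pow_le_pow_right₀ (by norm_num) (by omega)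
    rw [e1, e4]
    set X := Real.exp (-(2 * c) * (n : ℝ) ^ (1 / α)) with hX
    have hX0 : 0 ≤ X := (Real.exp_pos _).le
    calc X * (4 ^ k * ((n : ℝ) + q) ^ q)
        ≤ X * (4 ^ q * (2 ^ q * ((n : ℝ) ^ q + (q : ℝ) ^ q))) := by gcongr
      _ = 4 ^ q * 2 ^ q * ((n : ℝ) ^ q * X + X * (q : ℝ) ^ q) := by ring
      _ ≤ 4 ^ q * 2 ^ q * (B₀ ^ q * (q : ℝ) ^ (α * q) + 1 * (q : ℝ) ^ (α * q)) := by
        gcongr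
        exact pow_self_le_rpow hα q
      _ ≤ 4 ^ q * 2 ^ q * ((B₀ + 1) ^ q * (q : ℝ) ^ (α * q) +
          (B₀ + 1) ^ q * (q : ℝ) ^ (α * q)) := by
        gcongr
        · linarith
        · exact one_le_pow₀ (by linarith)
      _ ≤ 4 * (4 ^ q * 2 ^ q * (B₀ + 1) ^ q * (q : ℝ) ^ (α * q)) := by
        have : 0 ≤ 4 ^ q * 2 ^ q * (B₀ + 1) ^ q * (q : ℝ) ^ (α * q) := by positivity
        nlinarith
      _ ≤ 4 * (4 ^ q * 2 ^ q * (B₀ + 1) ^ q * (((2 * Real.exp 1) ^ α) ^ q *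
          ((p : ℝ) ^ (α * p) * (k : ℝ) ^ (α * k)))) := by gcongr
      _ = _ := by
        rw [hR, mul_pow, mul_pow, show (8 : ℝ) = 4 * 2 by norm_num, mul_pow]; ring
  have h3 := Real.sqrt_le_sqrt h2
  rw [Real.sqrt_mul (by positivity), Real.sqrt_sq (Real.exp_pos _).le] at h3
  refine h3.trans_eq ?_
  rw [Real.sqrt_mul (by positivity), Real.sqrt_mul (by positivity),
    Real.sqrt_mul (by positivity), sqrt_natCast_rpow, sqrt_natCast_rpow,
    show √(4 : ℝ) = 2 by rw [show (4 : ℝ) = 2 ^ 2 by norm_num]; simp]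
  congr 2
  rw [Real.sqrt_eq_rpow, Real.sqrt_eq_rpow, Real.rpow_pow_comm hR0.le]

end LaguerreG

/-! ### Laguerre polynomials: identities, orthogonality, weighted norms and pointwise bounds. -/

namespace LaguerreG

open Polynomial

/-- The Laguerre polynomial of order zero as an element of `ℝ[X]`. -/
noncomputable def lagPoly (n : ℕ) : ℝ[X] :=
  ∑ k ∈ Finset.range (n + 1), C ((-1) ^ k * (n.choose k : ℝ) / (k.factorial : ℝ)) * X ^ k

lemma coeff_lagPoly (n k : ℕ) :
    (lagPoly n).coeff k = (-1) ^ k * (n.choose k : ℝ) / (k.factorial : ℝ) := by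
  simp only [lagPoly, finsetSum_coeff, coeff_C_mul_X_pow]
  rcases lt_or_ge n k with h | h
  · rw [Nat.choose_eq_zero_of_lt h]
    simp only [Nat.cast_zero, mul_zero, zero_div]
    refine Finset.sum_eq_zero fun i hi => if_neg ?_
    have := Finset.mem_range.1 hi
    omega
  · simp [Finset.sum_ite_eq, h]

lemma natDegree_lagPoly_le (n : ℕ) : (lagPoly n).natDegree ≤ n := by
  refine natDegree_le_iff_coeff_eq_zero.2 fun k hk => ?_
  rw [coeff_lagPoly, Nat.choose_eq_zero_of_lt hk]; simp

lemma lagPoly_zero : lagPoly 0 = 1 := by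
  ext k
  rw [coeff_lagPoly, coeff_one]
  cases k <;> simp

/-- Pascal's rule on coefficients. This identity is what trades a function for derivatives of one
order more in the weighted estimates below. -/
lemma lagPoly_eq_derivative_sub (n : ℕ) :
    lagPoly n = derivative (lagPoly n) - derivative (lagPoly (n + 1)) := by
  ext k
  simp only [coeff_sub, coeff_derivative, coeff_lagPoly, Nat.choose_succ_succ' n k,
    Nat.factorial_succ, Nat.cast_add, Nat.cast_mul, Nat.cast_one, pow_succ]
  field_simp
  ring

lemma X_mul_derivative_lagPoly (n : ℕ) :
    X * derivative (lagPoly (n + 1)) = C ((n : ℝ) + 1) * (lagPoly (n + 1) - lagPoly n) := by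
  ext k
  cases k with
  | zero => simp [coeff_lagPoly]
  | succ k =>
    rw [coeff_X_mul, coeff_derivative, coeff_C_mul, coeff_sub, coeff_lagPoly, coeff_lagPoly]
    have h1 : ((n + 1).choose (k + 1) : ℝ) = n.choose k + n.choose (k + 1) := by
      exact_mod_cast Nat.choose_succ_succ' n k
    have h2 : ((n : ℝ) + 1) * n.choose k = (n + 1).choose (k + 1) * (k + 1) := by
      exact_mod_cast Nat.add_one_mul_choose_eq n k
    have h3 : ((n : ℝ) + 1) * ((n + 1).choose (k + 1) - n.choose (k + 1)) =
      (n + 1).choose (k + 1) * (k + 1) := by rw [← h2, h1]; ring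
    field_simp
    linear_combination -h3

lemma X_mul_lagPoly_succ (n : ℕ) :
    X * lagPoly (n + 1) = C (2 * (n : ℝ) + 3) * lagPoly (n + 1) - C ((n : ℝ) + 1) * lagPoly n
      - C ((n : ℝ) + 2) * lagPoly (n + 2) := by
  conv_lhs => rw [lagPoly_eq_derivative_sub (n + 1), mul_sub, X_mul_derivative_lagPoly,
    X_mul_derivative_lagPoly]
  simp only [map_add, map_mul, map_one, map_natCast, Nat.cast_add, Nat.cast_one, map_ofNat]
  ring

lemma X_mul_lagPoly_zero : X * lagPoly 0 = lagPoly 0 - lagPoly 1 := by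
  ext k
  rcases k with _ | _ | k <;>
    simp [coeff_lagPoly, coeff_X_mul, Nat.choose_eq_zero_of_lt]

/-- Laguerre's equation `t y'' + (1 - t) y' + n y = 0`, checked on coefficients and then
differentiated `p` times. -/
lemma lagPoly_ode (n p : ℕ) :
    X * derivative^[p + 2] (lagPoly n) + (C ((p : ℝ) + 1) - X) * derivative^[p + 1] (lagPoly n)
      + C ((n : ℝ) - p) * derivative^[p] (lagPoly n) = 0 := by
  induction p with
  | zero =>
    ext k
    simp only [Function.iterate_succ, Function.iterate_zero, Function.comp, id]
    cases k with
    | zero =>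
      simp [sub_mul, coeff_zero_eq_eval_zero]
      have := coeff_lagPoly n 0
      have h1 := coeff_lagPoly n 1
      rw [coeff_zero_eq_eval_zero] at this
      have h2 : eval 0 (derivative (lagPoly n)) = -n := by
        rw [← coeff_zero_eq_eval_zero, coeff_derivative]; simp [h1]
      rw [this, h2]; simp
    | succ k =>
      simp only [sub_mul, coeff_add, coeff_sub, coeff_C_mul, coeff_X_mul, coeff_derivative,
        coeff_lagPoly, coeff_zero, Nat.cast_zero, Nat.factorial_succ]
      have h2 : ((n.choose (k + 1 + 1) : ℕ) : ℝ) * (k + 1 + 1) = n.choose (k + 1) * (n - (k + 1)) := by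
        rcases Nat.lt_or_ge n (k + 1) with h | h
        · rw [Nat.choose_eq_zero_of_lt h, Nat.choose_eq_zero_of_lt (by omega)]; simp
        · have := Nat.choose_succ_right_eq n (k + 1)
          have h3 : ((n - (k + 1) : ℕ) : ℝ) = n - (k + 1) := by
            rw [Nat.cast_sub h]; push_cast; ring
          rw [← h3]
          exact_mod_cast this
      push_cast
      field_simp
      linear_combination (-1 : ℝ) ^ k * h2
  | succ p ih =>
    have := congrArg derivative ih
    simp only [derivative_add, derivative_mul, derivative_sub, derivative_X, derivative_C,
      derivative_zero, ← Function.iterate_succ_apply' (derivative : ℝ[X] → ℝ[X])] at this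
    simp only [map_add, map_sub, map_one, map_natCast, Nat.cast_add, Nat.cast_one] at this ⊢
    rw [← this]
    ring

/-- The functional `P ↦ ∫_0^∞ P(t) e^{-t} dt` on polynomials. -/
noncomputable def expInt : ℝ[X] →ₗ[ℝ] ℝ := Polynomial.lsum fun k =>
  LinearMap.lsmul ℝ ℝ (k.factorial : ℝ)

lemma expInt_X_pow (k : ℕ) : expInt (X ^ k) = (k.factorial : ℝ) := by
  rw [← monomial_one_right_eq_X_pow]
  simp [expInt]

lemma expInt_derivative (P : ℝ[X]) : expInt (derivative P) = expInt P - P.eval 0 := by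
  induction P using Polynomial.induction_on' with
  | add p q hp hq => simp only [map_add, hp, hq, eval_add]; ring
  | monomial k a =>
    have h : ∀ (j : ℕ) (b : ℝ), expInt (monomial j b) = b * j.factorial := by
      intro j b; simp [expInt, mul_comm]
    rw [derivative_monomial, h, h]
    cases k with
    | zero => simp
    | succ k =>
      simp only [Nat.add_sub_cancel, Nat.factorial_succ, eval_monomial]
      push_cast
      ring

/-- Laguerre's equation in divergence form is `(t^{p+1} e^{-t} L_n^{(p+1)})' = -(n-p) t^p e^{-t}
L_n^{(p)}`. Multiply by `Q^{(p)}` and integrate by parts; the boundary term at `0` vanishes thanks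
to `t^{p+1}`. -/
lemma expInt_ibp (Q : ℝ[X]) (n p : ℕ) :
    ((n : ℝ) - p) * expInt (derivative^[p] Q * (X ^ p * derivative^[p] (lagPoly n))) =
      expInt (derivative^[p + 1] Q * (X ^ (p + 1) * derivative^[p + 1] (lagPoly n))) := by
  set U := derivative^[p] Q * (X ^ (p + 1) * derivative^[p + 1] (lagPoly n)) with hU
  have h1 := expInt_derivative U
  have h2 : derivative U =
      derivative^[p + 1] Q * (X ^ (p + 1) * derivative^[p + 1] (lagPoly n)) + U
      - C ((n : ℝ) - p) * (derivative^[p] Q * (X ^ p * derivative^[p] (lagPoly n))) := by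
    have ode := lagPoly_ode n p
    rw [hU]
    simp only [derivative_mul, derivative_X_pow, ← Function.iterate_succ_apply'
      (derivative : ℝ[X] → ℝ[X]), Nat.add_sub_cancel]
    simp only [map_add, map_one, map_natCast, Nat.cast_add, Nat.cast_one, map_sub,
      pow_succ] at ode ⊢
    linear_combination (derivative^[p] Q * X ^ p) * ode
  have h3 : U.eval 0 = 0 := by simp [hU]
  rw [h2, h3, map_sub, map_add, ← smul_eq_C_mul, map_smul, smul_eq_mul] at h1
  linarith

lemma expInt_mul_iterate (Q : ℝ[X]) (n p : ℕ) :
    expInt (derivative^[p] Q * (X ^ p * derivative^[p] (lagPoly n))) =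
      (n.descFactorial p : ℝ) * expInt (Q * lagPoly n) := by
  induction p with
  | zero => simp
  | succ p ih =>
    rw [← expInt_ibp, ih, Nat.descFactorial_succ, Nat.cast_mul, ← mul_assoc]
    -- For `n < p` the factor `n - p` is negative, but the falling factorial is already zero.
    rcases Nat.lt_or_ge n p with h | h
    · rw [Nat.descFactorial_of_lt h]; simp
    · rw [Nat.cast_sub h]

/-- Moving `n` derivatives onto `Q` kills it. -/
lemma expInt_mul_lagPoly_eq_zero {Q : ℝ[X]} {n : ℕ} (h : Q.natDegree < n) :
    expInt (Q * lagPoly n) = 0 := by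
  have := expInt_mul_iterate Q n n
  rw [iterate_derivative_eq_zero h, Nat.descFactorial_self] at this
  simp only [zero_mul, map_zero] at this
  exact (mul_eq_zero.1 this.symm).resolve_left (by positivity)

lemma iterate_derivative_lagPoly_self (n : ℕ) : derivative^[n] (lagPoly n) = C ((-1) ^ n) := by
  ext k
  rw [coeff_iterate_derivative, coeff_lagPoly, coeff_C]
  cases k with
  | zero =>
    simp [Nat.descFactorial_self]
    field_simp
  | succ k => simp [Nat.choose_eq_zero_of_lt (show n < k + 1 + n by omega)]

lemma expInt_lagPoly_mul_self (n : ℕ) : expInt (lagPoly n * lagPoly n) = 1 := by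
  have := expInt_mul_iterate (lagPoly n) n n
  rw [iterate_derivative_lagPoly_self, Nat.descFactorial_self] at this
  have h2 : (C ((-1 : ℝ) ^ n)) * (X ^ n * C ((-1 : ℝ) ^ n)) = X ^ n := by
    rw [mul_comm (X ^ n), ← mul_assoc, ← C_mul, ← mul_pow]; simp
  rw [h2, expInt_X_pow] at this
  have h3 : (n.factorial : ℝ) ≠ 0 := by positivity
  field_simp at this
  linarith

lemma expInt_lagPoly_mul (m n : ℕ) :
    expInt (lagPoly m * lagPoly n) = if m = n then 1 else 0 := by
  rcases lt_trichotomy m n with h | rfl | h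
  · rw [if_neg h.ne, expInt_mul_lagPoly_eq_zero ((natDegree_lagPoly_le m).trans_lt h)]
  · rw [if_pos rfl, expInt_lagPoly_mul_self]
  · rw [if_neg h.ne', mul_comm, expInt_mul_lagPoly_eq_zero ((natDegree_lagPoly_le n).trans_lt h)]

lemma expInt_X_pow_mul_sq (n p : ℕ) :
    expInt (X ^ p * derivative^[p] (lagPoly n) ^ 2) = n.descFactorial p := by
  have := expInt_mul_iterate (lagPoly n) n p
  rw [expInt_lagPoly_mul_self, mul_one] at this
  rw [← this]; congr 1; ring

lemma integrableOn_eval_mul_exp (P : ℝ[X]) {c : ℝ} (hc : 0 < c) :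
    IntegrableOn (fun t : ℝ => P.eval t * Real.exp (-(c * t))) (Ioi 0) := by
  induction P using Polynomial.induction_on' with
  | add p q hp hq =>
    simp only [eval_add, add_mul]
    exact hp.add hq
  | monomial k a =>
    have := (integrableOn_rpow_mul_exp_neg_mul_rpow (s := k) (p := 1) (b := c)
      (by linarith [show (0 : ℝ) ≤ k by positivity]) one_pos hc).const_mul a
    refine IntegrableOn.congr_fun this (fun t _ => ?_) measurableSet_Ioi
    simp only [eval_monomial, Real.rpow_natCast, Real.rpow_one, neg_mul]
    ring

lemma integral_eval_mul_exp (P : ℝ[X]) :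
    ∫ t in Ioi (0 : ℝ), P.eval t * Real.exp (-t) = expInt P := by
  induction P using Polynomial.induction_on' with
  | add p q hp hq =>
    simp only [eval_add, add_mul, map_add]
    rw [← hp, ← hq]
    have h := fun P => integrableOn_eval_mul_exp P one_pos
    simp only [one_mul] at h
    exact integral_add (h p) (h q)
  | monomial k a =>
    have h : expInt (monomial k a) = a * k.factorial := by simp [expInt, mul_comm]
    rw [h, ← Real.Gamma_nat_eq_factorial, Real.Gamma_eq_integral (by positivity),
      ← integral_const_mul]
    refine setIntegral_congr_fun measurableSet_Ioi fun t _ => ?_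
    simp only [eval_monomial, add_sub_cancel_right, Real.rpow_natCast]
    ring

lemma expInt_nonneg {P : ℝ[X]} (h : ∀ t : ℝ, 0 < t → 0 ≤ P.eval t) : 0 ≤ expInt P := by
  rw [← integral_eval_mul_exp]
  exact setIntegral_nonneg measurableSet_Ioi fun t ht => mul_nonneg (h t ht) (Real.exp_pos _).le

/-- The operator `P ↦ P' - P/2`, which describes differentiation of `P(t) e^{-t/2}`. -/
noncomputable def twistDeriv : ℝ[X] →ₗ[ℝ] ℝ[X] := derivative - (1 / 2 : ℝ) • LinearMap.id

lemma twistDeriv_apply (P : ℝ[X]) : twistDeriv P = derivative P - (1 / 2 : ℝ) • P := rfl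

lemma twistDeriv_derivative (P : ℝ[X]) :
    twistDeriv (derivative P) = derivative (twistDeriv P) := by
  simp [twistDeriv_apply]

lemma twistDeriv_iterate_derivative (P : ℝ[X]) (j : ℕ) :
    twistDeriv (derivative^[j] P) = derivative^[j] (twistDeriv P) := by
  induction j with
  | zero => rfl
  | succ j ih => rw [Function.iterate_succ_apply', Function.iterate_succ_apply',
      twistDeriv_derivative, ih]

/-- Writing the undifferentiated term as a difference of derivatives leaves only first derivatives.
Thus every derivative of `L_n e^{-t/2}` raises the order of differentiation of the polynomial, as
the growing weight `t^{(p+k)/2}` requires. -/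
lemma twistDeriv_lagPoly (n : ℕ) : twistDeriv (lagPoly n) =
    (1 / 2 : ℝ) • (derivative (lagPoly n) + derivative (lagPoly (n + 1))) := by
  rw [twistDeriv_apply]
  nth_rw 2 [lagPoly_eq_derivative_sub n]
  module

lemma twistDeriv_iterate_lagPoly (n j : ℕ) : twistDeriv (derivative^[j] (lagPoly n)) =
    (1 / 2 : ℝ) • (derivative^[j + 1] (lagPoly n) + derivative^[j + 1] (lagPoly (n + 1))) := by
  rw [twistDeriv_iterate_derivative, twistDeriv_lagPoly, iterate_derivative_smul,
    iterate_map_add, ← Function.iterate_succ_apply, ← Function.iterate_succ_apply]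

/-- Parallelogram law for the seminorm with weight `t^q e^{-t}`. -/
lemma expInt_sq_add_le (q : ℕ) (P Q : ℝ[X]) :
    expInt (X ^ q * ((1 / 2 : ℝ) • (P + Q)) ^ 2) ≤
      (expInt (X ^ q * P ^ 2) + expInt (X ^ q * Q ^ 2)) / 2 := by
  have h : 0 ≤ expInt (X ^ q * (P - Q) ^ 2) :=
    expInt_nonneg fun t ht => by simp only [eval_mul, eval_pow, eval_X]; positivity
  have e : X ^ q * ((1 / 2 : ℝ) • (P + Q)) ^ 2 = (1 / 2 : ℝ) • (X ^ q * P ^ 2)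
      + (1 / 2 : ℝ) • (X ^ q * Q ^ 2) - (1 / 4 : ℝ) • (X ^ q * (P - Q) ^ 2) := by
    rw [_root_.smul_pow, mul_smul_comm]
    have : (P + Q) ^ 2 = (2 : ℝ) • P ^ 2 + (2 : ℝ) • Q ^ 2 - (P - Q) ^ 2 := by
      rw [two_smul, two_smul]; ring
    rw [this, mul_sub, mul_add, mul_smul_comm, mul_smul_comm]
    module
  rw [e]
  simp only [map_add, map_sub, map_smul, smul_eq_mul]
  linarith

lemma expInt_sq_sub_le (q : ℕ) (P Q : ℝ[X]) :
    expInt (X ^ q * (P - Q) ^ 2) ≤ 2 * (expInt (X ^ q * P ^ 2) + expInt (X ^ q * Q ^ 2)) := by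
  have h := expInt_sq_add_le q P (-Q)
  rw [_root_.smul_pow, mul_smul_comm, map_smul, smul_eq_mul, ← sub_eq_add_neg, neg_sq] at h
  linarith

/-- The exact formula needs the power of `t` to equal the order of differentiation. Each of the `m`
surplus powers is matched by `L_n^{(j)} = L_n^{(j+1)} - L_{n+1}^{(j+1)}`, at the cost of a factor
`4` and a shift of `n` by one. -/
lemma expInt_sq_iterate_derivative_le (m : ℕ) : ∀ n j : ℕ,
    expInt (X ^ (j + m) * derivative^[j] (lagPoly n) ^ 2) ≤ 4 ^ m * ((n : ℝ) + m) ^ (j + m) := by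
  induction m with
  | zero =>
    intro n j
    rw [add_zero, expInt_X_pow_mul_sq]
    simpa using (show (n.descFactorial j : ℝ) ≤ (n : ℝ) ^ j by
      exact_mod_cast Nat.descFactorial_le_pow n j)
  | succ m ih =>
    intro n j
    have e : derivative^[j] (lagPoly n) =
        derivative^[j + 1] (lagPoly n) - derivative^[j + 1] (lagPoly (n + 1)) := by
      conv_lhs => rw [lagPoly_eq_derivative_sub n]
      rw [iterate_derivative_sub, ← Function.iterate_succ_apply, ← Function.iterate_succ_apply]
    rw [e, show j + (m + 1) = j + 1 + m by ring]
    refine (expInt_sq_sub_le _ _ _).trans ?_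
    have h1 := ih n (j + 1)
    have h2 := ih (n + 1) (j + 1)
    have h3 : ((n : ℝ) + m) ^ (j + 1 + m) ≤ ((n : ℝ) + (m + 1 : ℕ)) ^ (j + 1 + m) := by
      gcongr; simp
    have h4 : ((n + 1 : ℕ) : ℝ) + m = (n : ℝ) + (m + 1 : ℕ) := by push_cast; ring
    rw [h4] at h2
    rw [pow_succ (4 : ℝ)]
    nlinarith [show (0 : ℝ) < 4 ^ m by positivity]

/-- A twisted derivative is an average of two ordinary derivatives with indices `n` and `n + 1`. By
convexity of the square averaging costs no constant, only the shift of `n`. -/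
lemma expInt_sq_twistDeriv_le (i : ℕ) : ∀ n j m : ℕ,
    expInt (X ^ (i + j + m) * (twistDeriv^[i] (derivative^[j] (lagPoly n))) ^ 2) ≤
      4 ^ m * ((n : ℝ) + i + m) ^ (i + j + m) := by
  induction i with
  | zero => intro n j m; simpa using expInt_sq_iterate_derivative_le m n j
  | succ i ih =>
    intro n j m
    have e : twistDeriv^[i + 1] (derivative^[j] (lagPoly n)) = (1 / 2 : ℝ) •
        (twistDeriv^[i] (derivative^[j + 1] (lagPoly n)) +
          twistDeriv^[i] (derivative^[j + 1] (lagPoly (n + 1)))) := by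
      rw [Function.iterate_succ_apply, twistDeriv_iterate_lagPoly]
      simp only [← Module.End.coe_pow, map_smul, map_add]
    rw [e, show i + 1 + j + m = i + (j + 1) + m by ring]
    refine (expInt_sq_add_le _ _ _).trans ?_
    have h1 := ih n (j + 1) m
    have h2 := ih (n + 1) (j + 1) m
    have h3 : ((n : ℝ) + i + m) ^ (i + (j + 1) + m) ≤
        ((n : ℝ) + (i + 1 : ℕ) + m) ^ (i + (j + 1) + m) := by
      gcongr; simp
    have h4 : ((n + 1 : ℕ) : ℝ) + i + m = (n : ℝ) + (i + 1 : ℕ) + m := by push_cast; ring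
    rw [h4] at h2
    nlinarith [show (0 : ℝ) < 4 ^ m by positivity]

/-- `L_{n+1}' = L_n' - L_n` is an orthogonal sum, since `L_n'` has lower degree than `L_n`; each
step adds `1`. -/
lemma expInt_derivative_lagPoly_sq (n : ℕ) :
    expInt (derivative (lagPoly n) ^ 2) = n := by
  induction n with
  | zero => simp [lagPoly_zero]
  | succ n ih =>
    have e : derivative (lagPoly (n + 1)) = derivative (lagPoly n) - lagPoly n := by
      linear_combination lagPoly_eq_derivative_sub n
    have h0 : expInt (derivative (lagPoly n) * lagPoly n) = 0 := by
      rcases Nat.eq_zero_or_pos n with rfl | hn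
      · simp [lagPoly_zero]
      · refine expInt_mul_lagPoly_eq_zero ((natDegree_derivative_le _).trans_lt ?_)
        have := natDegree_lagPoly_le n
        omega
    have h1 : (derivative (lagPoly n) - lagPoly n) ^ 2 = derivative (lagPoly n) ^ 2
        - (2 : ℝ) • (derivative (lagPoly n) * lagPoly n) + lagPoly n * lagPoly n := by
      rw [two_smul]; ring
    rw [e, h1, map_add, map_sub, map_smul, h0, ih, expInt_lagPoly_mul_self]
    simp

lemma tendsto_eval_mul_exp (P : ℝ[X]) {c : ℝ} (hc : 0 < c) :
    Tendsto (fun t : ℝ => P.eval t * Real.exp (-(c * t))) atTop (𝓝 0) := by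
  induction P using Polynomial.induction_on' with
  | add p q hp hq => simpa only [eval_add, add_mul, add_zero] using hp.add hq
  | monomial k a =>
    have := (Real.tendsto_pow_mul_exp_neg_atTop_nhds_zero k).comp
      (tendsto_id.const_mul_atTop hc)
    have h2 := this.const_mul (a / c ^ k)
    rw [mul_zero] at h2
    refine h2.congr fun t => ?_
    simp only [Function.comp, id, eval_monomial, mul_pow]
    field_simp

/-- A Sobolev-type bound for polynomials with the weight `e^{-t}`. -/
lemma sq_eval_mul_exp_le (P : ℝ[X]) {t : ℝ} (ht : 0 ≤ t) :
    P.eval t ^ 2 * Real.exp (-t) ≤ 2 * expInt (P ^ 2) + expInt (derivative P ^ 2) := by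
  have hint := fun P : ℝ[X] => integrableOn_eval_mul_exp P one_pos
  have hlim := tendsto_eval_mul_exp (P ^ 2) one_pos
  simp only [one_mul] at hint hlim
  have hd : ∀ s ∈ Ici t, HasDerivAt (fun s : ℝ => (P ^ 2).eval s * Real.exp (-s))
      ((derivative (P ^ 2) - P ^ 2).eval s * Real.exp (-s)) s := by
    intro s _
    have h1 := ((P ^ 2).hasDerivAt s).mul ((hasDerivAt_neg s).exp)
    refine h1.congr_deriv ?_
    simp only [eval_sub]; ring
  have hI := integral_Ioi_of_hasDerivAt_of_tendsto' hd
    ((hint _).mono_set (Ioi_subset_Ioi ht)) hlim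
  have h2 : P.eval t ^ 2 * Real.exp (-t) =
      ∫ s in Ioi t, (P ^ 2 - derivative (P ^ 2)).eval s * Real.exp (-s) := by
    have : ∀ s : ℝ, (P ^ 2 - derivative (P ^ 2)).eval s * Real.exp (-s) =
        -((derivative (P ^ 2) - P ^ 2).eval s * Real.exp (-s)) := by
      intro s; simp only [eval_sub]; ring
    simp only [this]
    rw [integral_neg, hI]; simp
  rw [h2]
  have h3 : 2 * expInt (P ^ 2) + expInt (derivative P ^ 2) =
      expInt ((2 : ℝ) • P ^ 2 + derivative P ^ 2) := by simp
  rw [h3, ← integral_eval_mul_exp]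
  calc _ ≤ ∫ s in Ioi t, ((2 : ℝ) • P ^ 2 + derivative P ^ 2).eval s * Real.exp (-s) := by
        refine setIntegral_mono_on ((hint _).mono_set (Ioi_subset_Ioi ht))
          ((hint _).mono_set (Ioi_subset_Ioi ht)) measurableSet_Ioi fun s _ => ?_
        refine mul_le_mul_of_nonneg_right ?_ (Real.exp_pos _).le
        simp only [sq, derivative_mul, eval_sub, eval_add, eval_mul, eval_smul, smul_eq_mul]
        -- `P² - 2PP' ≤ 2P² + P'²` is `(P + P')² ≥ 0`.
        nlinarith [sq_nonneg (P.eval s + (derivative P).eval s)]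
    _ ≤ _ := by
        refine setIntegral_mono_set (hint _) ?_ (Ioi_subset_Ioi ht).eventuallyLE
        refine (ae_restrict_iff' measurableSet_Ioi).2 (ae_of_all _ fun s _ => ?_)
        simp only [Pi.zero_apply, eval_add, eval_smul, eval_pow, smul_eq_mul]
        positivity

lemma abs_lagPoly_mul_exp_le (n : ℕ) {t : ℝ} (ht : 0 ≤ t) :
    |(lagPoly n).eval t * Real.exp (-t / 2)| ≤ 2 * ((n : ℝ) + 1) := by
  have h := sq_eval_mul_exp_le (lagPoly n) ht
  rw [expInt_derivative_lagPoly_sq, sq (lagPoly n), expInt_lagPoly_mul_self] at h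
  refine abs_le_of_sq_le_sq ?_ (by positivity)
  rw [mul_pow, ← Real.exp_nat_mul]
  have : ((2 : ℕ) : ℝ) * (-t / 2) = -t := by push_cast; ring
  rw [this]
  nlinarith [show (0 : ℝ) ≤ n by positivity]

/-- The three-term recurrence replaces a factor `t` by neighbouring indices with coefficients of
size `O(n)`. Polynomial growth in `n` is harmless against the coefficient decay. -/
lemma exists_bound_X_pow_mul_lagPoly (k : ℕ) : ∃ (C : ℝ) (N : ℕ), 0 ≤ C ∧ ∀ (n : ℕ) (t : ℝ), 0 ≤ t →
    |t ^ k * ((lagPoly n).eval t * Real.exp (-t / 2))| ≤ C * ((n : ℝ) + 1) ^ N := by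
  induction k with
  | zero => exact ⟨2, 1, by norm_num, fun n t ht => by simpa using abs_lagPoly_mul_exp_le n ht⟩
  | succ k ih =>
    obtain ⟨C, N, hC, h⟩ := ih
    -- At index `n + 1` the recurrence coefficients add up to `4n + 6 ≤ 6(n + 2)`, and the indices
    -- involved, at most `n + 2`, cost `3^N`.
    refine ⟨C * 6 * 3 ^ N, N + 1, by positivity, fun n t ht => ?_⟩
    cases n with
    | zero =>
      have e := congrArg (eval t) X_mul_lagPoly_zero
      simp only [eval_mul, eval_X, eval_sub] at e
      have e2 : t ^ (k + 1) * ((lagPoly 0).eval t * Real.exp (-t / 2)) =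
        t ^ k * ((lagPoly 0).eval t * Real.exp (-t / 2)) -
        t ^ k * ((lagPoly 1).eval t * Real.exp (-t / 2)) := by
        rw [pow_succ]; linear_combination t ^ k * Real.exp (-t / 2) * e
      rw [e2]
      have h0 := h 0 t ht
      have h1 := h 1 t ht
      refine (abs_sub _ _).trans ((add_le_add h0 h1).trans ?_)
      have a1 : ((1 : ℕ) + 1 : ℝ) ^ N ≤ 3 ^ N := by gcongr; norm_num
      have a2 : (1 : ℝ) ≤ 3 ^ N := one_le_pow₀ (by norm_num)
      simp only [Nat.cast_zero, zero_add, one_pow, mul_one] at *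
      nlinarith
    | succ n =>
      have e := congrArg (eval t) (X_mul_lagPoly_succ n)
      simp only [eval_mul, eval_X, eval_sub, eval_C] at e
      set E := Real.exp (-t / 2)
      have e2 : t ^ (k + 1) * ((lagPoly (n + 1)).eval t * E) =
        (2 * n + 3) * (t ^ k * ((lagPoly (n + 1)).eval t * E)) -
        (n + 1) * (t ^ k * ((lagPoly n).eval t * E)) -
        (n + 2) * (t ^ k * ((lagPoly (n + 2)).eval t * E)) := by
        rw [pow_succ]; linear_combination t ^ k * E * e
      have hb : ∀ m ≤ n + 2, |t ^ k * ((lagPoly m).eval t * E)| ≤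
          C * 3 ^ N * ((n + 1 : ℕ) + 1 : ℝ) ^ N := by
        intro m hm
        refine (h m t ht).trans ?_
        rw [mul_assoc, ← mul_pow]
        have : (m : ℝ) ≤ n + 2 := by exact_mod_cast hm
        gcongr
        push_cast
        linarith [show (0 : ℝ) ≤ n by positivity]
      set K := C * 3 ^ N * ((n + 1 : ℕ) + 1 : ℝ) ^ N with hK
      rw [e2]
      calc _ ≤ (2 * n + 3) * K + (n + 1) * K + (n + 2) * K := by
            refine (abs_sub _ _).trans (add_le_add ((abs_sub _ _).trans (add_le_add ?_ ?_)) ?_) <;>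
            · rw [abs_mul, abs_of_nonneg (by positivity)]
              exact mul_le_mul_of_nonneg_left (hb _ (by omega)) (by positivity)
        _ ≤ 6 * ((n + 1 : ℕ) + 1) * K := by
            have : 0 ≤ K := by positivity
            push_cast
            nlinarith [show (0 : ℝ) ≤ n by positivity]
        _ = _ := by rw [hK]; ring

/-- `L_{n+1}^{(p+1)} = L_n^{(p+1)} - L_n^{(p)}`: the next derivative is a sum of about `n` terms
already bounded, so one more power of `n` suffices. -/
lemma exists_bound_X_pow_mul_derivative_lagPoly (k p : ℕ) :
    ∃ (C : ℝ) (N : ℕ), 0 ≤ C ∧ ∀ (n : ℕ) (t : ℝ), 0 ≤ t →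
    |t ^ k * ((derivative^[p] (lagPoly n)).eval t * Real.exp (-t / 2))| ≤
      C * ((n : ℝ) + 1) ^ N := by
  induction p with
  | zero => exact exists_bound_X_pow_mul_lagPoly k
  | succ p ih =>
    obtain ⟨C, N, hC, h⟩ := ih
    refine ⟨C, N + 1, hC, fun n t ht => ?_⟩
    induction n with
    | zero =>
      rw [lagPoly_zero, Function.iterate_succ_apply, derivative_one, iterate_derivative_zero]
      simp [hC]
    | succ n ihn =>
      have e : derivative^[p + 1] (lagPoly (n + 1)) =
          derivative^[p + 1] (lagPoly n) - derivative^[p] (lagPoly n) := by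
        conv_rhs => enter [2]; rw [lagPoly_eq_derivative_sub n]
        rw [iterate_derivative_sub, ← Function.iterate_succ_apply, ← Function.iterate_succ_apply]
        ring
      rw [e, eval_sub, sub_mul, mul_sub]
      refine (abs_sub _ _).trans ((add_le_add ihn (h n t ht)).trans ?_)
      push_cast
      have a1 : ((n : ℝ) + 1) ^ N ≤ ((n : ℝ) + 1 + 1) ^ N := by gcongr; simp
      calc C * ((n : ℝ) + 1) ^ (N + 1) + C * ((n : ℝ) + 1) ^ N
          = C * ((n + 1 + 1) * ((n : ℝ) + 1) ^ N) := by ring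
        _ ≤ C * ((n + 1 + 1) * ((n : ℝ) + 1 + 1) ^ N) := by gcongr
        _ = _ := by ring

/-- All functions `t^k (d/dt)^q (L_n(t) e^{-t/2})` are bounded on `[0, ∞)`, polynomially in `n`. -/
lemma exists_bound_X_pow_mul_twistDeriv_lagPoly (k q : ℕ) : ∀ p : ℕ,
    ∃ (C : ℝ) (N : ℕ), 0 ≤ C ∧ ∀ (n : ℕ) (t : ℝ), 0 ≤ t →
    |t ^ k * ((twistDeriv^[q] (derivative^[p] (lagPoly n))).eval t * Real.exp (-t / 2))| ≤
      C * ((n : ℝ) + 1) ^ N := by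
  induction q with
  | zero => exact exists_bound_X_pow_mul_derivative_lagPoly k
  | succ q ih =>
    intro p
    obtain ⟨C, N, hC, h⟩ := ih (p + 1)
    obtain ⟨C', N', hC', h'⟩ := ih p
    refine ⟨C + C', N + N', by positivity, fun n t ht => ?_⟩
    have e : twistDeriv^[q + 1] (derivative^[p] (lagPoly n)) =
        twistDeriv^[q] (derivative^[p + 1] (lagPoly n)) -
          (1 / 2 : ℝ) • twistDeriv^[q] (derivative^[p] (lagPoly n)) := by
      rw [Function.iterate_succ_apply, twistDeriv_apply, Function.iterate_succ_apply']
      simp only [← Module.End.coe_pow, map_smul, map_sub]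
    rw [e, eval_sub, eval_smul, smul_eq_mul, sub_mul, mul_sub]
    have h1 := h n t ht
    have h2 := h' n t ht
    have b1 : (1 : ℝ) ≤ (n : ℝ) + 1 := by simp
    have a1 : ((n : ℝ) + 1) ^ N ≤ ((n : ℝ) + 1) ^ (N + N') := pow_le_pow_right₀ b1 (by omega)
    have a2 : ((n : ℝ) + 1) ^ N' ≤ ((n : ℝ) + 1) ^ (N + N') := pow_le_pow_right₀ b1 (by omega)
    refine (abs_sub _ _).trans ?_
    have e3 : t ^ k * (1 / 2 * (twistDeriv^[q] (derivative^[p] (lagPoly n))).eval t *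
      Real.exp (-t / 2)) = 1 / 2 * (t ^ k * ((twistDeriv^[q] (derivative^[p] (lagPoly n))).eval t *
      Real.exp (-t / 2))) := by ring
    rw [e3, abs_mul (1 / 2 : ℝ), abs_of_pos (show (0 : ℝ) < 1 / 2 by norm_num), add_mul]
    refine add_le_add (h1.trans (by gcongr)) ?_
    calc _ ≤ 1 * (C' * ((n : ℝ) + 1) ^ N') := by gcongr; norm_num
      _ ≤ _ := by rw [one_mul]; gcongr

lemma hasDerivAt_eval_mul_exp (P : ℝ[X]) (t : ℝ) :
    HasDerivAt (fun t : ℝ => P.eval t * Real.exp (-t / 2))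
      ((twistDeriv P).eval t * Real.exp (-t / 2)) t := by
  have h1 : HasDerivAt (fun t : ℝ => Real.exp (-t / 2)) (Real.exp (-t / 2) * (-1 / 2)) t :=
    ((hasDerivAt_neg t).div_const 2).exp
  refine ((P.hasDerivAt t).mul h1).congr_deriv ?_
  simp only [twistDeriv_apply, eval_sub, eval_smul, smul_eq_mul]; ring

/-- Leibniz's rule applied to the Rodrigues formula. -/
lemma laguerrePoly_eq_eval (n : ℕ) (t : ℝ) : laguerrePoly n t = (lagPoly n).eval t := by
  have hexp : ∀ i : ℕ, iteratedDeriv i (fun s : ℝ => Real.exp (-s)) =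
      fun s => (-1) ^ i * Real.exp (-s) := by
    intro i
    have := iteratedDeriv_comp_const_mul (n := i) (f := Real.exp) Real.contDiff_exp (-1)
    simp only [neg_mul, one_mul, iteratedDeriv_eq_iterate, Real.iter_deriv_exp] at this ⊢
    exact this
  have hmul : iteratedDeriv n (fun s : ℝ => Real.exp (-s) * s ^ n) t =
      ∑ i ∈ Finset.range (n + 1), (n.choose i : ℝ) *
        iteratedDeriv i (fun s : ℝ => Real.exp (-s)) t *
        iteratedDeriv (n - i) (fun s : ℝ => s ^ n) t :=
    iteratedDeriv_fun_mul (by fun_prop) (by fun_prop)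
  rw [laguerrePoly, hmul, lagPoly, eval_finsetSum, Finset.mul_sum]
  refine Finset.sum_congr rfl fun i hi => ?_
  have hi' : i ≤ n := Nat.lt_succ_iff.1 (Finset.mem_range.1 hi)
  rw [hexp]
  have hp : iteratedDeriv (n - i) (fun s : ℝ => s ^ n) t =
      (n.descFactorial (n - i) : ℝ) * t ^ i := by
    simp [Nat.sub_sub_self hi']
  rw [hp]
  simp only [eval_mul, eval_C, eval_pow, eval_X]
  have h1 : (n.descFactorial (n - i) : ℝ) * i.factorial = n.factorial := by
    have := Nat.factorial_mul_descFactorial (Nat.sub_le n i)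
    rw [Nat.sub_sub_self hi', mul_comm] at this
    exact_mod_cast this
  have h2 : Real.exp t * Real.exp (-t) = 1 := by rw [← Real.exp_add]; simp
  have h3 : (n.factorial : ℝ) ≠ 0 := by positivity
  have h4 : (i.factorial : ℝ) ≠ 0 := by positivity
  field_simp
  linear_combination (n.choose i : ℝ) * t ^ i * (n.factorial : ℝ) * h2 +
    (n.choose i : ℝ) * t ^ i * Real.exp t * Real.exp (-t) * h1

end LaguerreG

/-! ### Multiple series: products, iterated partial derivatives, termwise differentiation. -/

namespace LaguerreG

section ProductSeries

variable {R : Type*} [NormedField R]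

lemma summable_norm_prod_pi {d : ℕ} {f : Fin d → ℕ → R} (hf : ∀ l, Summable fun k => ‖f l k‖) :
    Summable (fun n : Fin d → ℕ => ‖∏ l, f l (n l)‖) := by
  induction d with
  | zero => exact Summable.of_finite
  | succ d ih =>
    have h1 := ih (f := fun l => f l.succ) fun l => hf l.succ
    have h := Summable.mul_norm (hf 0) h1
    refine (Equiv.summable_iff (Fin.consEquiv fun _ : Fin (d + 1) => ℕ)).1 ?_
    refine h.congr fun x => ?_
    simp [Fin.prod_univ_succ, Fin.consEquiv]

lemma tsum_prod_pi [CompleteSpace R] {d : ℕ} {f : Fin d → ℕ → R} (hf : ∀ l, Summable fun k => ‖f l k‖) :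
    ∑' n : Fin d → ℕ, ∏ l, f l (n l) = ∏ l, ∑' k, f l k := by
  induction d with
  | zero => simp
  | succ d ih =>
    rw [← (Fin.consEquiv fun _ : Fin (d + 1) => ℕ).tsum_eq, Fin.prod_univ_succ,
      ← ih (f := fun l => f l.succ) fun l => hf l.succ,
      tsum_mul_tsum_of_summable_norm (hf 0)
        (summable_norm_prod_pi (f := fun l => f l.succ) fun l => hf l.succ)]
    refine tsum_congr fun x => ?_
    simp [Fin.prod_univ_succ, Fin.consEquiv]

end ProductSeries

lemma summable_prod_pi {d : ℕ} {f : Fin d → ℕ → ℝ} (hf0 : ∀ l k, 0 ≤ f l k)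
    (hf : ∀ l, Summable (f l)) : Summable (fun n : Fin d → ℕ => ∏ l, f l (n l)) := by
  have := summable_norm_prod_pi (f := f) fun l => (hf l).norm
  refine this.congr fun n => ?_
  rw [Real.norm_of_nonneg (Finset.prod_nonneg fun l _ => hf0 l _)]

section PartialDerivatives

variable {𝕜 : Type} [NontriviallyNormedField 𝕜] [NormedSpace 𝕜 ℂ] {d : ℕ}
  {U : Set (Fin d → 𝕜)}

lemma pderiv_eqOn (hU : IsOpen U) (l : Fin d) {f g : (Fin d → 𝕜) → ℂ} (h : EqOn f g U) :
    EqOn (pderiv 𝕜 l f) (pderiv 𝕜 l g) U := fun _ hx =>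
  (h.eventuallyEq_of_mem (hU.mem_nhds hx)).lineDeriv_eq

lemma iterate_pderiv_eqOn (hU : IsOpen U) {G : (Fin d → ℕ) → (Fin d → 𝕜) → ℂ}
    (hG : ∀ q l, EqOn (pderiv 𝕜 l (G q)) (G (q + Pi.single l 1)) U) (l : Fin d)
    {f : (Fin d → 𝕜) → ℂ} {q : Fin d → ℕ} (hf : EqOn f (G q) U) (k : ℕ) :
    EqOn ((pderiv 𝕜 l)^[k] f) (G (q + Pi.single l k)) U := by
  induction k with
  | zero => simpa using hf
  | succ k ih =>
    rw [Function.iterate_succ_apply', Pi.single_add, ← add_assoc]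
    exact (pderiv_eqOn hU l ih).trans (hG _ l)

/-- A family indexed by multi-indices and closed under partial derivatives must consist of the
iterated derivatives. The fold meets each variable once, so the index reached is `p` restricted to
the variables processed; no commutation of derivatives is needed. -/
lemma mderiv_eqOn_family (hU : IsOpen U) {G : (Fin d → ℕ) → (Fin d → 𝕜) → ℂ}
    (hG : ∀ q l, EqOn (pderiv 𝕜 l (G q)) (G (q + Pi.single l 1)) U)
    {f : (Fin d → 𝕜) → ℂ} (hf : EqOn f (G 0) U) (p : Fin d → ℕ) :
    EqOn (mderiv 𝕜 p f) (G p) U := by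
  have key : ∀ L : List (Fin d), L.Nodup →
      EqOn (L.foldr (fun l g => (pderiv 𝕜 l)^[p l] g) f)
        (G fun l => if l ∈ L then p l else 0) U := by
    intro L
    induction L with
    | nil => intro _; simp only [List.foldr_nil, List.not_mem_nil, if_false]; exact hf
    | cons l L ih =>
      intro hL
      rw [List.nodup_cons] at hL
      have h := iterate_pderiv_eqOn hU hG l (ih hL.2) (p l)
      rw [List.foldr_cons]
      convert h using 2
      ext j
      by_cases hj : j = l
      · subst hj; simp [hL.1]
      · simp [hj]
  have h := key _ (List.nodup_finRange d)
  simp only [List.mem_finRange, if_true] at h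
  exact h

lemma mderiv_single (l : Fin d) (k : ℕ) (f : (Fin d → 𝕜) → ℂ) :
    mderiv 𝕜 (Pi.single l k) f = (pderiv 𝕜 l)^[k] f := by
  have key : ∀ L : List (Fin d), L.Nodup →
      L.foldr (fun j g => (pderiv 𝕜 j)^[(Pi.single l k : Fin d → ℕ) j] g) f =
        if l ∈ L then (pderiv 𝕜 l)^[k] f else f := by
    intro L
    induction L with
    | nil => intro _; simp
    | cons j L ih =>
      intro hL
      rw [List.nodup_cons] at hL
      rw [List.foldr_cons, ih hL.2]
      by_cases hj : j = l
      · subst hj; simp [hL.1]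
      · simp [hj, Ne.symm hj]
  have h := key _ (List.nodup_finRange d)
  rwa [if_pos (List.mem_finRange l)] at h

end PartialDerivatives

section Series

variable {𝕜 : Type} {d : ℕ}

/-- The series `∑_n c_n ∏_l u_{n_l}^{(q_l)}(x_l)`, where `u n q` plays the role of the `q`-th
derivative of `u n`. -/
noncomputable def mseries (c : (Fin d → ℕ) → ℂ) (u : ℕ → ℕ → 𝕜 → ℂ) (q : Fin d → ℕ)
    (x : Fin d → 𝕜) : ℂ := ∑' n : Fin d → ℕ, c n * ∏ l, u (n l) (q l) (x l)

variable {c : (Fin d → ℕ) → ℂ} {u : ℕ → ℕ → 𝕜 → ℂ} {V : Set 𝕜} {b : ℕ → ℕ → ℝ}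

lemma norm_mseries_term_le (hb : ∀ n q, ∀ x ∈ V, ‖u n q x‖ ≤ b n q) (n q : Fin d → ℕ)
    {x : Fin d → 𝕜} (hx : x ∈ Set.pi univ fun _ => V) :
    ‖c n * ∏ l, u (n l) (q l) (x l)‖ ≤ ‖c n‖ * ∏ l, b (n l) (q l) := by
  rw [norm_mul, norm_prod]
  refine mul_le_mul_of_nonneg_left ?_ (norm_nonneg _)
  exact Finset.prod_le_prod (fun l _ => norm_nonneg _) fun l _ => hb _ _ _ (hx l (mem_univ l))

lemma summable_mseries (hb : ∀ n q, ∀ x ∈ V, ‖u n q x‖ ≤ b n q)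
    (hs : ∀ q : Fin d → ℕ, Summable fun n : Fin d → ℕ => ‖c n‖ * ∏ l, b (n l) (q l))
    (q : Fin d → ℕ) {x : Fin d → 𝕜} (hx : x ∈ Set.pi univ fun _ => V) :
    Summable fun n : Fin d → ℕ => c n * ∏ l, u (n l) (q l) (x l) :=
  Summable.of_norm_bounded (hs q) fun n => norm_mseries_term_le hb n q hx

lemma continuousOn_mseries [TopologicalSpace 𝕜] (hu : ∀ n q, ContinuousOn (u n q) V)
    (hb : ∀ n q, ∀ x ∈ V, ‖u n q x‖ ≤ b n q)
    (hs : ∀ q : Fin d → ℕ, Summable fun n : Fin d → ℕ => ‖c n‖ * ∏ l, b (n l) (q l))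
    (q : Fin d → ℕ) : ContinuousOn (mseries c u q) (Set.pi univ fun _ => V) := by
  refine continuousOn_tsum (fun n => ?_) (hs q) fun n x hx => norm_mseries_term_le hb n q hx
  refine continuousOn_const.mul (continuousOn_finsetProd _ fun l _ => ?_)
  exact (hu _ _).comp (continuous_apply l).continuousOn fun x hx => hx l (mem_univ l)

variable [RCLike 𝕜] [NormedAlgebra 𝕜 ℂ]

variable (𝕜) in
/-- The linear form with prescribed partial derivatives `z`. -/
noncomputable def gradForm (z : Fin d → ℂ) : (Fin d → 𝕜) →L[𝕜] ℂ :=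
  ∑ l, (ContinuousLinearMap.proj l : (Fin d → 𝕜) →L[𝕜] 𝕜).smulRight (z l)

lemma gradForm_apply (z : Fin d → ℂ) (y : Fin d → 𝕜) : gradForm 𝕜 z y = ∑ l, y l • z l := by
  simp [gradForm]

lemma gradForm_single (z : Fin d → ℂ) (l : Fin d) :
    gradForm 𝕜 z (Pi.single l 1) = z l := by
  rw [gradForm_apply, Finset.sum_eq_single l]
  · simp
  · intro j _ hj; simp [hj]
  · simp

lemma norm_gradForm_le (z : Fin d → ℂ) : ‖gradForm 𝕜 z‖ ≤ ∑ l, ‖z l‖ := by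
  refine ContinuousLinearMap.opNorm_le_bound _ (by positivity) fun y => ?_
  rw [gradForm_apply, Finset.sum_mul]
  refine (norm_sum_le _ _).trans (Finset.sum_le_sum fun l _ => ?_)
  rw [norm_smul, mul_comm]
  exact mul_le_mul_of_nonneg_left (norm_le_pi_norm y l) (norm_nonneg _)

lemma hasSum_gradForm {ι : Type*} {z : ι → Fin d → ℂ} {Z : Fin d → ℂ}
    (h : ∀ l, HasSum (fun i => z i l) (Z l)) :
    HasSum (fun i => gradForm 𝕜 (z i)) (gradForm 𝕜 Z) := by
  refine hasSum_sum fun l _ => ?_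
  exact (ContinuousLinearMap.smulRightL 𝕜 (Fin d → 𝕜) ℂ (ContinuousLinearMap.proj l)).hasSum (h l)

lemma hasFDerivAt_mseries_term (hu : ∀ n q, ∀ x ∈ V, HasDerivAt (u n q) (u n (q + 1) x) x)
    (n q : Fin d → ℕ) {x : Fin d → 𝕜} (hx : x ∈ Set.pi univ fun _ => V) :
    HasFDerivAt (fun x : Fin d → 𝕜 => c n * ∏ l, u (n l) (q l) (x l))
      (gradForm 𝕜 fun l => c n * ∏ j, u (n j) ((q + Pi.single l 1 : Fin d → ℕ) j) (x j)) x := by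
  have h1 : ∀ l ∈ Finset.univ, HasFDerivAt (fun x : Fin d → 𝕜 => u (n l) (q l) (x l))
      ((ContinuousLinearMap.proj l : (Fin d → 𝕜) →L[𝕜] 𝕜).smulRight
        (u (n l) (q l + 1) (x l))) x := by
    intro l _
    have h2 := (hu (n l) (q l) (x l) (hx l (mem_univ l))).hasFDerivAt
    have h3 := h2.comp x (ContinuousLinearMap.proj (R := 𝕜) (φ := fun _ : Fin d => 𝕜) l).hasFDerivAt
    refine h3.congr_fderiv ?_
    ext y
    simp
  have h := (HasFDerivAt.finsetProd h1).const_mul (c n)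
  refine h.congr_fderiv ?_
  ext y
  rw [gradForm_apply]
  simp only [FunLike.coe_smul, Pi.smul_apply, FunLike.coe_sum, Finset.sum_apply,
    ContinuousLinearMap.smulRight_apply, ContinuousLinearMap.proj_apply, smul_eq_mul,
    Finset.mul_sum]
  refine Finset.sum_congr rfl fun l _ => ?_
  rw [← Finset.prod_erase_mul Finset.univ _ (Finset.mem_univ l)]
  have h4 : ∏ j ∈ Finset.univ.erase l, u (n j) ((q + Pi.single l 1 : Fin d → ℕ) j) (x j) =
      ∏ j ∈ Finset.univ.erase l, u (n j) (q j) (x j) :=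
    Finset.prod_congr rfl fun j hj => by simp [Finset.ne_of_mem_erase hj]
  rw [h4]
  simp only [Pi.add_apply, Pi.single_eq_same, mul_smul_comm]

/-- The partial derivatives of the terms are again terms of series of the same kind, dominated
uniformly on the box, so the series may be differentiated termwise. This serves both the half-line
(Laguerre series) and complex discs (power series). -/
lemma hasFDerivAt_mseries (hV : IsOpen V) (hVc : IsPreconnected V)
    (hu : ∀ n q, ∀ x ∈ V, HasDerivAt (u n q) (u n (q + 1) x) x)
    (hb : ∀ n q, ∀ x ∈ V, ‖u n q x‖ ≤ b n q)
    (hs : ∀ q : Fin d → ℕ, Summable fun n : Fin d → ℕ => ‖c n‖ * ∏ l, b (n l) (q l))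
    (q : Fin d → ℕ) {x : Fin d → 𝕜} (hx : x ∈ Set.pi univ fun _ => V) :
    HasFDerivAt (mseries c u q) (gradForm 𝕜 fun l => mseries c u (q + Pi.single l 1) x) x := by
  have h := hasFDerivAt_tsum_of_isPreconnected (𝕜 := 𝕜)
    (u := fun n : Fin d → ℕ => ∑ l, ‖c n‖ * ∏ j, b (n j) ((q + Pi.single l 1 : Fin d → ℕ) j))
    (summable_sum fun l _ => hs (q + Pi.single l 1))
    (isOpen_set_pi finite_univ fun _ _ => hV) (isPreconnected_univ_pi fun _ => hVc)
    (fun n x hx => hasFDerivAt_mseries_term (c := c) hu n q hx)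
    (fun n x hx => (norm_gradForm_le _).trans
      (Finset.sum_le_sum fun l _ => norm_mseries_term_le hb n _ hx)) hx
    (summable_mseries hb hs q hx) hx
  have h2 := hasSum_gradForm (𝕜 := 𝕜)
    (z := fun n : Fin d → ℕ => fun l => c n * ∏ j, u (n j) ((q + Pi.single l 1 : Fin d → ℕ) j) (x j))
    fun l => (summable_mseries hb hs (q + Pi.single l 1) hx).hasSum
  rw [h2.tsum_eq] at h
  exact h

lemma pderiv_mseries (hV : IsOpen V) (hVc : IsPreconnected V)
    (hu : ∀ n q, ∀ x ∈ V, HasDerivAt (u n q) (u n (q + 1) x) x)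
    (hb : ∀ n q, ∀ x ∈ V, ‖u n q x‖ ≤ b n q)
    (hs : ∀ q : Fin d → ℕ, Summable fun n : Fin d → ℕ => ‖c n‖ * ∏ l, b (n l) (q l))
    (q : Fin d → ℕ) (l : Fin d) :
    EqOn (pderiv 𝕜 l (mseries c u q)) (mseries c u (q + Pi.single l 1))
      (Set.pi univ fun _ => V) := fun x hx => by
  have h := ((hasFDerivAt_mseries hV hVc hu hb hs q hx).hasLineDerivAt (Pi.single l 1)).lineDeriv
  rw [gradForm_single] at h
  exact h

lemma mderiv_mseries (hV : IsOpen V) (hVc : IsPreconnected V)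
    (hu : ∀ n q, ∀ x ∈ V, HasDerivAt (u n q) (u n (q + 1) x) x)
    (hb : ∀ n q, ∀ x ∈ V, ‖u n q x‖ ≤ b n q)
    (hs : ∀ q : Fin d → ℕ, Summable fun n : Fin d → ℕ => ‖c n‖ * ∏ l, b (n l) (q l))
    (p : Fin d → ℕ) :
    EqOn (mderiv 𝕜 p (mseries c u 0)) (mseries c u p) (Set.pi univ fun _ => V) :=
  mderiv_eqOn_family (isOpen_set_pi finite_univ fun _ _ => hV)
    (pderiv_mseries hV hVc hu hb hs) (fun _ _ => rfl) p

/-- Bootstrap: the derivative is a continuous linear image of series of the same form, so each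
degree of smoothness follows from the previous one for all `q` at once. -/
lemma contDiffOn_mseries (hV : IsOpen V) (hVc : IsPreconnected V)
    (hu : ∀ n q, ∀ x ∈ V, HasDerivAt (u n q) (u n (q + 1) x) x)
    (hb : ∀ n q, ∀ x ∈ V, ‖u n q x‖ ≤ b n q)
    (hs : ∀ q : Fin d → ℕ, Summable fun n : Fin d → ℕ => ‖c n‖ * ∏ l, b (n l) (q l))
    (q : Fin d → ℕ) : ContDiffOn 𝕜 ∞ (mseries c u q) (Set.pi univ fun _ => V) := by
  have hO : IsOpen (Set.pi univ fun _ : Fin d => V) := isOpen_set_pi finite_univ fun _ _ => hV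
  refine contDiffOn_infty.2 fun m => ?_
  induction m generalizing q with
  | zero =>
    refine contDiffOn_zero.2 fun x hx => ?_
    exact (hasFDerivAt_mseries hV hVc hu hb hs q hx).continuousAt.continuousWithinAt
  | succ m ih =>
    have : ((m + 1 : ℕ) : WithTop ℕ∞) = (m : WithTop ℕ∞) + 1 := by push_cast; rfl
    rw [this, contDiffOn_succ_iff_hasFDerivWithinAt_of_uniqueDiffOn hO.uniqueDiffOn]
    refine ⟨fun h => absurd h (by simp), _, ?_, fun x hx =>
      (hasFDerivAt_mseries hV hVc hu hb hs q hx).hasFDerivWithinAt⟩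
    refine ContDiffOn.sum fun l _ => ?_
    exact (ContinuousLinearMap.smulRightL 𝕜 (Fin d → 𝕜) ℂ
      (ContinuousLinearMap.proj l)).contDiff.comp_contDiffOn (ih (q + Pi.single l 1))

end Series

lemma isOpen_orthant (d : ℕ) : IsOpen (orthant d) := by
  have : orthant d = Set.pi univ fun _ => Ioi 0 := by ext; simp [orthant]
  rw [this]
  exact isOpen_set_pi finite_univ fun _ _ => isOpen_Ioi

lemma contDiffOn_pderiv {d : ℕ} {f : (Fin d → ℝ) → ℂ} {U : Set (Fin d → ℝ)} (hU : IsOpen U)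
    (hf : ContDiffOn ℝ ∞ f U) (l : Fin d) : ContDiffOn ℝ ∞ (pderiv ℝ l f) U := by
  have h := ((contDiffOn_infty_iff_fderiv_of_isOpen hU).1 hf).2.clm_apply
    (contDiffOn_const (c := (Pi.single l 1 : Fin d → ℝ)))
  refine h.congr fun x hx => ?_
  exact ((hf.contDiffAt (hU.mem_nhds hx)).differentiableAt (by simp)).lineDeriv_eq_fderiv

lemma contDiffOn_iterate_pderiv {d : ℕ} {f : (Fin d → ℝ) → ℂ} {U : Set (Fin d → ℝ)}
    (hU : IsOpen U) (hf : ContDiffOn ℝ ∞ f U) (l : Fin d) (k : ℕ) :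
    ContDiffOn ℝ ∞ ((pderiv ℝ l)^[k] f) U := by
  induction k with
  | zero => exact hf
  | succ k ih => rw [Function.iterate_succ_apply']; exact contDiffOn_pderiv hU ih l

end LaguerreG

/-! ### Laguerre functions on the orthant: `L²` norms, orthonormality, coefficients. -/

namespace LaguerreG

open Polynomial

section OrthantIntegrals

variable {d : ℕ}

lemma orthant_eq_pi (d : ℕ) : orthant d = Set.pi univ fun _ => Ioi 0 := by ext; simp [orthant]

lemma measurableSet_orthant (d : ℕ) : MeasurableSet (orthant d) :=
  (isOpen_orthant d).measurableSet

lemma orthantMeasure_eq_pi (d : ℕ) :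
    orthantMeasure d = Measure.pi fun _ => (volume : Measure ℝ).restrict (Ioi 0) := by
  rw [orthantMeasure, orthant_eq_pi, volume_pi, Measure.restrict_pi_pi]

lemma ae_mem_orthant (d : ℕ) : ∀ᵐ t ∂orthantMeasure d, t ∈ orthant d :=
  ae_restrict_mem (measurableSet_orthant d)

/-- The function `∏_l P_l(t_l) e^{-t_l/2}`. -/
noncomputable def polyFun (P : Fin d → ℝ[X]) (t : Fin d → ℝ) : ℝ :=
  ∏ l, (P l).eval (t l) * Real.exp (-(t l) / 2)

lemma laguerreFun_eq_polyFun (n : Fin d → ℕ) :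
    (laguerreFun n : (Fin d → ℝ) → ℝ) = polyFun fun l => lagPoly (n l) := by
  ext t
  simp [laguerreFun, polyFun, laguerrePoly_eq_eval]

lemma continuous_polyFun (P : Fin d → ℝ[X]) : Continuous (polyFun P) := by
  refine continuous_finsetProd _ fun l _ => ?_
  exact ((P l).continuous.comp (continuous_apply l)).mul (by fun_prop)

lemma integrable_prod_eval_mul_exp (P : Fin d → ℝ[X]) {c : ℝ} (hc : 0 < c) :
    Integrable (fun t : Fin d → ℝ => ∏ l, (P l).eval (t l) * Real.exp (-(c * t l)))
      (orthantMeasure d) := by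
  rw [orthantMeasure_eq_pi]
  exact Integrable.fintype_prod (f := fun l (s : ℝ) => (P l).eval s * Real.exp (-(c * s)))
    fun l => integrableOn_eval_mul_exp (P l) hc

lemma integrable_polyFun (P : Fin d → ℝ[X]) : Integrable (polyFun P) (orthantMeasure d) := by
  refine (integrable_prod_eval_mul_exp P (c := 1 / 2) (by norm_num)).congr (ae_of_all _ fun t => ?_)
  refine Finset.prod_congr rfl fun l _ => ?_
  congr 2; ring

lemma integral_prod_eval_mul_exp (P : Fin d → ℝ[X]) :
    ∫ t, ∏ l, (P l).eval (t l) * Real.exp (-(t l)) ∂orthantMeasure d = ∏ l, expInt (P l) := by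
  rw [orthantMeasure_eq_pi, integral_fintype_prod_eq_prod
    (f := fun l (s : ℝ) => (P l).eval s * Real.exp (-s))]
  exact Finset.prod_congr rfl fun l _ => integral_eval_mul_exp (P l)

lemma polyFun_mul_polyFun (P Q : Fin d → ℝ[X]) (t : Fin d → ℝ) :
    polyFun P t * polyFun Q t = ∏ l, (P l * Q l).eval (t l) * Real.exp (-(t l)) := by
  rw [polyFun, polyFun, ← Finset.prod_mul_distrib]
  refine Finset.prod_congr rfl fun l _ => ?_
  have : Real.exp (-(t l)) = Real.exp (-(t l) / 2) * Real.exp (-(t l) / 2) := by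
    rw [← Real.exp_add]; congr 1; ring
  rw [this, eval_mul]; ring

lemma integral_polyFun_mul (P Q : Fin d → ℝ[X]) :
    ∫ t, polyFun P t * polyFun Q t ∂orthantMeasure d = ∏ l, expInt (P l * Q l) := by
  simp only [polyFun_mul_polyFun]
  exact integral_prod_eval_mul_exp fun l => P l * Q l

lemma integral_laguerreFun_mul (m n : Fin d → ℕ) :
    ∫ t, laguerreFun m t * laguerreFun n t ∂orthantMeasure d = if m = n then 1 else 0 := by
  rw [laguerreFun_eq_polyFun, laguerreFun_eq_polyFun, integral_polyFun_mul]
  simp only [expInt_lagPoly_mul]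
  split_ifs with h
  · subst h; simp
  · obtain ⟨l, hl⟩ := Function.ne_iff.1 h
    exact Finset.prod_eq_zero (Finset.mem_univ l) (if_neg hl)

/-- Squaring removes the half-integer exponents, so weighted `L²` norms reduce to products of
`expInt` of polynomials. -/
lemma sq_mpow_mul_polyFun {q : Fin d → ℕ} {s : Fin d → ℝ} (hs : ∀ l, s l = (q l : ℝ) / 2)
    (P : Fin d → ℝ[X]) {t : Fin d → ℝ} (ht : t ∈ orthant d) :
    (mpow t s * polyFun P t) ^ 2 =
      ∏ l, (X ^ q l * P l ^ 2).eval (t l) * Real.exp (-(t l)) := by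
  have h1 : mpow t s ^ 2 = ∏ l, t l ^ q l := by
    rw [mpow, ← Finset.prod_pow]
    refine Finset.prod_congr rfl fun l _ => ?_
    rw [← Real.rpow_natCast, ← Real.rpow_mul (ht l).le, hs, ← Real.rpow_natCast]
    congr 1; push_cast; ring
  rw [mul_pow, h1, sq (polyFun P t), polyFun_mul_polyFun, ← Finset.prod_mul_distrib]
  refine Finset.prod_congr rfl fun l _ => ?_
  simp only [eval_mul, eval_pow, eval_X]; ring

lemma measurable_mpow (s : Fin d → ℝ) : Measurable fun t : Fin d → ℝ => mpow t s := by
  unfold mpow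
  fun_prop

lemma memLp_mpow_mul_polyFun {q : Fin d → ℕ} {s : Fin d → ℝ} (hs : ∀ l, s l = (q l : ℝ) / 2)
    (P : Fin d → ℝ[X]) :
    MemLp (fun t => ((mpow t s * polyFun P t : ℝ) : ℂ)) 2 (orthantMeasure d) := by
  have hm : Measurable fun t => ((mpow t s * polyFun P t : ℝ) : ℂ) :=
    Complex.measurable_ofReal.comp ((measurable_mpow s).mul (continuous_polyFun P).measurable)
  refine (memLp_two_iff_integrable_sq_norm hm.aestronglyMeasurable).2 ?_
  have h := integrable_prod_eval_mul_exp (fun l => X ^ q l * P l ^ 2) one_pos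
  simp only [one_mul] at h
  refine h.congr ?_
  filter_upwards [ae_mem_orthant d] with t ht
  rw [Complex.norm_real, Real.norm_eq_abs, sq_abs, sq_mpow_mul_polyFun hs P ht]

lemma eLpNorm_mpow_mul_polyFun {q : Fin d → ℕ} {s : Fin d → ℝ} (hs : ∀ l, s l = (q l : ℝ) / 2)
    (P : Fin d → ℝ[X]) :
    eLpNorm (fun t => ((mpow t s * polyFun P t : ℝ) : ℂ)) 2 (orthantMeasure d) =
      ENNReal.ofReal √(∏ l, expInt (X ^ q l * P l ^ 2)) := by
  rw [(memLp_mpow_mul_polyFun hs P).eLpNorm_eq_integral_rpow_norm (by norm_num) (by norm_num),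
    ← integral_prod_eval_mul_exp, Real.sqrt_eq_rpow]
  have h : ∫ t, ‖((mpow t s * polyFun P t : ℝ) : ℂ)‖ ^ (2 : ENNReal).toReal ∂orthantMeasure d =
      ∫ t, ∏ l, (X ^ q l * P l ^ 2).eval (t l) * Real.exp (-(t l)) ∂orthantMeasure d := by
    refine integral_congr_ae ?_
    filter_upwards [ae_mem_orthant d] with t ht
    rw [← sq_mpow_mul_polyFun hs P ht, Complex.norm_real, Real.norm_eq_abs]
    norm_num
    rw [← abs_mul, sq_abs]
  rw [h]
  norm_num

lemma mpow_zero (t : Fin d → ℝ) : mpow t (fun _ => 0) = 1 := by simp [mpow]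

lemma memLp_polyFun (P : Fin d → ℝ[X]) :
    MemLp (fun t => (polyFun P t : ℂ)) 2 (orthantMeasure d) := by
  have h := memLp_mpow_mul_polyFun (d := d) (q := 0) (s := fun _ => 0) (by simp) P
  simpa only [mpow_zero, one_mul] using h

lemma eLpNorm_laguerreFun (n : Fin d → ℕ) :
    eLpNorm (fun t => (laguerreFun n t : ℂ)) 2 (orthantMeasure d) = 1 := by
  have h := eLpNorm_mpow_mul_polyFun (d := d) (q := 0) (s := fun _ => 0) (by simp)
    fun l => lagPoly (n l)
  simpa [mpow_zero, one_mul, laguerreFun_eq_polyFun, sq, expInt_lagPoly_mul_self] using h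

lemma memLp_laguerreFun (n : Fin d → ℕ) :
    MemLp (fun t => (laguerreFun n t : ℂ)) 2 (orthantMeasure d) := by
  rw [laguerreFun_eq_polyFun]; exact memLp_polyFun _

end OrthantIntegrals

section CauchySchwarz

variable {Ω : Type*} [MeasurableSpace Ω] {μ : Measure Ω} {f g : Ω → ℂ}

lemma integrable_mul_of_memLp_two (hf : MemLp f 2 μ) (hg : MemLp g 2 μ) :
    Integrable (fun t => f t * g t) μ := hf.integrable_mul hg

lemma integral_norm_mul_le (hf : MemLp f 2 μ) (hg : MemLp g 2 μ) :
    ∫ t, ‖f t * g t‖ ∂μ ≤ (eLpNorm f 2 μ).toReal * (eLpNorm g 2 μ).toReal := by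
  have h := eLpNorm_smul_le_mul_eLpNorm (p := 2) (q := 2) (r := 1) hg.1 hf.1
  have h2 : ∫ t, ‖f t * g t‖ ∂μ = (eLpNorm (f • g) 1 μ).toReal := by
    rw [eLpNorm_one_eq_lintegral_enorm,
      integral_norm_eq_lintegral_enorm (integrable_mul_of_memLp_two hf hg).1]
    rfl
  rw [h2, ← ENNReal.toReal_mul]
  exact ENNReal.toReal_mono (ENNReal.mul_ne_top hf.2.ne hg.2.ne) h

end CauchySchwarz

section Coefficients

variable {d : ℕ} {f : (Fin d → ℝ) → ℂ}

lemma integrable_mul_laguerreFun (hf : MemLp f 2 (orthantMeasure d)) (n : Fin d → ℕ) :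
    Integrable (fun t => f t * (laguerreFun n t : ℂ)) (orthantMeasure d) :=
  integrable_mul_of_memLp_two hf (memLp_laguerreFun n)

lemma integral_norm_mul_laguerreFun_le (hf : MemLp f 2 (orthantMeasure d)) (n : Fin d → ℕ) :
    ∫ t, ‖f t * (laguerreFun n t : ℂ)‖ ∂orthantMeasure d ≤
      (eLpNorm f 2 (orthantMeasure d)).toReal := by
  have h := integral_norm_mul_le hf (memLp_laguerreFun n)
  rwa [eLpNorm_laguerreFun, ENNReal.toReal_one, mul_one] at h

lemma norm_laguerreCoeff_le (hf : MemLp f 2 (orthantMeasure d)) (n : Fin d → ℕ) :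
    ‖laguerreCoeff f n‖ ≤ (eLpNorm f 2 (orthantMeasure d)).toReal :=
  (norm_integral_le_integral_norm _).trans (integral_norm_mul_laguerreFun_le hf n)

/-- The Laguerre functions as an orthonormal family. -/
lemma orthonormal_laguerreFun (d : ℕ) :
    Orthonormal ℂ fun n : Fin d → ℕ => (memLp_laguerreFun n).toLp := by
  classical
  rw [orthonormal_iff_ite]
  intro m n
  rw [L2.inner_def]
  have h : ∫ t, inner ℂ ((memLp_laguerreFun m).toLp _ t) ((memLp_laguerreFun n).toLp _ t)
      ∂orthantMeasure d =
      ∫ t, ((laguerreFun m t * laguerreFun n t : ℝ) : ℂ) ∂orthantMeasure d := by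
    refine integral_congr_ae ?_
    filter_upwards [(memLp_laguerreFun m).coeFn_toLp, (memLp_laguerreFun n).coeFn_toLp]
      with t h1 h2
    rw [h1, h2]
    simp [mul_comm]
  rw [h, integral_complex_ofReal, integral_laguerreFun_mul]
  split_ifs <;> simp

/-- Bessel's inequality makes the squared coefficients summable. -/
lemma tendsto_laguerreCoeff (hf : MemLp f 2 (orthantMeasure d)) :
    Tendsto (laguerreCoeff f) cofinite (𝓝 0) := by
  have h := ((orthonormal_laguerreFun d).inner_products_summable (x := hf.toLp)).tendsto_cofinite_zero
  have h2 : ∀ n, inner ℂ ((memLp_laguerreFun n).toLp) (hf.toLp) = laguerreCoeff f n := by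
    intro n
    rw [L2.inner_def]
    refine integral_congr_ae ?_
    filter_upwards [(memLp_laguerreFun n).coeFn_toLp, hf.coeFn_toLp] with t h1 h2
    rw [h1, h2]
    simp
  simp only [h2] at h
  rw [tendsto_zero_iff_norm_tendsto_zero]
  have h3 := (Real.continuous_sqrt.tendsto 0).comp h
  rw [Real.sqrt_zero] at h3
  refine h3.congr fun n => ?_
  simp [Real.sqrt_sq]

end Coefficients

/-! ### The generating function and the series expansion of the transform. -/

section GeneratingFunction

lemma summable_norm_laguerre_mul_pow {w : ℂ} (hw : ‖w‖ < 1) {t : ℝ} (ht : 0 ≤ t) :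
    Summable fun n : ℕ =>
      ‖(((lagPoly n).eval t * Real.exp (-t / 2) : ℝ) : ℂ) * w ^ n‖ := by
  have h1 : Summable fun n : ℕ => 2 * ((n : ℝ) * ‖w‖ ^ n + ‖w‖ ^ n) := by
    refine (Summable.add ?_ (summable_geometric_of_lt_one (norm_nonneg _) hw)).mul_left 2
    simpa using summable_pow_mul_geometric_of_norm_lt_one 1 (r := ‖w‖) (by simpa using hw)
  refine Summable.of_nonneg_of_le (fun n => norm_nonneg _) (fun n => ?_) h1
  rw [norm_mul, norm_pow, Complex.norm_real, Real.norm_eq_abs]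
  calc _ ≤ 2 * ((n : ℝ) + 1) * ‖w‖ ^ n := by
        gcongr; exact abs_lagPoly_mul_exp_le n ht
    _ = _ := by ring

lemma eval_lagPoly_eq_sum (n : ℕ) (t : ℝ) : (((lagPoly n).eval t : ℝ) : ℂ) =
    ∑ k ∈ Finset.range (n + 1), (n.choose k : ℂ) * ((-t : ℂ) ^ k / (k.factorial : ℂ)) := by
  rw [lagPoly, eval_finsetSum]
  push_cast
  refine Finset.sum_congr rfl fun k _ => ?_
  simp only [eval_mul, eval_C, eval_pow, eval_X]
  push_cast
  rw [neg_pow (t : ℂ)]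
  ring

lemma tsum_sum_range_eq_tsum_prod {g : ℕ × ℕ → ℂ} (hg : Summable g) :
    ∑' n : ℕ, ∑ k ∈ Finset.range (n + 1), g (k, n - k) = ∑' x, g x := by
  have e2 := ((Finset.HasAntidiagonal.sigmaAntidiagonalEquivProd (A := ℕ)).hasSum_iff.2 hg.hasSum).sigma
    fun n => (hasSum_fintype _)
  rw [← e2.tsum_eq]
  refine tsum_congr fun n => ?_
  have e3 := Finset.sum_coe_sort (Finset.HasAntidiagonal.antidiagonal n) g
  simp only [Function.comp_def, Finset.HasAntidiagonal.sigmaAntidiagonalEquivProd_apply]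
  rw [e3, Finset.Nat.sum_antidiagonal_eq_sum_range_succ_mk]

/-- Expand `L_n`, put `n = m + k` and sum over `m` first: `∑_m binom(m+k,k) w^m = (1-w)^{-(k+1)}`
leaves the exponential series in `-tw/(1-w)`. The same computation with absolute values justifies
the rearrangement. -/
lemma tsum_lagPoly_mul_pow {w : ℂ} (hw : ‖w‖ < 1) (t : ℝ) :
    ∑' n : ℕ, (((lagPoly n).eval t : ℝ) : ℂ) * w ^ n =
      (1 - w)⁻¹ * Complex.exp (-t * w / (1 - w)) := by
  have hw1 : (1 - w) ≠ 0 := by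
    intro h
    rw [sub_eq_zero] at h
    rw [← h] at hw
    simp at hw
  obtain ⟨g, hg⟩ : ∃ g : ℕ × ℕ → ℂ, ∀ k m, g (k, m) = (-t * w) ^ k / (k.factorial : ℂ) *
      (((m + k).choose k : ℂ) * w ^ m) := ⟨fun x => (-t * w) ^ x.1 / (x.1.factorial : ℂ) *
      (((x.2 + x.1).choose x.1 : ℂ) * w ^ x.2), fun k m => rfl⟩
  have hinner : ∀ k, HasSum (fun m => g (k, m))
      ((-t * w) ^ k / (k.factorial : ℂ) * (1 / (1 - w) ^ (k + 1))) := fun k => by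
    simp only [hg]
    exact (hasSum_choose_mul_geometric_of_norm_lt_one k hw).mul_left _
  have hsum : Summable g := by
    refine Summable.of_norm ?_
    have hn : ∀ k, HasSum (fun m => ‖g (k, m)‖)
        (‖-t * w‖ ^ k / (k.factorial : ℝ) * (1 / (1 - ‖w‖) ^ (k + 1))) := by
      intro k
      have := (hasSum_choose_mul_geometric_of_norm_lt_one k
        (r := ‖w‖) (by simpa using hw)).mul_left (‖-t * w‖ ^ k / (k.factorial : ℝ))
      simpa [hg] using this
    rw [summable_prod_of_nonneg fun _ => norm_nonneg _]
    refine ⟨fun k => (hn k).summable, ?_⟩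
    simp only [fun k => (hn k).tsum_eq]
    have h1 : 0 < 1 - ‖w‖ := by linarith
    have := (Real.summable_pow_div_factorial (‖-t * w‖ / (1 - ‖w‖))).mul_left (1 / (1 - ‖w‖))
    refine this.congr fun k => ?_
    rw [div_pow, pow_succ]
    field_simp
  have e1 : ∑' x, g x = (1 - w)⁻¹ * Complex.exp (-t * w / (1 - w)) := by
    rw [hsum.tsum_prod' fun k => (hinner k).summable]
    simp only [fun k => (hinner k).tsum_eq]
    rw [Complex.exp_eq_exp_ℂ, NormedSpace.exp_eq_tsum_div, ← tsum_mul_left]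
    refine tsum_congr fun k => ?_
    rw [div_pow, pow_succ]
    field_simp
  rw [← e1, ← tsum_sum_range_eq_tsum_prod hsum]
  refine tsum_congr fun n => ?_
  rw [eval_lagPoly_eq_sum, Finset.sum_mul]
  refine Finset.sum_congr rfl fun k hk => ?_
  have hk' : k ≤ n := Nat.lt_succ_iff.1 (Finset.mem_range.1 hk)
  simp only [hg, Nat.sub_add_cancel hk', mul_pow]
  rw [← pow_mul_pow_sub w hk']
  ring

/-- The exponents combine as `-t/2 - tw/(1-w) = -(1/2) t (1+w)/(1-w)`. -/
lemma tsum_laguerre_mul_pow {w : ℂ} (hw : ‖w‖ < 1) (t : ℝ) :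
    (1 - w) * ∑' n : ℕ, (((lagPoly n).eval t * Real.exp (-t / 2) : ℝ) : ℂ) * w ^ n =
      Complex.exp (-(1 / 2) * ((1 + w) / (1 - w)) * (t : ℂ)) := by
  have hw1 : (1 - w) ≠ 0 := by
    intro h
    rw [sub_eq_zero] at h
    rw [← h] at hw
    simp at hw
  have h1 : ∀ n : ℕ, (((lagPoly n).eval t * Real.exp (-t / 2) : ℝ) : ℂ) * w ^ n =
      Complex.exp (-t / 2) * ((((lagPoly n).eval t : ℝ) : ℂ) * w ^ n) := by
    intro n; push_cast; ring
  simp only [h1]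
  rw [tsum_mul_left, tsum_lagPoly_mul_pow hw]
  rw [show (1 - w) * (Complex.exp (-t / 2) * ((1 - w)⁻¹ * Complex.exp (-t * w / (1 - w)))) =
    ((1 - w) * (1 - w)⁻¹) * (Complex.exp (-t / 2) * Complex.exp (-t * w / (1 - w))) by ring,
    mul_inv_cancel₀ hw1, one_mul, ← Complex.exp_add]
  congr 1
  field_simp
  ring

variable {d : ℕ} {f : (Fin d → ℝ) → ℂ}

lemma ofReal_laguerreFun_mul_pow (n : Fin d → ℕ) (t : Fin d → ℝ) (w : Fin d → ℂ) :
    (laguerreFun n t : ℂ) * ∏ l, w l ^ n l =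
      ∏ l, (((lagPoly (n l)).eval (t l) * Real.exp (-(t l) / 2) : ℝ) : ℂ) * w l ^ n l := by
  rw [laguerreFun_eq_polyFun, polyFun, Complex.ofReal_prod, Finset.prod_mul_distrib]

lemma laguerre_kernel_eq {w : Fin d → ℂ} (hw : w ∈ polydisc d) {t : Fin d → ℝ}
    (ht : t ∈ orthant d) :
    ∏ l, Complex.exp (-(1 / 2) * ((1 + w l) / (1 - w l)) * (t l : ℂ)) =
      (∏ l, (1 - w l)) * ∑' n : Fin d → ℕ, (laguerreFun n t : ℂ) * ∏ l, w l ^ n l := by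
  simp only [ofReal_laguerreFun_mul_pow]
  rw [tsum_prod_pi (f := fun l k => (((lagPoly k).eval (t l) * Real.exp (-(t l) / 2) : ℝ) : ℂ) *
    w l ^ k) fun l => summable_norm_laguerre_mul_pow (hw l) (ht l).le, ← Finset.prod_mul_distrib]
  exact Finset.prod_congr rfl fun l _ => (tsum_laguerre_mul_pow (hw l) (t l)).symm

lemma summable_norm_prod_pow {w : Fin d → ℂ} (hw : w ∈ polydisc d) :
    Summable fun n : Fin d → ℕ => ‖∏ l, w l ^ n l‖ :=
  summable_norm_prod_pi (f := fun l k => w l ^ k) fun l => by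
    simpa using summable_geometric_of_lt_one (norm_nonneg (w l)) (hw l)

/-- Sum and integral may be exchanged because `∫ |f 𝓛_n| ≤ ‖f‖₂` uniformly in `n` and `∑ |w^n|`
converges. -/
lemma hasSum_laguerreCoeff_mul_pow (hf : MemLp f 2 (orthantMeasure d)) {w : Fin d → ℂ}
    (hw : w ∈ polydisc d) :
    HasSum (fun n : Fin d → ℕ => laguerreCoeff f n * ∏ l, w l ^ n l)
      (∫ t, f t * ∑' n : Fin d → ℕ, (laguerreFun n t : ℂ) * ∏ l, w l ^ n l
        ∂orthantMeasure d) := by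
  have h := hasSum_integral_of_summable_integral_norm (μ := orthantMeasure d)
    (F := fun (n : Fin d → ℕ) t => f t * (laguerreFun n t : ℂ) * ∏ l, w l ^ n l)
    (fun n => (integrable_mul_laguerreFun hf n).mul_const _) ?_
  · simp only [integral_mul_const] at h
    simp only [mul_assoc, tsum_mul_left] at h
    exact h
  · refine Summable.of_nonneg_of_le (fun n => by positivity) (fun n => ?_)
      ((summable_norm_prod_pow hw).mul_left (eLpNorm f 2 (orthantMeasure d)).toReal)
    simp only [norm_mul (_ * _) (Finset.prod _ _), integral_mul_const]
    exact mul_le_mul_of_nonneg_right (integral_norm_mul_laguerreFun_le hf n) (norm_nonneg _)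

lemma FD_eq_laguerreGen (hf : MemLp f 2 (orthantMeasure d)) {w : Fin d → ℂ}
    (hw : w ∈ polydisc d) : FD f w = laguerreGen (laguerreCoeff f) w := by
  rw [FD, laguerreGen, (hasSum_laguerreCoeff_mul_pow hf hw).tsum_eq, ← integral_const_mul]
  refine integral_congr_ae ?_
  filter_upwards [ae_mem_orthant d] with t ht
  rw [laguerre_kernel_eq hw ht]
  ring

end GeneratingFunction

end LaguerreG

/-! ### Fourier uniqueness and completeness of the Laguerre functions. -/

namespace LaguerreG

section FourierUniqueness

variable {E : Type*} [NormedAddCommGroup E] [NormedSpace ℝ E] [CompleteSpace E]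
  [SecondCountableTopology E] [MeasurableSpace E] [BorelSpace E] {μ : Measure E}

/-- The positive and negative parts of `u` are densities of two finite measures with the same
characteristic function; these measures agree, hence so do the densities. -/
lemma ae_eq_zero_of_integral_cexp_eq_zero_real {u : E → ℝ} (hu : Integrable u μ)
    (h : ∀ L : StrongDual ℝ E, ∫ x, (u x : ℂ) * Complex.exp (L x * Complex.I) ∂μ = 0) :
    u =ᵐ[μ] 0 := by
  have hpos : AEMeasurable (fun x => ENNReal.ofReal (u x)) μ := hu.1.aemeasurable.ennreal_ofReal
  have hneg : AEMeasurable (fun x => ENNReal.ofReal (-u x)) μ :=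
    hu.1.aemeasurable.neg.ennreal_ofReal
  have hposf : ∫⁻ x, ENNReal.ofReal (u x) ∂μ ≠ ⊤ := hu.lintegral_lt_top.ne
  have hnegf : ∫⁻ x, ENNReal.ofReal (-u x) ∂μ ≠ ⊤ := hu.neg.lintegral_lt_top.ne
  have := isFiniteMeasure_withDensity hposf
  have := isFiniteMeasure_withDensity hnegf
  have hmul : ∀ (L : StrongDual ℝ E) (v : E → ℝ), Integrable v μ →
      Integrable (fun x => (v x : ℂ) * Complex.exp (L x * Complex.I)) μ := by
    intro L v hv
    refine (hv.ofReal (𝕜 := ℂ)).mul_bdd (c := 1) (by fun_prop) (ae_of_all _ fun x => ?_)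
    rw [Complex.norm_exp_ofReal_mul_I]
  have key : μ.withDensity (fun x => ENNReal.ofReal (u x)) =
      μ.withDensity (fun x => ENNReal.ofReal (-u x)) := by
    refine Measure.ext_of_charFunDual (funext fun L => ?_)
    rw [charFunDual_apply, charFunDual_apply,
      integral_withDensity_eq_integral_toReal_smul₀ hpos (ae_of_all _ fun _ => ENNReal.ofReal_lt_top),
      integral_withDensity_eq_integral_toReal_smul₀ hneg (ae_of_all _ fun _ => ENNReal.ofReal_lt_top),
      ← sub_eq_zero, ← h L, ← integral_sub]
    · refine integral_congr_ae (ae_of_all _ fun x => ?_)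
      simp only [Complex.real_smul, ← sub_mul, ← Complex.ofReal_sub, ENNReal.toReal_ofReal']
      congr 2
      rcases le_total 0 (u x) with h0 | h0
      · rw [max_eq_left h0, max_eq_right (by linarith), sub_zero]
      · rw [max_eq_right h0, max_eq_left (by linarith)]; ring
    · simpa only [Complex.real_smul, ENNReal.toReal_ofReal'] using hmul L _ hu.pos_part
    · simpa only [Complex.real_smul, ENNReal.toReal_ofReal'] using hmul L _ hu.neg_part
  have h2 := (withDensity_eq_iff hpos hneg hposf).1 key
  filter_upwards [h2] with x hx
  rcases lt_trichotomy (u x) 0 with h0 | h0 | h0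
  · rw [ENNReal.ofReal_of_nonpos h0.le, eq_comm, ENNReal.ofReal_eq_zero] at hx
    linarith
  · exact h0
  · rw [ENNReal.ofReal_of_nonpos (by linarith : -u x ≤ 0), ENNReal.ofReal_eq_zero] at hx
    linarith

/-- An integrable function with vanishing Fourier transform vanishes almost everywhere. -/
lemma ae_eq_zero_of_integral_cexp_eq_zero {g : E → ℂ} (hg : Integrable g μ)
    (h : ∀ L : StrongDual ℝ E, ∫ x, g x * Complex.exp (L x * Complex.I) ∂μ = 0) :
    g =ᵐ[μ] 0 := by
  have hint : ∀ (L : StrongDual ℝ E) (v : E → ℂ), Integrable v μ →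
      Integrable (fun x => v x * Complex.exp (L x * Complex.I)) μ := by
    intro L v hv
    refine hv.mul_bdd (c := 1) (by fun_prop) (ae_of_all _ fun x => ?_)
    rw [Complex.norm_exp_ofReal_mul_I]
  have hcg : Integrable (fun x => (starRingEnd ℂ) (g x)) μ := by
    simpa using (Complex.conjCLE.toContinuousLinearMap.integrable_comp hg)
  have hc : ∀ L : StrongDual ℝ E,
      ∫ x, (starRingEnd ℂ) (g x) * Complex.exp (L x * Complex.I) ∂μ = 0 := by
    intro L
    -- Conjugating the hypothesis at `-L` restores the character `e^{iL}`, so real and imaginary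
    -- parts can be treated separately.
    have h1 := congrArg (starRingEnd ℂ) (h (-L))
    rw [← integral_conj, map_zero] at h1
    rw [← h1]
    refine integral_congr_ae (ae_of_all _ fun x => ?_)
    simp [← Complex.exp_conj]
  have hre : (fun x => (g x).re) =ᵐ[μ] 0 := by
    refine ae_eq_zero_of_integral_cexp_eq_zero_real hg.re fun L => ?_
    have e : ∀ x, ((g x).re : ℂ) * Complex.exp (L x * Complex.I) =
        (1 / 2) * (g x * Complex.exp (L x * Complex.I) +
          (starRingEnd ℂ) (g x) * Complex.exp (L x * Complex.I)) := by
      intro x; rw [Complex.re_eq_add_conj]; ring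
    simp only [e]
    rw [integral_const_mul, integral_add (hint L _ hg) (hint L _ hcg), h, hc]; simp
  have him : (fun x => (g x).im) =ᵐ[μ] 0 := by
    refine ae_eq_zero_of_integral_cexp_eq_zero_real hg.im fun L => ?_
    have e : ∀ x, ((g x).im : ℂ) * Complex.exp (L x * Complex.I) =
        (1 / (2 * Complex.I)) * (g x * Complex.exp (L x * Complex.I) -
          (starRingEnd ℂ) (g x) * Complex.exp (L x * Complex.I)) := by
      intro x; rw [Complex.im_eq_sub_conj]; ring
    simp only [e]
    rw [integral_const_mul, integral_sub (hint L _ hg) (hint L _ hcg), h, hc]; simp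
  filter_upwards [hre, him] with x h1 h2
  exact Complex.ext h1 h2

end FourierUniqueness

section Completeness

variable {d : ℕ}

/-- The Laguerre functions are complete in `L²` of the orthant. -/
lemma ae_eq_zero_of_laguerreCoeff_eq_zero {f : (Fin d → ℝ) → ℂ}
    (hf : MemLp f 2 (orthantMeasure d)) (h : ∀ n, laguerreCoeff f n = 0) :
    f =ᵐ[orthantMeasure d] 0 := by
  have hE := memLp_polyFun (d := d) fun _ => 1
  have hg := integrable_mul_of_memLp_two hf hE
  have hzero : (fun t => f t * (polyFun (fun _ : Fin d => 1) t : ℂ)) =ᵐ[orthantMeasure d] 0 := by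
    refine ae_eq_zero_of_integral_cexp_eq_zero hg fun L => ?_
    -- With `ξ` purely imaginary and `w = -ξ/(1-ξ)`, one has `|w_l| < 1` and `(1+w)/(1-w) = 1 - 2ξ`,
    -- so the kernel at `w` is `e^{-t/2}` times the character of `L`. The expansion of `FD` then
    -- vanishes with the coefficients.
    set ξ : Fin d → ℂ := fun l => (L (Pi.single l 1) : ℂ) * Complex.I with hξ
    have hne : ∀ l, 1 - ξ l ≠ 0 := by
      intro l hl
      have := congrArg Complex.re hl
      simp [hξ] at this
    set w : Fin d → ℂ := fun l => -ξ l / (1 - ξ l) with hw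
    have hwD : w ∈ polydisc d := by
      intro l
      rw [hw]
      simp only [norm_div, norm_neg]
      rw [div_lt_one (norm_pos_iff.2 (hne l))]
      refine lt_of_pow_lt_pow_left₀ 2 (norm_nonneg _) ?_
      rw [← Complex.normSq_eq_norm_sq, ← Complex.normSq_eq_norm_sq, Complex.normSq_apply,
        Complex.normSq_apply]
      simp [hξ]
    have hF := FD_eq_laguerreGen hf hwD
    rw [laguerreGen] at hF
    simp only [h, zero_mul, tsum_zero, mul_zero] at hF
    rw [← hF, FD]
    refine integral_congr_ae (ae_of_all _ fun t => ?_)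
    have hL : L t = ∑ l, t l * L (Pi.single l 1) := by
      conv_lhs => rw [← Finset.univ_sum_single t]
      rw [map_sum]
      refine Finset.sum_congr rfl fun l _ => ?_
      have : (Pi.single l (t l) : Fin d → ℝ) = t l • Pi.single l 1 := by
        rw [← Pi.single_smul, smul_eq_mul, mul_one]
      rw [this, map_smul, smul_eq_mul]
    have e : ∀ l, Complex.exp (-(1 / 2) * ((1 + w l) / (1 - w l)) * (t l : ℂ)) =
        ((Real.exp (-(t l) / 2) : ℝ) : ℂ) *
          Complex.exp ((t l * L (Pi.single l 1) : ℝ) * Complex.I) := by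
      intro l
      have h1 : (1 + w l) / (1 - w l) = 1 - 2 * ξ l := by
        have h2 : 1 - w l = 1 / (1 - ξ l) := by rw [hw]; field_simp [hne l]; ring
        have h3 : 1 + w l = (1 - 2 * ξ l) / (1 - ξ l) := by
          rw [hw]; field_simp [hne l]; ring
        rw [h2, h3]
        field_simp [hne l]
      rw [h1, Complex.ofReal_exp, ← Complex.exp_add, hξ]
      congr 1
      push_cast
      ring
    simp only [e, Finset.prod_mul_distrib]
    rw [← Complex.exp_sum, ← Finset.sum_mul, ← Complex.ofReal_sum, ← hL, mul_assoc]
    simp [polyFun]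
  filter_upwards [hzero] with t ht
  have h1 : (polyFun (fun _ : Fin d => 1) t : ℂ) ≠ 0 := by
    rw [Complex.ofReal_ne_zero, polyFun]
    exact Finset.prod_ne_zero_iff.2 fun l _ => by simp [Real.exp_ne_zero]
  exact (mul_eq_zero.1 ht).resolve_right h1

end Completeness

/-! ### Power series with bounded coefficients on the polydisc and Cauchy's inequality. -/

section PowerSeries

/-- The `q`-th derivative of the monomial `w ↦ w^n`. -/
noncomputable def powDeriv (n q : ℕ) (w : ℂ) : ℂ := (n.descFactorial q : ℂ) * w ^ (n - q)

lemma hasDerivAt_powDeriv (n q : ℕ) (w : ℂ) :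
    HasDerivAt (powDeriv n q) (powDeriv n (q + 1) w) w := by
  refine ((hasDerivAt_pow (n - q) w).const_mul (n.descFactorial q : ℂ)).congr_deriv ?_
  rw [powDeriv, Nat.descFactorial_succ, Nat.sub_sub]
  push_cast
  ring

lemma norm_powDeriv_le {r : ℝ} (n q : ℕ) {w : ℂ} (hw : ‖w‖ ≤ r) :
    ‖powDeriv n q w‖ ≤ (n.descFactorial q : ℝ) * r ^ (n - q) := by
  rw [powDeriv, norm_mul, norm_pow, Complex.norm_natCast]
  gcongr

lemma summable_descFactorial_mul_pow {r : ℝ} (hr0 : 0 < r) (hr : r < 1) (q : ℕ) :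
    Summable fun n : ℕ => (n.descFactorial q : ℝ) * r ^ (n - q) := by
  have h := (summable_pow_mul_geometric_of_norm_lt_one q (r := r)
    (by rwa [Real.norm_of_nonneg hr0.le])).mul_right ((r ^ q)⁻¹)
  refine Summable.of_nonneg_of_le (fun n => by positivity) (fun n => ?_) h
  rcases Nat.lt_or_ge n q with hn | hn
  · rw [Nat.descFactorial_of_lt hn]; simp; positivity
  · rw [mul_assoc, ← pow_sub₀ r hr0.ne' hn]
    gcongr
    exact_mod_cast Nat.descFactorial_le_pow n q

variable {d : ℕ} {c : (Fin d → ℕ) → ℂ} {M : ℝ}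

lemma mem_polydisc_iff {w : Fin d → ℂ} : w ∈ polydisc d ↔ ‖w‖ < 1 :=
  (pi_norm_lt_iff one_pos).symm

lemma isOpen_polydisc (d : ℕ) : IsOpen (polydisc d) := by
  have : polydisc d = Metric.ball 0 1 := by ext w; simp [mem_polydisc_iff]
  rw [this]; exact Metric.isOpen_ball

/-- Bounded coefficients give uniform domination only on polydiscs of radius `r < 1`;
differentiation being local, this is enough. -/
lemma exists_radius {w : Fin d → ℂ} (hw : w ∈ polydisc d) :
    ∃ r : ℝ, 0 < r ∧ r < 1 ∧ w ∈ Set.pi univ fun _ => Metric.ball (0 : ℂ) r := by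
  rw [mem_polydisc_iff] at hw
  refine ⟨(1 + ‖w‖) / 2, by positivity, by linarith, fun l _ => ?_⟩
  rw [mem_ball_zero_iff]
  linarith [norm_le_pi_norm w l]

lemma summable_powDeriv_bound (hc : ∀ n, ‖c n‖ ≤ M) {r : ℝ} (hr0 : 0 < r) (hr : r < 1)
    (q : Fin d → ℕ) :
    Summable fun n : Fin d → ℕ => ‖c n‖ * ∏ l, ((n l).descFactorial (q l) : ℝ) * r ^ (n l - q l) := by
  have h := (summable_prod_pi (f := fun l k => (k.descFactorial (q l) : ℝ) * r ^ (k - q l))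
    (fun l k => by positivity) fun l => summable_descFactorial_mul_pow hr0 hr (q l)).mul_left M
  refine Summable.of_nonneg_of_le (fun n => by positivity) (fun n => ?_) h
  exact mul_le_mul_of_nonneg_right (hc n) (by positivity)

/-- The formal derivatives of a power series with bounded coefficients on the polydisc. -/
noncomputable def powSeries (c : (Fin d → ℕ) → ℂ) (q : Fin d → ℕ) (w : Fin d → ℂ) : ℂ :=
  mseries c powDeriv q w

lemma powSeries_zero (c : (Fin d → ℕ) → ℂ) (w : Fin d → ℂ) :
    powSeries c 0 w = ∑' n : Fin d → ℕ, c n * ∏ l, w l ^ n l := by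
  simp [powSeries, mseries, powDeriv]

lemma hasFDerivAt_powSeries (hc : ∀ n, ‖c n‖ ≤ M) (q : Fin d → ℕ) {w : Fin d → ℂ}
    (hw : w ∈ polydisc d) :
    HasFDerivAt (powSeries c q) (gradForm ℂ fun l => powSeries c (q + Pi.single l 1) w) w := by
  obtain ⟨r, hr0, hr, hwr⟩ := exists_radius hw
  exact hasFDerivAt_mseries Metric.isOpen_ball (convex_ball (0 : ℂ) r).isPreconnected
    (fun n q x _ => hasDerivAt_powDeriv n q x)
    (fun n q x hx => norm_powDeriv_le n q (mem_ball_zero_iff.1 hx).le)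
    (summable_powDeriv_bound hc hr0 hr) q hwr

lemma summable_norm_powSeries (hc : ∀ n, ‖c n‖ ≤ M) (q : Fin d → ℕ) {w : Fin d → ℂ}
    (hw : w ∈ polydisc d) :
    Summable fun n : Fin d → ℕ => ‖c n * ∏ l, powDeriv (n l) (q l) (w l)‖ := by
  obtain ⟨r, hr0, hr, hwr⟩ := exists_radius hw
  exact Summable.of_nonneg_of_le (fun n => norm_nonneg _)
    (fun n => norm_mseries_term_le (V := Metric.ball (0 : ℂ) r)
      (fun n q x hx => norm_powDeriv_le n q (mem_ball_zero_iff.1 hx).le) n q hwr)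
    (summable_powDeriv_bound hc hr0 hr q)

lemma mderiv_eq_powSeries (hc : ∀ n, ‖c n‖ ≤ M) {F : (Fin d → ℂ) → ℂ}
    (hF : EqOn F (powSeries c 0) (polydisc d)) (p : Fin d → ℕ) :
    EqOn (mderiv ℂ p F) (powSeries c p) (polydisc d) := by
  refine mderiv_eqOn_family (isOpen_polydisc d) (fun q l w hw => ?_) hF p
  have h := ((hasFDerivAt_powSeries hc q hw).hasLineDerivAt (Pi.single l 1)).lineDeriv
  rw [gradForm_single] at h
  exact h

lemma differentiableOn_powSeries (hc : ∀ n, ‖c n‖ ≤ M) :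
    DifferentiableOn ℂ (powSeries c 0) (polydisc d) := fun _ hw =>
  (hasFDerivAt_powSeries hc 0 hw).differentiableAt.differentiableWithinAt

/-- Cauchy's inequality for the coefficients of a bounded power series on the polydisc. -/
lemma norm_coeff_le_of_norm_tsum_le
    (hs : ∀ w ∈ polydisc d, Summable fun n : Fin d → ℕ => ‖c n * ∏ l, w l ^ n l‖)
    (hM : ∀ w ∈ polydisc d, ‖∑' n : Fin d → ℕ, c n * ∏ l, w l ^ n l‖ ≤ M) (n : Fin d → ℕ) :
    ‖c n‖ ≤ M := by
  have hT : Fact ((0 : ℝ) < 1) := ⟨one_pos⟩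
  -- Integrate over the torus of radius `r` against the character of frequency `-n`: orthogonality
  -- isolates `c_n r^{|n|}`. The torus stays inside the open polydisc, and `r → 1` comes at the end.
  have key : ∀ r : ℝ, 0 < r → r < 1 → ‖c n‖ * r ^ len n ≤ M := by
    intro r hr0 hr
    set μ : Measure (Fin d → AddCircle (1 : ℝ)) :=
      Measure.pi fun _ => AddCircle.haarAddCircle with hμ
    set W : (Fin d → AddCircle (1 : ℝ)) → Fin d → ℂ := fun x l => r * fourier 1 (x l) with hW
    have hfn : ∀ (k : ℤ) (y : AddCircle (1 : ℝ)), ‖fourier k y‖ = 1 := fun k y => by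
      rw [fourier_apply]; exact Circle.norm_coe _
    have hWD : ∀ x, W x ∈ polydisc d := fun x l => by
      simp only [hW, norm_mul, hfn, Complex.norm_real, Real.norm_of_nonneg hr0.le, mul_one]
      exact hr
    have hpow : ∀ (m : ℕ) (y : AddCircle (1 : ℝ)), fourier 1 y ^ m = fourier (m : ℤ) y := by
      intro m y
      induction m with
      | zero => simp
      | succ m ih => rw [pow_succ, ih, ← fourier_add]; push_cast; rfl
    have hterm : ∀ (m : Fin d → ℕ) x, c m * (∏ l, W x l ^ m l) * ∏ l, fourier (-(n l : ℤ)) (x l) =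
        c m * (r : ℂ) ^ len m * ∏ l, fourier (-(n l : ℤ)) (x l) • fourier (m l : ℤ) (x l) := by
      intro m x
      simp only [hW, mul_pow, hpow, Finset.prod_mul_distrib, smul_eq_mul, len,
        Finset.prod_pow_eq_pow_sum]
      ring
    have hint : ∀ m : Fin d → ℕ, ∫ x, c m * (∏ l, W x l ^ m l) * ∏ l, fourier (-(n l : ℤ)) (x l) ∂μ =
        if m = n then c n * (r : ℂ) ^ len n else 0 := by
      intro m
      simp only [hterm]
      rw [integral_const_mul, hμ, integral_fintype_prod_eq_prod
        (f := fun l (y : AddCircle (1 : ℝ)) => fourier (-(n l : ℤ)) y • fourier (m l : ℤ) y)]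
      have h1 : ∀ l, ∫ y : AddCircle (1 : ℝ), fourier (-(n l : ℤ)) y • fourier (m l : ℤ) y
          ∂AddCircle.haarAddCircle (T := 1) = (Pi.single (m l : ℤ) 1 : ℤ → ℂ) (n l) := by
        intro l
        rw [← fourierCoeff_fourier (T := 1)]
        rfl
      simp only [h1]
      split_ifs with h
      · subst h; simp
      · obtain ⟨l, hl⟩ := Function.ne_iff.1 h
        rw [Finset.prod_eq_zero (Finset.mem_univ l), mul_zero]
        rw [Pi.single_eq_of_ne]
        exact_mod_cast Ne.symm hl
    have hnorm : ∀ (m : Fin d → ℕ) x,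
        ‖c m * (∏ l, W x l ^ m l) * ∏ l, fourier (-(n l : ℤ)) (x l)‖ = ‖c m * ∏ l, (r : ℂ) ^ m l‖ := by
      intro m x
      simp only [hW, norm_mul, norm_prod, norm_pow, hfn, mul_one, Finset.prod_const_one]
    have hcont : ∀ m : Fin d → ℕ, Continuous fun x : Fin d → AddCircle (1 : ℝ) =>
        c m * (∏ l, W x l ^ m l) * ∏ l, fourier (-(n l : ℤ)) (x l) := by
      intro m
      simp only [hW]
      fun_prop
    have hsum := hasSum_integral_of_summable_integral_norm (μ := μ)
      (F := fun (m : Fin d → ℕ) x => c m * (∏ l, W x l ^ m l) * ∏ l, fourier (-(n l : ℤ)) (x l))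
      (fun m => Integrable.of_bound (hcont m).aestronglyMeasurable _
        (ae_of_all _ fun x => (hnorm m x).le)) ?_
    swap
    · simp only [hnorm, integral_const, probReal_univ, one_smul]
      exact hs (fun _ => (r : ℂ)) fun l => by
        rw [Complex.norm_real, Real.norm_of_nonneg hr0.le]; exact hr
    simp only [hint] at hsum
    have h2 := hsum.unique (hasSum_ite_eq n (c n * (r : ℂ) ^ len n))
    have h3 : ‖c n * (r : ℂ) ^ len n‖ ≤ M := by
      rw [← h2]
      have := norm_integral_le_of_norm_le_const (μ := μ) (C := M)
        (f := fun x => ∑' m : Fin d → ℕ, c m * (∏ l, W x l ^ m l) * ∏ l, fourier (-(n l : ℤ)) (x l))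
        (ae_of_all _ fun x => ?_)
      · simpa using this
      · rw [tsum_mul_right, norm_mul, norm_prod]
        simp only [hfn, Finset.prod_const_one, mul_one]
        exact hM _ (hWD x)
    rwa [norm_mul, norm_pow, Complex.norm_real, Real.norm_of_nonneg hr0.le] at h3
  have hlim : Tendsto (fun r : ℝ => ‖c n‖ * r ^ len n) (𝓝[<] 1) (𝓝 (‖c n‖ * 1 ^ len n)) :=
    (Continuous.tendsto (by fun_prop) 1).mono_left nhdsWithin_le_nhds
  rw [one_pow, mul_one] at hlim
  refine le_of_tendsto hlim ?_
  filter_upwards [Ioo_mem_nhdsLT (zero_lt_one (α := ℝ))] with r hr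
  exact key r hr.1 hr.2

end PowerSeries

end LaguerreG

/-! ### The factor `∏ (1 - w_l)` as a mixed backward difference of the coefficients. -/

namespace LaguerreG

section Differences

variable {d : ℕ}

/-- The backward difference of a multi-sequence in the `l`-th index. -/
def backDiff (l : Fin d) (a : (Fin d → ℕ) → ℂ) (n : Fin d → ℕ) : ℂ :=
  a n - if n l = 0 then 0 else a (n - Pi.single l 1)

/-- The mixed backward difference over a list of indices. -/
def mixedDiff (L : List (Fin d)) (a : (Fin d → ℕ) → ℂ) : (Fin d → ℕ) → ℂ :=
  L.foldr backDiff a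

lemma norm_backDiff_le {a : (Fin d → ℕ) → ℂ} {M : ℝ} (ha : ∀ n, ‖a n‖ ≤ M) (l : Fin d)
    (n : Fin d → ℕ) : ‖backDiff l a n‖ ≤ M + M := by
  have hM : 0 ≤ M := (norm_nonneg _).trans (ha n)
  refine (norm_sub_le _ _).trans (add_le_add (ha n) ?_)
  split_ifs
  · simpa using hM
  · exact ha _

lemma exists_bound_mixedDiff {a : (Fin d → ℕ) → ℂ} {M : ℝ} (ha : ∀ n, ‖a n‖ ≤ M)
    (L : List (Fin d)) : ∃ M', ∀ n, ‖mixedDiff L a n‖ ≤ M' := by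
  induction L with
  | nil => exact ⟨M, ha⟩
  | cons l L ih =>
    obtain ⟨M', h⟩ := ih
    exact ⟨M' + M', norm_backDiff_le h l⟩

lemma tsum_backDiff {a : (Fin d → ℕ) → ℂ} {M : ℝ} (ha : ∀ n, ‖a n‖ ≤ M) (l : Fin d)
    {w : Fin d → ℂ} (hw : w ∈ polydisc d) :
    ∑' n : Fin d → ℕ, backDiff l a n * ∏ j, w j ^ n j =
      (1 - w l) * ∑' n : Fin d → ℕ, a n * ∏ j, w j ^ n j := by
  have hsum : ∀ (b : (Fin d → ℕ) → ℂ) (M : ℝ), (∀ n, ‖b n‖ ≤ M) →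
      Summable fun n : Fin d → ℕ => b n * ∏ j, w j ^ n j := by
    intro b M hb
    refine Summable.of_norm_bounded ((summable_norm_prod_pow hw).mul_left M) fun n => ?_
    rw [norm_mul]
    exact mul_le_mul_of_nonneg_right (hb n) (norm_nonneg _)
  have hM : 0 ≤ M := (norm_nonneg _).trans (ha 0)
  set s : (Fin d → ℕ) → ℂ := fun n => if n l = 0 then 0 else a (n - Pi.single l 1) with hs
  have hsb : ∀ n, ‖s n‖ ≤ M := by
    intro n
    simp only [hs]
    split_ifs
    · simpa using hM
    · exact ha _
  have hshift : ∑' n : Fin d → ℕ, s n * ∏ j, w j ^ n j =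
      w l * ∑' n : Fin d → ℕ, a n * ∏ j, w j ^ n j := by
    -- Shifted terms with `n_l = 0` vanish, so the sum lives on the range of this shift.
    have hinj : Function.Injective fun n : Fin d → ℕ => n + Pi.single l 1 := add_left_injective _
    rw [← hinj.tsum_eq, ← tsum_mul_left]
    · refine tsum_congr fun n => ?_
      have h1 : (∏ j, w j ^ ((n + Pi.single l 1 : Fin d → ℕ) j)) = w l * ∏ j, w j ^ n j := by
        simp only [Pi.add_apply, pow_add, Finset.prod_mul_distrib]
        rw [mul_comm]
        congr 1
        rw [Finset.prod_eq_single l]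
        · simp
        · intro j _ hj; simp [hj]
        · simp
      rw [h1]
      simp [hs]
      ring
    · intro n hn
      have h2 : n l ≠ 0 := by
        intro h
        apply hn
        simp [hs, h]
      refine ⟨n - Pi.single l 1, ?_⟩
      ext j
      by_cases hj : j = l
      · subst hj; simp; omega
      · simp [hj]
  have : ∀ n : Fin d → ℕ, backDiff l a n * ∏ j, w j ^ n j =
      a n * (∏ j, w j ^ n j) - s n * ∏ j, w j ^ n j := by
    intro n; rw [backDiff, sub_mul]
  simp only [this]
  rw [(hsum a M ha).tsum_sub (hsum s M hsb), hshift]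
  ring

lemma tsum_mixedDiff {a : (Fin d → ℕ) → ℂ} {M : ℝ} (ha : ∀ n, ‖a n‖ ≤ M) (L : List (Fin d))
    {w : Fin d → ℂ} (hw : w ∈ polydisc d) :
    ∑' n : Fin d → ℕ, mixedDiff L a n * ∏ j, w j ^ n j =
      (L.map fun l => 1 - w l).prod * ∑' n : Fin d → ℕ, a n * ∏ j, w j ^ n j := by
  induction L with
  | nil => simp [mixedDiff]
  | cons l L ih =>
    obtain ⟨M', h⟩ := exists_bound_mixedDiff ha L
    rw [List.map_cons, List.prod_cons, mul_assoc, ← ih, ← tsum_backDiff h l hw]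
    rfl

/-- Absorbing the prefactor turns the generating function into a plain power series, to which
termwise differentiation and Cauchy's inequality apply. -/
lemma laguerreGen_eq_powSeries {a : (Fin d → ℕ) → ℂ} {M : ℝ} (ha : ∀ n, ‖a n‖ ≤ M) :
    EqOn (laguerreGen a) (powSeries (mixedDiff (List.finRange d) a) 0) (polydisc d) := by
  intro w hw
  rw [powSeries_zero, tsum_mixedDiff ha _ hw, laguerreGen, Fin.prod_univ_def]

lemma tendsto_backDiff {a : (Fin d → ℕ) → ℂ} (ha : Tendsto a cofinite (𝓝 0)) (l : Fin d) :
    Tendsto (backDiff l a) cofinite (𝓝 0) := by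
  rw [Metric.tendsto_nhds]
  intro ε hε
  rw [Metric.tendsto_nhds] at ha
  have h1 := ha (ε / 2) (half_pos hε)
  have h2 : ∀ᶠ n : Fin d → ℕ in cofinite, n l = 0 ∨ ‖a (n - Pi.single l 1)‖ < ε / 2 := by
    rw [eventually_cofinite] at h1 ⊢
    refine (h1.image fun n => n + Pi.single l 1).subset ?_
    intro n hn
    simp only [mem_ofPred_eq, not_or, dist_zero_right] at hn ⊢
    refine ⟨n - Pi.single l 1, hn.2, ?_⟩
    ext j
    by_cases hj : j = l
    · subst hj; simp; omega
    · simp [hj]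
  filter_upwards [h1, h2] with n hn1 hn2
  rw [dist_zero_right] at hn1 ⊢
  refine (norm_sub_le _ _).trans_lt ?_
  have : ‖(if n l = 0 then 0 else a (n - Pi.single l 1) : ℂ)‖ < ε / 2 := by
    split_ifs with h
    · simpa using hε
    · exact hn2.resolve_left h
  linarith

lemma len_add_single (n : Fin d → ℕ) (l : Fin d) (m : ℕ) :
    len (n + Pi.single l m) = len n + m := by
  simp [len, Finset.sum_add_distrib]

lemma len_sub_single {n : Fin d → ℕ} {l : Fin d} (h : n l ≠ 0) :
    len (n - Pi.single l 1) + 1 = len n := by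
  rw [← len_add_single _ l]
  congr 1
  ext j
  by_cases hj : j = l
  · subst hj; simp; omega
  · simp [hj]

/-- For `α ≥ 1`, `(m+1)^{1/α} ≤ m^{1/α} + 1`, so the index shift costs only a factor `e^c` and the
rate is kept. -/
lemma coeffDecay_backDiff {α : ℝ} (hα : 1 ≤ α) {a : (Fin d → ℕ) → ℂ} (ha : CoeffDecay α a)
    (l : Fin d) : CoeffDecay α (backDiff l a) := by
  obtain ⟨C, c, hc, h⟩ := coeffDecay_iff_exp.1 ha
  have hC : 0 ≤ C := nonneg_of_mul_nonneg_left ((norm_nonneg _).trans (h 0)) (Real.exp_pos _)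
  refine coeffDecay_iff_exp.2 ⟨C + C * Real.exp c, c, hc, fun n => ?_⟩
  rw [add_mul]
  refine (norm_sub_le _ _).trans (add_le_add (h n) ?_)
  split_ifs with hn
  · simp only [norm_zero]; positivity
  refine (h _).trans ?_
  rw [mul_assoc, ← Real.exp_add]
  gcongr C * Real.exp ?_
  have h1 : (len n : ℝ) = len (n - Pi.single l 1) + 1 := by exact_mod_cast (len_sub_single hn).symm
  have h2 : (len n : ℝ) ^ (1 / α) ≤ (len (n - Pi.single l 1) : ℝ) ^ (1 / α) + 1 := by
    rw [h1]
    have := Real.rpow_add_le_add_rpow (p := 1 / α)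
      (Nat.cast_nonneg (len (n - Pi.single l 1))) (zero_le_one (α := ℝ))
      (by positivity) (by rw [div_le_one (by linarith)]; exact hα)
    simpa using this
  nlinarith

lemma coeffDecay_mixedDiff {α : ℝ} (hα : 1 ≤ α) {a : (Fin d → ℕ) → ℂ} (ha : CoeffDecay α a)
    (L : List (Fin d)) : CoeffDecay α (mixedDiff L a) := by
  induction L with
  | nil => exact ha
  | cons l L ih => exact coeffDecay_backDiff hα ih l

/-- Since `a` tends to zero, `a_n` telescopes to minus the sum of the differences at `n + m e_l`, `m
≥ 1`. Half of the rate pays for the decay in `|n|`, the other half for summing over `m`. -/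
lemma coeffDecay_of_backDiff {α : ℝ} (hα : 0 < α) {a : (Fin d → ℕ) → ℂ}
    (ha : Tendsto a cofinite (𝓝 0)) {l : Fin d} (h : CoeffDecay α (backDiff l a)) :
    CoeffDecay α a := by
  obtain ⟨C, c, hc, hb⟩ := coeffDecay_iff_exp.1 h
  have hC : 0 ≤ C := nonneg_of_mul_nonneg_left ((norm_nonneg _).trans (hb 0)) (Real.exp_pos _)
  set g : ℕ → ℝ := fun m => Real.exp (-(c / 2) * (m : ℝ) ^ (1 / α)) with hg
  have hgs : Summable g := summable_exp_neg_rpow hα (half_pos hc)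
  have hgs1 : Summable fun m => g (m + 1) := (summable_nat_add_iff 1).2 hgs
  refine coeffDecay_iff_exp.2 ⟨C * ∑' m, g (m + 1), c / 2, half_pos hc, fun n => ?_⟩
  set K : ℝ := C * (∑' m, g (m + 1)) * Real.exp (-(c / 2) * (len n : ℝ) ^ (1 / α)) with hK
  have hstep : ∀ m : ℕ, ‖a (n + Pi.single l m)‖ ≤ ‖a (n + Pi.single l (m + 1))‖ +
      C * Real.exp (-(c / 2) * (len n : ℝ) ^ (1 / α)) * g (m + 1) := by
    intro m
    have h1 := hb (n + Pi.single l (m + 1))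
    have h2 : backDiff l a (n + Pi.single l (m + 1)) =
        a (n + Pi.single l (m + 1)) - a (n + Pi.single l m) := by
      have h3 : n + Pi.single l (m + 1) - Pi.single l 1 = n + Pi.single l m := by
        rw [Pi.single_add, ← add_assoc, add_tsub_cancel_right]
      rw [backDiff, h3, if_neg (by simp)]
    rw [h2, len_add_single, Nat.cast_add] at h1
    have h4 := exp_neg_add_rpow_le hα hc (Nat.cast_nonneg (len n)) (m + 1)
    have h5 := norm_sub_norm_le (a (n + Pi.single l m)) (a (n + Pi.single l (m + 1)))
    rw [norm_sub_rev] at h5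
    have h6 : C * Real.exp (-c * ((len n : ℝ) + (m + 1 : ℕ)) ^ (1 / α)) ≤
        C * Real.exp (-(c / 2) * (len n : ℝ) ^ (1 / α)) * g (m + 1) := by
      rw [mul_assoc]
      exact mul_le_mul_of_nonneg_left h4 hC
    linarith
  have hind : ∀ N : ℕ, ‖a n‖ ≤ ‖a (n + Pi.single l N)‖ +
      C * Real.exp (-(c / 2) * (len n : ℝ) ^ (1 / α)) * ∑ m ∈ Finset.range N, g (m + 1) := by
    intro N
    induction N with
    | zero => simp
    | succ N ih =>
      rw [Finset.sum_range_succ, mul_add]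
      linarith [hstep N]
  have hbound : ∀ N : ℕ, ‖a n‖ ≤ ‖a (n + Pi.single l N)‖ + K := by
    intro N
    refine (hind N).trans ?_
    have h1 : ∑ m ∈ Finset.range N, g (m + 1) ≤ ∑' m, g (m + 1) :=
      hgs1.sum_le_tsum _ fun m _ => (Real.exp_pos _).le
    have h2 := mul_le_mul_of_nonneg_left h1
      (show 0 ≤ C * Real.exp (-(c / 2) * (len n : ℝ) ^ (1 / α)) by positivity)
    have h3 : C * Real.exp (-(c / 2) * (len n : ℝ) ^ (1 / α)) * ∑' m, g (m + 1) = K := by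
      rw [hK]; ring
    linarith
  have hinj : Function.Injective fun N : ℕ => n + Pi.single l N :=
    (add_right_injective n).comp (Pi.single_injective l)
  have hlim : Tendsto (fun N : ℕ => ‖a (n + Pi.single l N)‖ + K) atTop (𝓝 (0 + K)) := by
    have h1 := (ha.comp hinj.tendsto_cofinite).norm
    rw [Nat.cofinite_eq_atTop, norm_zero] at h1
    exact h1.add_const K
  rw [zero_add] at hlim
  exact ge_of_tendsto' hlim hbound

lemma coeffDecay_of_mixedDiff {α : ℝ} (hα : 0 < α) {a : (Fin d → ℕ) → ℂ}
    (ha : Tendsto a cofinite (𝓝 0)) (L : List (Fin d)) (h : CoeffDecay α (mixedDiff L a)) :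
    CoeffDecay α a := by
  have ht : ∀ L : List (Fin d), Tendsto (mixedDiff L a) cofinite (𝓝 0) := by
    intro L
    induction L with
    | nil => exact ha
    | cons l L ih => exact tendsto_backDiff ih l
  induction L with
  | nil => exact h
  | cons l L ih => exact ih (coeffDecay_of_backDiff hα (ht L) h)

end Differences

/-! ### Derivative bounds on the polydisc against decay of the coefficients. -/

section PolydiscConditions

variable {d : ℕ}

lemma len_single (l : Fin d) (p : ℕ) : len (Pi.single l p) = p := by
  simp [len]

lemma selfPow_single (r : ℝ) (l : Fin d) (p : ℕ) :
    selfPow r (Pi.single l p) = (p : ℝ) ^ (r * p) := by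
  rw [selfPow, mpow, Finset.prod_eq_single l]
  · simp
  · intro j _ hj; simp [hj]
  · simp

lemma selfPow_nonneg (r : ℝ) (p : Fin d → ℕ) : 0 ≤ selfPow r p := by
  unfold selfPow mpow
  positivity

lemma tendsto_len_cofinite : Tendsto (len : (Fin d → ℕ) → ℕ) cofinite atTop := by
  rw [← Nat.cofinite_eq_atTop]
  refine Tendsto.cofinite_of_finite_preimage_singleton fun k => ?_
  refine (Set.finite_Iic (fun _ : Fin d => k)).subset fun n hn l => ?_
  have h : len n = k := hn
  rw [← h]
  exact Finset.single_le_sum (f := n) (fun _ _ => Nat.zero_le _) (Finset.mem_univ l)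

lemma exists_bound_of_tendsto_cofinite {a : (Fin d → ℕ) → ℂ} (ha : Tendsto a cofinite (𝓝 0)) :
    ∃ M, ∀ n, ‖a n‖ ≤ M := by
  have h1 : ∀ᶠ n in cofinite, ‖a n‖ < 1 := by
    have := ha.norm
    rw [norm_zero] at this
    exact this.eventually_lt_const one_pos
  rw [eventually_cofinite] at h1
  obtain ⟨M, hM⟩ := (h1.image fun n => ‖a n‖).bddAbove
  refine ⟨max M 1, fun n => ?_⟩
  by_cases hn : ‖a n‖ < 1
  · exact hn.le.trans (le_max_right _ _)
  · exact (hM ⟨n, hn, rfl⟩).trans (le_max_left _ _)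

/-- Gevrey bounds of the generating function force exponential decay of the coefficients. -/
lemma coeffDecay_of_derivBound (hd : 1 ≤ d) {α : ℝ} (hα : 1 ≤ α) {a : (Fin d → ℕ) → ℂ}
    (ha : Tendsto a cofinite (𝓝 0)) {F : (Fin d → ℂ) → ℂ}
    (hF : EqOn F (laguerreGen a) (polydisc d)) (hb : DerivBound α F) : CoeffDecay α a := by
  obtain ⟨M, hM⟩ := exists_bound_of_tendsto_cofinite ha
  set f := mixedDiff (List.finRange d) a with hf
  obtain ⟨M', hM'⟩ := exists_bound_mixedDiff hM (List.finRange d)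
  obtain ⟨C, A, hC, hA, h⟩ := hb
  obtain ⟨c, hc, hnum⟩ := exists_exp_decay_of_descFactorial_bound hα hC.le hA
  refine coeffDecay_of_mixedDiff (by linarith) ha (List.finRange d) ?_
  refine coeffDecay_of_forall_coord hd (C := C * Real.exp 1) (c := c) (by linarith)
    (by positivity) hc fun n l => ?_
  refine hnum (n l) _ (norm_nonneg _) fun p _ => ?_
  have hmd := mderiv_eq_powSeries hM' (hF.trans (laguerreGen_eq_powSeries hM)) (Pi.single l p)
  -- Only the pure derivatives `∂_l^p F` are needed. The factor `w_l^p`, of modulus at most `1`,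
  -- restores the exponents, giving a power series with coefficients `f_m (m_l)_p` to which Cauchy's
  -- inequality applies.
  have hterm : ∀ (w : Fin d → ℂ) (m : Fin d → ℕ),
      f m * ((m l).descFactorial p : ℂ) * ∏ j, w j ^ m j =
        w l ^ p * (f m * ∏ j, powDeriv (m j) ((Pi.single l p : Fin d → ℕ) j) (w j)) := by
    intro w m
    have h1 : ∀ j, powDeriv (m j) ((Pi.single l p : Fin d → ℕ) j) (w j) =
        if j = l then powDeriv (m l) p (w l) else w j ^ m j := by
      intro j
      split_ifs with hj
      · subst hj; simp
      · simp [hj, powDeriv]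
    simp only [h1]
    rw [← Finset.mul_prod_erase _ _ (Finset.mem_univ l),
      ← Finset.mul_prod_erase _ (fun j => if j = l then _ else _) (Finset.mem_univ l), if_pos rfl]
    have h2 : ∏ j ∈ Finset.univ.erase l, (if j = l then powDeriv (m l) p (w l) else w j ^ m j) =
        ∏ j ∈ Finset.univ.erase l, w j ^ m j :=
      Finset.prod_congr rfl fun j hj => if_neg (Finset.ne_of_mem_erase hj)
    rw [h2, powDeriv]
    rcases Nat.lt_or_ge (m l) p with hp | hp
    · simp [Nat.descFactorial_of_lt hp]
    · rw [← pow_mul_pow_sub (w l) hp]; ring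
  have hle := norm_coeff_le_of_norm_tsum_le
    (c := fun m => f m * ((m l).descFactorial p : ℂ)) (M := C * A ^ p * (p : ℝ) ^ (α * p)) ?_ ?_ n
  · simpa [norm_mul] using hle
  · intro w hw
    simp only [hterm w, norm_mul (w l ^ p)]
    exact (summable_norm_powSeries hM' (Pi.single l p) hw).mul_left _
  · intro w hw
    simp only [hterm w]
    rw [tsum_mul_left, norm_mul]
    have h3 := h (Pi.single l p) w hw
    rw [hmd hw, len_single, selfPow_single] at h3
    refine le_trans (mul_le_of_le_one_left (norm_nonneg _) ?_) h3
    rw [norm_pow]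
    exact pow_le_one₀ (norm_nonneg _) (hw l).le

lemma prod_pow_len (A : ℝ) (p : Fin d → ℕ) : ∏ l, A ^ p l = A ^ len p := by
  rw [len, Finset.prod_pow_eq_pow_sum]

/-- Exponential decay of the coefficients gives Gevrey bounds of the generating function. -/
lemma derivBound_of_coeffDecay (hd : 1 ≤ d) {α : ℝ} (hα : 1 ≤ α) {a : (Fin d → ℕ) → ℂ}
    (ha : CoeffDecay α a) {F : (Fin d → ℂ) → ℂ}
    (hF : EqOn F (laguerreGen a) (polydisc d)) : DerivBound α F := by
  have hα0 : 0 < α := by linarith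
  obtain ⟨C₀, c₀, hc₀, hC₀⟩ := coeffDecay_iff_exp.1 ha
  have hM : ∀ n, ‖a n‖ ≤ |C₀| := fun n => (hC₀ n).trans <| by
    refine (mul_le_mul_of_nonneg_right (le_abs_self C₀) (Real.exp_pos _).le).trans ?_
    refine mul_le_of_le_one_right (abs_nonneg _) (Real.exp_le_one_iff.2 ?_)
    nlinarith [show (0 : ℝ) ≤ (len n : ℝ) ^ (1 / α) by positivity]
  set f := mixedDiff (List.finRange d) a with hf
  obtain ⟨M', hM'⟩ := exists_bound_mixedDiff hM (List.finRange d)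
  obtain ⟨C, c, hc, hC⟩ := coeffDecay_iff_exp.1 (coeffDecay_mixedDiff hα ha (List.finRange d))
  have hC0 : 0 ≤ C := nonneg_of_mul_nonneg_left ((norm_nonneg _).trans (hC 0)) (Real.exp_pos _)
  have hd0 : (0 : ℝ) < d := by exact_mod_cast hd
  -- The rate `c` is shared among the `d` coordinates and halved: one half absorbs `n_l^{p_l}`, the
  -- other makes the sum over `n` converge.
  set γ : ℝ := c / d / 2 with hγ
  have hγ0 : 0 < γ := by positivity
  set g : ℕ → ℝ := fun k => Real.exp (-γ * (k : ℝ) ^ (1 / α)) with hg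
  have hgs : Summable g := summable_exp_neg_rpow hα0 hγ0
  have hG : Summable fun n : Fin d → ℕ => ∏ l, g (n l) :=
    summable_prod_pi (f := fun _ => g) (fun _ _ => (Real.exp_pos _).le) fun _ => hgs
  set S := ∑' n : Fin d → ℕ, ∏ l, g (n l) with hS
  set A : ℝ := (α / γ) ^ α with hA
  have hA0 : 0 < A := by positivity
  -- The `+ 1` keeps the constant positive even when `C = 0`.
  refine ⟨C * S + 1, A, ?_, hA0, fun p w hw => ?_⟩
  · have : 0 ≤ S := tsum_nonneg fun n => Finset.prod_nonneg fun l _ => (Real.exp_pos _).le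
    positivity
  rw [mderiv_eq_powSeries hM' (hF.trans (laguerreGen_eq_powSeries hM)) p hw]
  have hterm : ∀ n : Fin d → ℕ, ‖f n * ∏ l, powDeriv (n l) (p l) (w l)‖ ≤
      C * (A ^ len p * selfPow α p) * ∏ l, g (n l) := by
    intro n
    have h1 : ‖f n‖ ≤ C * ∏ l, (g (n l) * g (n l)) := by
      refine (hC n).trans (mul_le_mul_of_nonneg_left ?_ hC0)
      refine (exp_neg_len_rpow_le_prod hd hα0 hc n).trans_eq (Finset.prod_congr rfl fun l _ => ?_)
      rw [hg, ← Real.exp_add]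
      congr 1
      rw [hγ]; ring
    have h2 : ∀ l, ‖powDeriv (n l) (p l) (w l)‖ ≤ (n l : ℝ) ^ p l := by
      intro l
      refine (norm_powDeriv_le (r := 1) _ _ (hw l).le).trans ?_
      rw [one_pow, mul_one]
      exact_mod_cast Nat.descFactorial_le_pow _ _
    calc ‖f n * ∏ l, powDeriv (n l) (p l) (w l)‖
        ≤ (C * ∏ l, (g (n l) * g (n l))) * ∏ l, (n l : ℝ) ^ p l := by
          rw [norm_mul, norm_prod]
          refine mul_le_mul h1 (Finset.prod_le_prod (fun l _ => norm_nonneg _) fun l _ => h2 l)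
            (by positivity) ((norm_nonneg _).trans h1)
      _ = C * ∏ l, ((n l : ℝ) ^ p l * g (n l) * g (n l)) := by
          rw [mul_assoc, ← Finset.prod_mul_distrib]
          congr 1
          exact Finset.prod_congr rfl fun l _ => by ring
      _ ≤ C * ∏ l, (A ^ p l * (p l : ℝ) ^ (α * p l) * g (n l)) := by
          refine mul_le_mul_of_nonneg_left ?_ hC0
          refine Finset.prod_le_prod (fun l _ => by positivity) fun l _ => ?_
          refine mul_le_mul_of_nonneg_right ?_ (Real.exp_pos _).le
          exact pow_mul_exp_neg_rpow_le hα0 hγ0 (Nat.cast_nonneg _) (p l)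
      _ = _ := by
          rw [Finset.prod_mul_distrib, Finset.prod_mul_distrib, prod_pow_len, selfPow, mpow]
          ring
  refine (tsum_of_norm_bounded (hG.hasSum.mul_left _) hterm).trans ?_
  rw [← hS]
  have h3 : 0 ≤ A ^ len p * selfPow α p := by
    have : 0 ≤ selfPow α p := selfPow_nonneg α p
    positivity
  nlinarith

/-- The series is bounded on the polydisc by its absolutely summable coefficients, while the
prefactor tends to `0` at `𝟏` because `d ≥ 1`. -/
lemma tendsto_of_coeffDecay (hd : 1 ≤ d) {α : ℝ} (hα : 0 < α) {a : (Fin d → ℕ) → ℂ}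
    (ha : CoeffDecay α a) {F : (Fin d → ℂ) → ℂ}
    (hF : EqOn F (laguerreGen a) (polydisc d)) : Tendsto F (𝓝[polydisc d] 1) (𝓝 0) := by
  obtain ⟨C, c, hc, hC⟩ := coeffDecay_iff_exp.1 ha
  have hC0 : 0 ≤ C := nonneg_of_mul_nonneg_left ((norm_nonneg _).trans (hC 0)) (Real.exp_pos _)
  have hd0 : (0 : ℝ) < d := by exact_mod_cast hd
  have hG : Summable fun n : Fin d → ℕ =>
      C * ∏ l, Real.exp (-(c / d) * (n l : ℝ) ^ (1 / α)) :=
    (summable_prod_pi (f := fun (_ : Fin d) (k : ℕ) => Real.exp (-(c / d) * (k : ℝ) ^ (1 / α)))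
      (fun _ _ => (Real.exp_pos _).le)
      fun _ => summable_exp_neg_rpow hα (by positivity)).mul_left C
  set S := ∑' n : Fin d → ℕ, C * ∏ l, Real.exp (-(c / d) * (n l : ℝ) ^ (1 / α)) with hS
  have hbd : ∀ w ∈ polydisc d, ‖F w‖ ≤ ‖∏ l, (1 - w l)‖ * S := by
    intro w hw
    rw [hF hw, laguerreGen, norm_mul]
    refine mul_le_mul_of_nonneg_left ?_ (norm_nonneg _)
    refine tsum_of_norm_bounded hG.hasSum fun n => ?_
    rw [norm_mul, norm_prod]
    refine (mul_le_of_le_one_right (norm_nonneg _) ?_).trans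
      ((hC n).trans (mul_le_mul_of_nonneg_left (exp_neg_len_rpow_le_prod hd hα hc n) hC0))
    refine Finset.prod_le_one (fun l _ => norm_nonneg _) fun l _ => ?_
    rw [norm_pow]
    exact pow_le_one₀ (norm_nonneg _) (hw l).le
  have hcont : Continuous fun w : Fin d → ℂ => ‖∏ l, (1 - w l)‖ * S := by fun_prop
  have hlim := (hcont.tendsto 1).mono_left (nhdsWithin_le_nhds (s := polydisc d))
  have h0 : ‖∏ l : Fin d, (1 - (1 : Fin d → ℂ) l)‖ * S = 0 := by
    rw [Finset.prod_eq_zero (Finset.mem_univ (⟨0, hd⟩ : Fin d)) (by simp)]; simp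
  rw [h0] at hlim
  refine squeeze_zero_norm' ?_ hlim
  filter_upwards [self_mem_nhdsWithin] with w hw
  exact hbd w hw

end PolydiscConditions

end LaguerreG

/-! ### Integration by parts on the orthant. -/

namespace LaguerreG

open Polynomial

section IntegrationByParts

variable {d : ℕ}

lemma integral_Ioi_eq_zero_of_hasDerivAt {h h' : ℝ → ℂ} (hd : ∀ s ∈ Ioi (0 : ℝ), HasDerivAt h (h' s) s)
    (hint : IntegrableOn h' (Ioi 0)) (h0 : Tendsto h (𝓝[>] 0) (𝓝 0))
    (hinf : Tendsto h atTop (𝓝 0)) : ∫ s in Ioi (0 : ℝ), h' s = 0 := by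
  -- The value of `h` at `0` is arbitrary; setting it to the limit `0` gives continuity from the
  -- right.
  set F : ℝ → ℂ := fun s => if 0 < s then h s else 0 with hF
  have hFh : EqOn F h (Ioi 0) := fun s hs => if_pos hs
  have hF0 : F 0 = 0 := if_neg (lt_irrefl _)
  have h1 := integral_Ioi_of_hasDerivAt_of_tendsto (f := F) (f' := h') (a := 0) (m := 0) ?_ ?_ hint ?_
  · rw [h1, hF0, sub_zero]
  · rw [← continuousWithinAt_Ioi_iff_Ici, ContinuousWithinAt, hF0]
    exact h0.congr' (hFh.symm.eventuallyEq_of_mem self_mem_nhdsWithin)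
  · intro s hs
    exact (hd s hs).congr_of_eventuallyEq (hFh.eventuallyEq_of_mem (Ioi_mem_nhds hs))
  · exact hinf.congr' (hFh.symm.eventuallyEq_of_mem (Ioi_mem_atTop 0))

/-- The integral over the orthant of a partial derivative vanishes when there are no boundary
terms. -/
lemma integral_orthant_eq_zero_of_hasDerivAt (l : Fin d) {h h' : (Fin d → ℝ) → ℂ}
    (hd : ∀ t ∈ orthant d, HasDerivAt (fun s => h (Function.update t l s)) (h' t) (t l))
    (hint : Integrable h' (orthantMeasure d))
    (h0 : ∀ t ∈ orthant d, Tendsto (fun s => h (Function.update t l s)) (𝓝[>] 0) (𝓝 0))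
    (hinf : ∀ t ∈ orthant d, Tendsto (fun s => h (Function.update t l s)) atTop (𝓝 0)) :
    ∫ t, h' t ∂orthantMeasure d = 0 := by
  cases d with
  | zero => exact l.elim0
  | succ n =>
    set μ : Measure ℝ := volume.restrict (Ioi 0) with hμ
    -- Split off the coordinate `l` and integrate over it first.
    have hmp := (measurePreserving_piFinSuccAbove (fun _ : Fin (n + 1) => μ) l).symm
    rw [orthantMeasure_eq_pi, ← hmp.integrable_comp_emb (MeasurableEquiv.measurableEmbedding _)]
      at hint
    simp only [Function.comp_def] at hint
    rw [orthantMeasure_eq_pi, ← hmp.integral_comp', integral_prod_symm _ hint]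
    refine integral_eq_zero_of_ae ?_
    have hy : ∀ᵐ y ∂(Measure.pi fun _ : Fin n => μ), y ∈ orthant n := by
      have := ae_mem_orthant n
      rwa [orthantMeasure_eq_pi] at this
    filter_upwards [hint.prod_left_ae, hy] with y hyint hyo
    have hup : ∀ s s' : ℝ, Function.update ((MeasurableEquiv.piFinSuccAbove (fun _ => ℝ) l).symm (s', y)) l s
        = (MeasurableEquiv.piFinSuccAbove (fun _ => ℝ) l).symm (s, y) := by
      intro s s'
      simp [MeasurableEquiv.piFinSuccAbove_symm_apply, Fin.insertNthEquiv]
    have hl : ∀ s : ℝ, (MeasurableEquiv.piFinSuccAbove (fun _ => ℝ) l).symm (s, y) l = s := by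
      intro s
      simp [MeasurableEquiv.piFinSuccAbove_symm_apply, Fin.insertNthEquiv]
    have hmem : ∀ s : ℝ, 0 < s →
        (MeasurableEquiv.piFinSuccAbove (fun _ => ℝ) l).symm (s, y) ∈ orthant (n + 1) := by
      intro s hs j
      rcases Fin.eq_self_or_eq_succAbove l j with rfl | ⟨i, rfl⟩
      · rw [hl]; exact hs
      · simpa [MeasurableEquiv.piFinSuccAbove_symm_apply, Fin.insertNthEquiv] using hyo i
    refine integral_Ioi_eq_zero_of_hasDerivAt
      (h := fun s => h ((MeasurableEquiv.piFinSuccAbove (fun _ => ℝ) l).symm (s, y)))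
      (fun s hs => ?_) hyint ?_ ?_
    · have := hd _ (hmem s hs)
      simpa only [hup, hl] using this
    · simpa only [hup] using h0 _ (hmem 1 one_pos)
    · simpa only [hup] using hinf _ (hmem 1 one_pos)

lemma polyFun_eq_mul (P : Fin d → ℝ[X]) (l : Fin d) (t : Fin d → ℝ) :
    polyFun P t = ((P l).eval (t l) * Real.exp (-(t l) / 2)) *
      ∏ j ∈ Finset.univ.erase l, (P j).eval (t j) * Real.exp (-(t j) / 2) :=
  (Finset.mul_prod_erase _ _ (Finset.mem_univ l)).symm

lemma polyFun_update (P : Fin d → ℝ[X]) (l : Fin d) (R : ℝ[X]) (t : Fin d → ℝ) :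
    polyFun (Function.update P l R) t = (R.eval (t l) * Real.exp (-(t l) / 2)) *
      ∏ j ∈ Finset.univ.erase l, (P j).eval (t j) * Real.exp (-(t j) / 2) := by
  rw [polyFun_eq_mul _ l, Function.update_self]
  congr 1
  refine Finset.prod_congr rfl fun j hj => ?_
  rw [Function.update_of_ne (Finset.ne_of_mem_erase hj)]

lemma polyFun_update_update (P : Fin d → ℝ[X]) (l : Fin d) (R : ℝ[X]) (t : Fin d → ℝ) (s : ℝ) :
    polyFun (Function.update P l R) (Function.update t l s) =
      (R.eval s * Real.exp (-s / 2)) *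
      ∏ j ∈ Finset.univ.erase l, (P j).eval (t j) * Real.exp (-(t j) / 2) := by
  rw [polyFun_update, Function.update_self]
  congr 1
  refine Finset.prod_congr rfl fun j hj => ?_
  rw [Function.update_of_ne (Finset.ne_of_mem_erase hj)]

lemma integrable_bdd_mul_polyFun {g : (Fin d → ℝ) → ℂ} (hg : ContinuousOn g (orthant d)) {M : ℝ}
    (hM : ∀ t ∈ orthant d, ‖g t‖ ≤ M) (P : Fin d → ℝ[X]) :
    Integrable (fun t => g t * (polyFun P t : ℂ)) (orthantMeasure d) := by
  refine (integrable_polyFun P).ofReal.bdd_mul (c := M)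
    (hg.aestronglyMeasurable (measurableSet_orthant d)) ?_
  filter_upwards [ae_mem_orthant d] with t ht
  exact hM t ht

/-- The boundary term at `t_l = 0` vanishes since `R(0) = 0` and `g` is bounded; the one at infinity
is killed by the exponential. -/
lemma integral_pderiv_mul_polyFun {g : (Fin d → ℝ) → ℂ} (hg : ContDiffOn ℝ ∞ g (orthant d))
    (l : Fin d) {M M' : ℝ} (hM : ∀ t ∈ orthant d, ‖g t‖ ≤ M)
    (hM' : ∀ t ∈ orthant d, ‖pderiv ℝ l g t‖ ≤ M') (P : Fin d → ℝ[X]) {R : ℝ[X]}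
    (hR : R.eval 0 = 0) :
    ∫ t, pderiv ℝ l g t * (polyFun (Function.update P l R) t : ℂ) ∂orthantMeasure d =
      - ∫ t, g t * (polyFun (Function.update P l (twistDeriv R)) t : ℂ) ∂orthantMeasure d := by
  have hO := isOpen_orthant d
  have h1 := integrable_bdd_mul_polyFun (contDiffOn_pderiv hO hg l).continuousOn hM'
    (Function.update P l R)
  have h2 := integrable_bdd_mul_polyFun hg.continuousOn hM (Function.update P l (twistDeriv R))
  have hbd : ∀ t ∈ orthant d, ∀ s > 0,
      ‖g (Function.update t l s) *
        (polyFun (Function.update P l R) (Function.update t l s) : ℂ)‖ ≤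
      M * ‖R.eval s * Real.exp (-s / 2)‖ *
        ‖∏ j ∈ Finset.univ.erase l, (P j).eval (t j) * Real.exp (-(t j) / 2)‖ := by
    intro t ht s hs
    rw [norm_mul, Complex.norm_real, polyFun_update_update, norm_mul, ← mul_assoc]
    gcongr
    refine hM _ fun j => ?_
    by_cases hj : j = l
    · subst hj; simpa using hs
    · simpa [hj] using ht j
  rw [← sub_eq_zero, sub_neg_eq_add, ← integral_add h1 h2]
  refine integral_orthant_eq_zero_of_hasDerivAt l
    (h := fun t => g t * (polyFun (Function.update P l R) t : ℂ)) (fun t ht => ?_)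
    (h1.add h2) (fun t ht => ?_) fun t ht => ?_
  · have e1 : HasDerivAt (fun s => g (Function.update t l s)) (pderiv ℝ l g t) (t l) := by
      have hda := (hg.contDiffAt (hO.mem_nhds ht)).differentiableAt (by simp)
      have hda' : HasFDerivAt g (fderiv ℝ g t) (Function.update t l (t l)) := by
        rw [Function.update_eq_self]; exact hda.hasFDerivAt
      have := hda'.comp_hasDerivAt (t l) (hasDerivAt_update t l (t l))
      rwa [← hda.lineDeriv_eq_fderiv] at this
    have e2 : HasDerivAt (fun s => polyFun (Function.update P l R) (Function.update t l s))
        (polyFun (Function.update P l (twistDeriv R)) t) (t l) := by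
      simp only [polyFun_update_update]
      rw [polyFun_update]
      exact (hasDerivAt_eval_mul_exp R (t l)).mul_const _
    refine (e1.mul e2.ofReal_comp).congr_deriv ?_
    simp only [Function.update_eq_self]
  · have hlim : Tendsto (fun s : ℝ => M * ‖R.eval s * Real.exp (-s / 2)‖ *
        ‖∏ j ∈ Finset.univ.erase l, (P j).eval (t j) * Real.exp (-(t j) / 2)‖) (𝓝[>] 0) (𝓝 0) := by
      have hc : Continuous (fun s : ℝ => M * ‖R.eval s * Real.exp (-s / 2)‖ *
        ‖∏ j ∈ Finset.univ.erase l, (P j).eval (t j) * Real.exp (-(t j) / 2)‖) := by fun_prop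
      have := (hc.tendsto 0).mono_left (nhdsWithin_le_nhds (s := Ioi 0))
      simpa [hR] using this
    refine squeeze_zero_norm' ?_ hlim
    filter_upwards [self_mem_nhdsWithin] with s hs
    exact hbd t ht s hs
  · have hlim : Tendsto (fun s : ℝ => M * ‖R.eval s * Real.exp (-s / 2)‖ *
        ‖∏ j ∈ Finset.univ.erase l, (P j).eval (t j) * Real.exp (-(t j) / 2)‖) atTop (𝓝 0) := by
      have h3 := (tendsto_eval_mul_exp R (c := 1 / 2) (by norm_num)).norm
      have h4 : ∀ s : ℝ, -(1 / 2 * s) = -s / 2 := fun s => by ring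
      simp only [h4, norm_zero] at h3
      simpa using (h3.const_mul M).mul_const
        ‖∏ j ∈ Finset.univ.erase l, (P j).eval (t j) * Real.exp (-(t j) / 2)‖
    refine squeeze_zero_norm' ?_ hlim
    filter_upwards [Ioi_mem_atTop 0] with s hs
    exact hbd t ht s hs

end IntegrationByParts

/-! ### Decay of the coefficients of functions in `G`. -/

section CoefficientDecay

variable {d : ℕ} {f : (Fin d → ℝ) → ℂ}

/-- The pairing of `∂_l^j f` with `t_l^p L_{n_l}^{(p)}(t_l) e^{-t_l/2}` and the Laguerre functions
in the other variables. -/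
noncomputable def derivPairing (f : (Fin d → ℝ) → ℂ) (n : Fin d → ℕ) (l : Fin d) (j p : ℕ) : ℂ :=
  ∫ t, (pderiv ℝ l)^[j] f t * (polyFun (Function.update (fun i => lagPoly (n i)) l
    (X ^ p * derivative^[p] (lagPoly (n l)))) t : ℂ) ∂orthantMeasure d

lemma derivPairing_zero (f : (Fin d → ℝ) → ℂ) (n : Fin d → ℕ) (l : Fin d) :
    derivPairing f n l 0 0 = laguerreCoeff f n := by
  simp only [derivPairing, laguerreCoeff, laguerreFun_eq_polyFun, pow_zero, one_mul,
    Function.iterate_zero, id]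
  rw [Function.update_eq_self]

lemma IsSchwartz.bounded_iterate_pderiv (hf : IsSchwartz f) (l : Fin d) (j : ℕ) :
    ∃ M, ∀ t ∈ orthant d, ‖(pderiv ℝ l)^[j] f t‖ ≤ M := by
  obtain ⟨M, hM⟩ := hf.decay 0 (Pi.single l j)
  refine ⟨M, fun t ht => ?_⟩
  simpa [mderiv_single] using hM t ht

lemma twistDeriv_X_pow_mul_iterate (n p : ℕ) :
    twistDeriv (X ^ (p + 1) * derivative^[p + 1] (lagPoly n)) =
      (1 / 2 : ℝ) • (X ^ (p + 1) * derivative^[p + 1] (lagPoly n)) -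
        ((n : ℝ) - p) • (X ^ p * derivative^[p] (lagPoly n)) := by
  have ode := lagPoly_ode n p
  have h1 : derivative (X ^ (p + 1) * derivative^[p + 1] (lagPoly n)) =
      X ^ (p + 1) * derivative^[p + 1] (lagPoly n) -
        ((n : ℝ) - p) • (X ^ p * derivative^[p] (lagPoly n)) := by
    simp only [derivative_mul, derivative_X_pow, ← Function.iterate_succ_apply'
      (derivative : ℝ[X] → ℝ[X]), Nat.add_sub_cancel, smul_eq_C_mul]
    simp only [map_add, map_one, map_natCast, Nat.cast_add, Nat.cast_one, map_sub,
      pow_succ] at ode ⊢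
    linear_combination (X ^ p) * ode
  rw [twistDeriv_apply, h1]
  module

/-- Integrate by parts against `t^{p+1} L^{(p+1)} e^{-t/2}`: its derivative contains `-(n_l - p) t^p
L^{(p)} e^{-t/2}` by Laguerre's equation, and half the function itself. Each use gains a factor `n_l
- p`. -/
lemma derivPairing_succ (hf : IsSchwartz f) (n : Fin d → ℕ) (l : Fin d) (j p : ℕ) :
    ((n l : ℂ) - p) * derivPairing f n l j p =
      derivPairing f n l (j + 1) (p + 1) + 1 / 2 * derivPairing f n l j (p + 1) := by
  have hO := isOpen_orthant d
  obtain ⟨M, hM⟩ := hf.bounded_iterate_pderiv l j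
  obtain ⟨M', hM'⟩ := hf.bounded_iterate_pderiv l (j + 1)
  rw [Function.iterate_succ_apply'] at hM'
  have hsm := contDiffOn_iterate_pderiv hO hf.smooth l j
  have h := integral_pderiv_mul_polyFun hsm l hM hM' (fun i => lagPoly (n i))
    (R := X ^ (p + 1) * derivative^[p + 1] (lagPoly (n l))) (by simp)
  have hint := fun R => integrable_bdd_mul_polyFun hsm.continuousOn hM
    (Function.update (fun i => lagPoly (n i)) l R)
  have e : ∀ t, (pderiv ℝ l)^[j] f t * (polyFun (Function.update (fun i => lagPoly (n i)) l
      (twistDeriv (X ^ (p + 1) * derivative^[p + 1] (lagPoly (n l))))) t : ℂ) =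
      1 / 2 * ((pderiv ℝ l)^[j] f t * (polyFun (Function.update (fun i => lagPoly (n i)) l
        (X ^ (p + 1) * derivative^[p + 1] (lagPoly (n l)))) t : ℂ)) -
      ((n l : ℂ) - p) * ((pderiv ℝ l)^[j] f t * (polyFun (Function.update (fun i => lagPoly (n i)) l
        (X ^ p * derivative^[p] (lagPoly (n l)))) t : ℂ)) := by
    intro t
    rw [twistDeriv_X_pow_mul_iterate]
    simp only [polyFun_update, eval_sub, eval_smul, smul_eq_mul]
    push_cast
    ring
  simp only [e] at h
  rw [integral_sub ((hint _).const_mul _) ((hint _).const_mul _), integral_const_mul,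
    integral_const_mul] at h
  rw [derivPairing, derivPairing, derivPairing, Function.iterate_succ_apply', h]
  ring

/-- Descend from level `P`: the factors gained multiply to a falling factorial, and each of the `s`
steps branches into two terms, whence `2^s`. The condition `j ≤ p` keeps the order at level `P` at
most `P`, where `B` is available. -/
lemma norm_derivPairing_le_of_terminal (hf : IsSchwartz f) (n : Fin d → ℕ) (l : Fin d) {P : ℕ}
    {B : ℝ} (hP : P ≤ n l) (hB : ∀ i ≤ P, ‖derivPairing f n l i P‖ ≤ B) (s : ℕ) :
    ∀ p j : ℕ, p + s = P → j ≤ p →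
      ((n l - p).descFactorial s : ℝ) * ‖derivPairing f n l j p‖ ≤ 2 ^ s * B := by
  induction s with
  | zero =>
    intro p j hp hj
    rw [add_zero] at hp
    subst hp
    simpa using hB j hj
  | succ s ih =>
    intro p j hp hj
    have h1 := ih (p + 1) (j + 1) (by omega) (by omega)
    have h2 := ih (p + 1) j (by omega) (by omega)
    have h3 := congrArg norm (derivPairing_succ hf n l j p)
    have hcast : ((n l - p : ℕ) : ℝ) = ‖(n l : ℂ) - p‖ := by
      rw [← Nat.cast_sub (by omega : p ≤ n l), Complex.norm_natCast]
    rw [norm_mul, ← hcast] at h3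
    have hdf : ((n l - p).descFactorial (s + 1) : ℝ) =
        ((n l - (p + 1)).descFactorial s : ℝ) * ((n l - p : ℕ) : ℝ) := by
      obtain ⟨m, hm⟩ : ∃ m, n l - p = m + 1 := ⟨n l - p - 1, by omega⟩
      rw [hm, Nat.succ_descFactorial_succ, show n l - (p + 1) = m by omega]
      push_cast; ring
    rw [hdf, mul_assoc, h3]
    have h4 : ‖derivPairing f n l (j + 1) (p + 1) + 1 / 2 * derivPairing f n l j (p + 1)‖ ≤
        ‖derivPairing f n l (j + 1) (p + 1)‖ + ‖derivPairing f n l j (p + 1)‖ := by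
      refine (norm_add_le _ _).trans (add_le_add_right ?_ _)
      rw [norm_mul]
      refine mul_le_of_le_one_left (norm_nonneg _) ?_
      norm_num
    calc _ ≤ ((n l - (p + 1)).descFactorial s : ℝ) *
          (‖derivPairing f n l (j + 1) (p + 1)‖ + ‖derivPairing f n l j (p + 1)‖) := by gcongr
      _ ≤ 2 ^ s * B + 2 ^ s * B := by rw [mul_add]; exact add_le_add h1 h2
      _ = _ := by ring

lemma mpow_single (l : Fin d) (x : ℝ) (t : Fin d → ℝ) :
    mpow t (Pi.single l x) = t l ^ x := by
  rw [mpow, Finset.prod_eq_single l]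
  · simp
  · intro j _ hj; simp [hj]
  · simp

/-- Split `t_l^P` into two halves `t_l^{P/2}` and apply Cauchy–Schwarz: one half with `∂_l^i f` is a
norm controlled by `G`, the other with `L^{(P)}` has norm exactly `√(n_l)_P`. -/
lemma norm_derivPairing_le (hf : IsSchwartz f) {α A C : ℝ} (hα : 0 ≤ α) (hA : 0 < A)
    (hC : ∀ p k : Fin d → ℕ,
      eLpNorm (fun t => (mpow t (fun l => ((p l : ℝ) + (k l : ℝ)) / 2) : ℂ) * mderiv ℝ p f t) 2
        (orthantMeasure d)
      ≤ ENNReal.ofReal (C * (A ^ len (p + k) * selfPow (α / 2) k * selfPow (α / 2) p)))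
    (n : Fin d → ℕ) (l : Fin d) {i P : ℕ} (hi : i ≤ P) :
    ‖derivPairing f n l i P‖ ≤ |C| * A ^ P * (P : ℝ) ^ (α / 2 * P) *
      √((n l).descFactorial P : ℝ) := by
  set s : Fin d → ℝ := Pi.single l ((P : ℝ) / 2) with hs
  set G : (Fin d → ℝ) → ℂ := fun t => (mpow t s : ℂ) * (pderiv ℝ l)^[i] f t with hG
  set Q : Fin d → ℝ[X] := Function.update (fun j => lagPoly (n j)) l
    (derivative^[P] (lagPoly (n l))) with hQ
  have hsq : ∀ j, s j = ((Pi.single l P : Fin d → ℕ) j : ℝ) / 2 := by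
    intro j
    by_cases hj : j = l
    · subst hj; simp [hs]
    · simp [hs, hj]
  have hK := memLp_mpow_mul_polyFun hsq Q
  have hKn := eLpNorm_mpow_mul_polyFun hsq Q
  have hprod : ∏ j, expInt (X ^ (Pi.single l P : Fin d → ℕ) j * Q j ^ 2) =
      ((n l).descFactorial P : ℝ) := by
    rw [Finset.prod_eq_single l]
    · simp [hQ, expInt_X_pow_mul_sq]
    · intro j _ hj
      simp [hQ, hj, sq, expInt_lagPoly_mul_self]
    · simp
  rw [hprod] at hKn
  have hGm : AEStronglyMeasurable G (orthantMeasure d) := by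
    refine (Complex.measurable_ofReal.comp (measurable_mpow s)).aestronglyMeasurable.mul ?_
    exact (contDiffOn_iterate_pderiv (isOpen_orthant d) hf.smooth l i).continuousOn.aestronglyMeasurable
      (measurableSet_orthant d)
  set D : ℝ := |C| * A ^ P * (P : ℝ) ^ (α / 2 * P) with hD
  have hD0 : 0 ≤ D := by positivity
  have hGn : eLpNorm G 2 (orthantMeasure d) ≤ ENNReal.ofReal D := by
    -- Taking `p = i e_l` and `k = (P - i) e_l` gives the weight exponent `(p + k)/2 = (P/2) e_l`.
    have h1 := hC (Pi.single l i) (Pi.single l (P - i))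
    have h2 : (fun j => (((Pi.single l i : Fin d → ℕ) j : ℝ) +
        ((Pi.single l (P - i) : Fin d → ℕ) j : ℝ)) / 2) = s := by
      ext j
      by_cases hj : j = l
      · subst hj; simp [hs, Nat.cast_sub hi]
      · simp [hs, hj]
    rw [h2, mderiv_single, ← Pi.single_add, len_single, Nat.add_sub_cancel' hi, selfPow_single,
      selfPow_single] at h1
    refine h1.trans (ENNReal.ofReal_le_ofReal ?_)
    have h3 : ((P - i : ℕ) : ℝ) ^ (α / 2 * (P - i : ℕ)) * (i : ℝ) ^ (α / 2 * i) ≤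
        (P : ℝ) ^ (α / 2 * P) := by
      rcases Nat.eq_zero_or_pos P with rfl | hP
      · have : i = 0 := by omega
        subst this; simp
      have hPr : (0 : ℝ) < P := by exact_mod_cast hP
      have hiP : (i : ℝ) ≤ P := by exact_mod_cast hi
      have hsub : ((P - i : ℕ) : ℝ) = P - i := Nat.cast_sub hi
      calc _ ≤ (P : ℝ) ^ (α / 2 * (P - i : ℕ)) * (P : ℝ) ^ (α / 2 * i) := by
            gcongr
            exact Nat.sub_le _ _
        _ = (P : ℝ) ^ (α / 2 * P) := by
            rw [← Real.rpow_add hPr, hsub]; congr 1; ring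
    calc C * (A ^ P * ((P - i : ℕ) : ℝ) ^ (α / 2 * (P - i : ℕ)) * (i : ℝ) ^ (α / 2 * i))
        ≤ |C| * (A ^ P * ((P - i : ℕ) : ℝ) ^ (α / 2 * (P - i : ℕ)) * (i : ℝ) ^ (α / 2 * i)) := by
          gcongr; exact le_abs_self C
      _ = |C| * A ^ P * (((P - i : ℕ) : ℝ) ^ (α / 2 * (P - i : ℕ)) * (i : ℝ) ^ (α / 2 * i)) := by
          ring
      _ ≤ D := by rw [hD]; gcongr
  have hGL : MemLp G 2 (orthantMeasure d) := ⟨hGm, hGn.trans_lt ENNReal.ofReal_lt_top⟩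
  have hcs := integral_norm_mul_le hGL hK
  have hJ : derivPairing f n l i P =
      ∫ t, G t * ((mpow t s * polyFun Q t : ℝ) : ℂ) ∂orthantMeasure d := by
    rw [derivPairing]
    refine integral_congr_ae ?_
    filter_upwards [ae_mem_orthant d] with t ht
    have h4 : mpow t s * mpow t s = t l ^ P := by
      rw [hs, mpow_single, ← Real.rpow_add (ht l), ← Real.rpow_natCast]
      congr 1; ring
    have h5 : (polyFun (Function.update (fun i => lagPoly (n i)) l
        (X ^ P * derivative^[P] (lagPoly (n l)))) t) = mpow t s * (mpow t s * polyFun Q t) := by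
      rw [← mul_assoc, h4, hQ, polyFun_update, polyFun_update]
      simp only [eval_mul, eval_pow, eval_X]
      ring
    rw [h5, hG]
    push_cast
    ring
  rw [hJ]
  refine (norm_integral_le_integral_norm _).trans (hcs.trans ?_)
  rw [hKn, ENNReal.toReal_ofReal (Real.sqrt_nonneg _)]
  gcongr
  exact ENNReal.toReal_le_of_le_ofReal hD0 hGn

/-- The Laguerre coefficients of the elements of `G^α_α` decay exponentially. -/
lemma coeffDecay_of_isG (hd : 1 ≤ d) {α : ℝ} (hα : 1 ≤ α) (hf : IsG α α f) :
    CoeffDecay α (laguerreCoeff f) := by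
  obtain ⟨A, hA, C, hC⟩ := hf.bound
  have hα0 : 0 ≤ α := by linarith
  obtain ⟨c, hc, hnum⟩ := exists_exp_decay_of_descFactorial_bound hα (sq_nonneg C)
    (show 0 < (2 * A) ^ 2 by positivity)
  refine coeffDecay_of_forall_coord hd (C := √(C ^ 2 * Real.exp 1)) (c := c / 2) (by linarith)
    (Real.sqrt_nonneg _) (half_pos hc) fun n l => ?_
  -- Squaring turns `√(n_l)_P` and `P^{αP/2}` into `(n_l)_P` and `P^{αP}`, as the numerical lemma
  -- requires; the final square root halves the rate.
  have key : ‖laguerreCoeff f n‖ ^ 2 ≤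
      C ^ 2 * Real.exp 1 * Real.exp (-c * (n l : ℝ) ^ (1 / α)) := by
    refine hnum (n l) _ (sq_nonneg _) fun P hP => ?_
    have h1 := norm_derivPairing_le_of_terminal hf.schwartz n l hP
      (fun i hi => norm_derivPairing_le hf.schwartz hα0 hA hC n l hi) P 0 0 (zero_add P) le_rfl
    rw [derivPairing_zero, Nat.sub_zero] at h1
    set x : ℝ := ((n l).descFactorial P : ℝ) with hx
    have hx0 : 0 < x := by
      rw [hx]; exact_mod_cast Nat.descFactorial_pos.2 hP
    have h2 : ‖laguerreCoeff f n‖ * √x ≤ |C| * (2 * A) ^ P * (P : ℝ) ^ (α / 2 * P) := by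
      have h3 : √x * (‖laguerreCoeff f n‖ * √x) ≤
          √x * (|C| * (2 * A) ^ P * (P : ℝ) ^ (α / 2 * P)) := by
        calc √x * (‖laguerreCoeff f n‖ * √x) = x * ‖laguerreCoeff f n‖ := by
              rw [mul_comm, mul_assoc, Real.mul_self_sqrt hx0.le, mul_comm]
          _ ≤ _ := h1
          _ = _ := by rw [mul_pow]; ring
      exact le_of_mul_le_mul_left h3 (Real.sqrt_pos.2 hx0)
    have h4 := pow_le_pow_left₀ (by positivity) h2 2
    have h5 : ((P : ℝ) ^ (α / 2 * P)) ^ 2 = (P : ℝ) ^ (α * P) := by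
      rw [← Real.rpow_natCast, ← Real.rpow_mul (by positivity)]
      congr 1; push_cast; ring
    rw [mul_pow, mul_pow, mul_pow, Real.sq_sqrt hx0.le, h5, sq_abs, ← pow_mul, mul_comm P 2,
      pow_mul] at h4
    exact h4
  have h6 := Real.sqrt_le_sqrt key
  rw [Real.sqrt_sq (norm_nonneg _), Real.sqrt_mul (by positivity)] at h6
  refine h6.trans_eq ?_
  congr 1
  rw [Real.sqrt_eq_rpow, ← Real.exp_mul]
  congr 1; ring

end CoefficientDecay

end LaguerreG

/-! ### Laguerre series with decaying coefficients belong to `G`. -/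

namespace LaguerreG

open Polynomial

/-- Minkowski's inequality for partial sums along an exhausting sequence of finite sets, then Fatou.
-/
lemma eLpNorm_le_of_hasSum {Ω ι : Type*} [MeasurableSpace Ω] {μ : Measure Ω} [Countable ι]
    {f : ι → Ω → ℂ} {g : Ω → ℂ} {r : ENNReal} (hr : 1 ≤ r)
    (hf : ∀ i, AEStronglyMeasurable (f i) μ)
    (hg : ∀ᵐ t ∂μ, HasSum (fun i => f i t) (g t)) {B : ι → ℝ} (hB0 : ∀ i, 0 ≤ B i)
    (hB : ∀ i, eLpNorm (f i) r μ ≤ ENNReal.ofReal (B i)) (hs : Summable B) :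
    eLpNorm g r μ ≤ ENNReal.ofReal (∑' i, B i) := by
  obtain ⟨s, hs'⟩ := exists_seq_tendsto (atTop : Filter (Finset ι))
  have h := Lp.eLpNorm_lim_le_liminf_eLpNorm (μ := μ) (p := r)
    (f := fun m => ∑ i ∈ s m, f i) (fun m => Finset.aestronglyMeasurable_sum _ fun i _ => hf i) g
    (by
      filter_upwards [hg] with t ht
      simpa only [Finset.sum_apply, Function.comp_def] using ht.comp hs')
  refine h.trans (liminf_le_of_frequently_le' (Frequently.of_forall fun m => ?_))
  refine (eLpNorm_sum_le (fun i _ => hf i) hr).trans ?_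
  refine (Finset.sum_le_sum fun i _ => hB i).trans ?_
  rw [← ENNReal.ofReal_sum_of_nonneg fun i _ => hB0 i]
  exact ENNReal.ofReal_le_ofReal (hs.sum_le_tsum _ fun i _ => hB0 i)

section Decay

variable {d : ℕ} {α : ℝ} {a : (Fin d → ℕ) → ℂ}

lemma CoeffDecay.exists_le_prod (hd : 1 ≤ d) (hα : 0 < α) (ha : CoeffDecay α a) :
    ∃ C c : ℝ, 0 ≤ C ∧ 0 < c ∧
      ∀ n, ‖a n‖ ≤ C * ∏ l, Real.exp (-c * (n l : ℝ) ^ (1 / α)) := by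
  obtain ⟨C, c, hc, h⟩ := coeffDecay_iff_exp.1 ha
  have hC : 0 ≤ C :=
    nonneg_of_mul_nonneg_left ((norm_nonneg _).trans (h 0)) (Real.exp_pos _)
  have hd0 : (0 : ℝ) < d := by exact_mod_cast hd
  exact ⟨C, c / d, hC, div_pos hc hd0, fun n => (h n).trans
    (mul_le_mul_of_nonneg_left (exp_neg_len_rpow_le_prod hd hα hc n) hC)⟩

lemma CoeffDecay.summable_mul_prod (hd : 1 ≤ d) (hα : 0 < α) (ha : CoeffDecay α a)
    {K : Fin d → ℝ} (hK : ∀ l, 0 ≤ K l) (N : Fin d → ℕ) :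
    Summable fun n : Fin d → ℕ => ‖a n‖ * ∏ l, (K l * ((n l : ℝ) + 1) ^ N l) := by
  obtain ⟨C, c, hC, hc, h⟩ := ha.exists_le_prod hd hα
  have hs := (summable_prod_pi
    (f := fun l n => K l * (((n : ℝ) + 1) ^ N l * Real.exp (-c * (n : ℝ) ^ (1 / α))))
    (fun l n => mul_nonneg (hK l) (by positivity))
    fun l => (summable_pow_mul_exp_neg_rpow hα hc (N l)).mul_left (K l)).mul_left C
  refine Summable.of_nonneg_of_le (fun n => ?_) (fun n => ?_) hs
  · exact mul_nonneg (norm_nonneg _)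
      (Finset.prod_nonneg fun l _ => mul_nonneg (hK l) (by positivity))
  · refine (mul_le_mul_of_nonneg_right (h n)
      (Finset.prod_nonneg fun l _ => mul_nonneg (hK l) (by positivity))).trans_eq ?_
    rw [mul_assoc, ← Finset.prod_mul_distrib]
    congr 1
    exact Finset.prod_congr rfl fun l _ => by ring

lemma CoeffDecay.summable_norm (hd : 1 ≤ d) (hα : 0 < α) (ha : CoeffDecay α a) :
    Summable fun n => ‖a n‖ := by
  simpa using ha.summable_mul_prod hd hα (K := fun _ => 1) (fun _ => zero_le_one) fun _ => 0

end Decay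

section LaguerreSeries

variable {d : ℕ} {α : ℝ} {a : (Fin d → ℕ) → ℂ}

/-- The `q`-th derivative of the one-dimensional Laguerre function of degree `n`. -/
noncomputable def lagDeriv (n q : ℕ) (t : ℝ) : ℂ :=
  (((twistDeriv^[q] (lagPoly n)).eval t * Real.exp (-t / 2) : ℝ) : ℂ)

lemma hasDerivAt_lagDeriv (n q : ℕ) (t : ℝ) :
    HasDerivAt (lagDeriv n q) (lagDeriv n (q + 1) t) t := by
  rw [lagDeriv, Function.iterate_succ_apply']
  exact (hasDerivAt_eval_mul_exp (twistDeriv^[q] (lagPoly n)) t).ofReal_comp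

lemma continuous_lagDeriv (n q : ℕ) : Continuous (lagDeriv n q) :=
  continuous_iff_continuousAt.2 fun t => (hasDerivAt_lagDeriv n q t).continuousAt

lemma exists_bound_lagDeriv : ∃ (K : ℕ → ℕ → ℝ) (N : ℕ → ℕ → ℕ), (∀ k q, 0 ≤ K k q) ∧
    ∀ k q n : ℕ, ∀ t : ℝ, 0 ≤ t →
      ‖(t : ℂ) ^ k * lagDeriv n q t‖ ≤ K k q * ((n : ℝ) + 1) ^ N k q := by
  choose K N hK h using fun k q => exists_bound_X_pow_mul_twistDeriv_lagPoly k q 0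
  refine ⟨K, N, hK, fun k q n t ht => ?_⟩
  rw [lagDeriv, ← Complex.ofReal_pow, ← Complex.ofReal_mul, Complex.norm_real, Real.norm_eq_abs]
  exact h k q n t ht

lemma prod_lagDeriv (n q : Fin d → ℕ) (t : Fin d → ℝ) :
    ∏ l, lagDeriv (n l) (q l) (t l) =
      (polyFun (fun l => twistDeriv^[q l] (lagPoly (n l))) t : ℂ) := by
  simp only [lagDeriv, polyFun, Complex.ofReal_prod]

lemma prod_lagDeriv_zero (n : Fin d → ℕ) (t : Fin d → ℝ) :
    ∏ l, lagDeriv (n l) ((0 : Fin d → ℕ) l) (t l) = (laguerreFun n t : ℂ) := by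
  rw [prod_lagDeriv, laguerreFun_eq_polyFun]
  rfl

lemma exists_bound_lagDeriv_summable (hd : 1 ≤ d) (hα : 0 < α) (ha : CoeffDecay α a) :
    ∃ b : ℕ → ℕ → ℝ, (∀ n q, ∀ t ∈ Ici (0 : ℝ), ‖lagDeriv n q t‖ ≤ b n q) ∧
      ∀ q : Fin d → ℕ, Summable fun n : Fin d → ℕ => ‖a n‖ * ∏ l, b (n l) (q l) := by
  obtain ⟨K, N, hK, h⟩ := exists_bound_lagDeriv
  refine ⟨fun n q => K 0 q * ((n : ℝ) + 1) ^ N 0 q, fun n q t ht => ?_, fun q => ?_⟩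
  · simpa using h 0 q n t ht
  · exact ha.summable_mul_prod hd hα (K := fun l => K 0 (q l)) (fun l => hK _ _) fun l => N 0 (q l)

lemma closedOrthant_eq_pi (d : ℕ) : closedOrthant d = Set.pi univ fun _ => Ici 0 := by
  ext; simp only [closedOrthant, Set.mem_ofPred_eq, Set.mem_pi, mem_univ, true_imp_iff, mem_Ici]

/-- The Laguerre series with coefficients `a`. -/
noncomputable def lagSeries (a : (Fin d → ℕ) → ℂ) : (Fin d → ℝ) → ℂ := mseries a lagDeriv 0

lemma mderiv_lagSeries (hd : 1 ≤ d) (hα : 0 < α) (ha : CoeffDecay α a) (p : Fin d → ℕ) :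
    EqOn (mderiv ℝ p (lagSeries a)) (mseries a lagDeriv p) (orthant d) := by
  obtain ⟨b, hb, hs⟩ := exists_bound_lagDeriv_summable hd hα ha
  rw [orthant_eq_pi]
  exact mderiv_mseries isOpen_Ioi isPreconnected_Ioi (fun n q t _ => hasDerivAt_lagDeriv n q t)
    (fun n q t ht => hb n q t (Ioi_subset_Ici_self ht)) hs p

lemma hasSum_lagDeriv (hd : 1 ≤ d) (hα : 0 < α) (ha : CoeffDecay α a) (p : Fin d → ℕ)
    {t : Fin d → ℝ} (ht : t ∈ orthant d) :
    HasSum (fun n : Fin d → ℕ => a n * ∏ l, lagDeriv (n l) (p l) (t l))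
      (mderiv ℝ p (lagSeries a) t) := by
  obtain ⟨b, hb, hs⟩ := exists_bound_lagDeriv_summable hd hα ha
  rw [mderiv_lagSeries hd hα ha p ht]
  exact (summable_mseries hb hs p fun l _ => (ht l).le).hasSum

/-- All bounds on `t^k (d/dt)^q (L_n e^{-t/2})` hold on the closed half-line and grow polynomially
in `n`. The differentiated series therefore converge uniformly up to the boundary, which provides
the continuous extensions. -/
lemma isSchwartz_lagSeries (hd : 1 ≤ d) (hα : 0 < α) (ha : CoeffDecay α a) :
    IsSchwartz (lagSeries a) := by
  obtain ⟨b, hb, hs⟩ := exists_bound_lagDeriv_summable hd hα ha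
  refine ⟨?_, fun p => ⟨mseries a lagDeriv p, ?_, (mderiv_lagSeries hd hα ha p).symm⟩,
    fun k p => ?_⟩
  · rw [orthant_eq_pi]
    exact contDiffOn_mseries isOpen_Ioi isPreconnected_Ioi
      (fun n q t _ => hasDerivAt_lagDeriv n q t)
      (fun n q t ht => hb n q t (Ioi_subset_Ici_self ht)) hs 0
  · rw [closedOrthant_eq_pi]
    exact continuousOn_mseries (fun n q => (continuous_lagDeriv n q).continuousOn) hb hs p
  · obtain ⟨K, N, hK, h⟩ := exists_bound_lagDeriv
    have hs := ha.summable_mul_prod hd hα (K := fun l => K (k l) (p l)) (fun l => hK _ _)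
      fun l => N (k l) (p l)
    refine ⟨∑' n : Fin d → ℕ, ‖a n‖ * ∏ l, (K (k l) (p l) * ((n l : ℝ) + 1) ^ N (k l) (p l)),
      fun t ht => ?_⟩
    have h1 := (hasSum_lagDeriv hd hα ha p ht).mul_left (∏ l, (t l : ℂ) ^ k l)
    have h2 := h1.norm_le_of_bounded hs.hasSum fun n => ?_
    · refine le_trans (le_of_eq ?_) h2
      rw [norm_mul, norm_prod]
      congr 1
      refine Finset.prod_congr rfl fun l _ => ?_
      rw [norm_pow, Complex.norm_real, Real.norm_of_nonneg (ht l).le]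
    · rw [mul_left_comm, ← Finset.prod_mul_distrib, norm_mul, norm_prod]
      exact mul_le_mul_of_nonneg_left (Finset.prod_le_prod (fun l _ => norm_nonneg _)
        fun l _ => h _ _ _ _ (ht l).le) (norm_nonneg _)

lemma eLpNorm_mpow_mul_prod_lagDeriv_le (n p k : Fin d → ℕ) :
    eLpNorm (fun t => (mpow t (fun l => ((p l : ℝ) + (k l : ℝ)) / 2) : ℂ) *
        ∏ l, lagDeriv (n l) (p l) (t l)) 2 (orthantMeasure d) ≤
      ENNReal.ofReal (∏ l, √(4 ^ k l * ((n l : ℝ) + p l + k l) ^ (p l + k l))) := by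
  simp only [prod_lagDeriv, ← Complex.ofReal_mul]
  rw [eLpNorm_mpow_mul_polyFun (q := p + k) (fun l => by simp)]
  refine ENNReal.ofReal_le_ofReal ?_
  rw [← Real.sqrt_prod _ (fun l _ => by positivity)]
  refine Real.sqrt_le_sqrt (Finset.prod_le_prod (fun l _ => ?_) fun l _ => ?_)
  · refine expInt_nonneg fun t ht => ?_
    simp only [Polynomial.eval_mul, Polynomial.eval_pow, Polynomial.eval_X]
    positivity
  · exact expInt_sq_twistDeriv_le (p l) (n l) 0 (k l)

lemma hasSum_prod_exp_mul {K : Fin d → ℝ} {c : ℝ} (hα : 0 < α) (hc : 0 < c) (hK : ∀ l, 0 ≤ K l) :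
    HasSum (fun n : Fin d → ℕ => ∏ l, Real.exp (-c * (n l : ℝ) ^ (1 / α)) * K l)
      ((∑' n : ℕ, Real.exp (-c * (n : ℝ) ^ (1 / α))) ^ d * ∏ l, K l) := by
  have hs : Summable fun n : ℕ => Real.exp (-c * (n : ℝ) ^ (1 / α)) := by
    simpa using summable_pow_mul_exp_neg_rpow hα hc 0
  have h0 : ∀ l (n : ℕ), 0 ≤ Real.exp (-c * (n : ℝ) ^ (1 / α)) * K l :=
    fun l n => mul_nonneg (Real.exp_pos _).le (hK l)
  have h1 := summable_prod_pi h0 fun l => hs.mul_right (K l)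
  have h2 := tsum_prod_pi (R := ℝ) (f := fun l (n : ℕ) => Real.exp (-c * (n : ℝ) ^ (1 / α)) * K l)
    fun l => (hs.mul_right (K l)).norm
  convert h1.hasSum using 1
  rw [h2]
  simp only [tsum_mul_right, Finset.prod_mul_distrib, Finset.prod_const, Finset.card_univ,
    Fintype.card_fin]

/-- Sum the weighted norms of the terms. Per coordinate, half of the rate turns the norm bound into
`2 B^{p+k} p^{αp/2} k^{αk/2}`, uniformly in `n`; the other half is summed and gives `S`. This
explains the constant `S^d 2^d`. -/
lemma isG_lagSeries (hd : 1 ≤ d) (hα : 1 ≤ α) (ha : CoeffDecay α a) :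
    IsG α α (lagSeries a) := by
  have hα0 : 0 < α := by linarith
  refine ⟨isSchwartz_lagSeries hd hα0 ha, ?_⟩
  obtain ⟨C, c, hC, hc, h⟩ := ha.exists_le_prod hd hα0
  obtain ⟨B, hB, hB'⟩ := exists_exp_mul_sqrt_le hα (half_pos hc)
  set S : ℝ := ∑' n : ℕ, Real.exp (-(c / 2) * (n : ℝ) ^ (1 / α)) with hS
  refine ⟨B, hB, C * (S ^ d * 2 ^ d), fun p k => ?_⟩
  set K : Fin d → ℝ := fun l =>
    2 * B ^ (p l + k l) * ((p l : ℝ) ^ (α / 2 * p l) * (k l : ℝ) ^ (α / 2 * k l)) with hK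
  have hK0 : ∀ l, 0 ≤ K l := fun l => by positivity
  have hsum := (hasSum_prod_exp_mul hα0 (half_pos hc) hK0).mul_left C
  have hval : C * (S ^ d * ∏ l, K l) =
      C * (S ^ d * 2 ^ d) * (B ^ len (p + k) * selfPow (α / 2) k * selfPow (α / 2) p) := by
    simp only [hK, Finset.prod_mul_distrib, Finset.prod_const, Finset.card_univ, Fintype.card_fin,
      Finset.prod_pow_eq_pow_sum, len, selfPow, mpow, Pi.add_apply]
    ring
  rw [← hval, ← hsum.tsum_eq]
  refine eLpNorm_le_of_hasSum (ι := Fin d → ℕ) one_le_two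
    (f := fun n t => a n * ((mpow t (fun l => ((p l : ℝ) + (k l : ℝ)) / 2) : ℂ) *
      ∏ l, lagDeriv (n l) (p l) (t l))) (fun n => ?_) ?_ (fun n => ?_) (fun n => ?_) hsum.summable
  · refine AEStronglyMeasurable.const_mul ?_ _
    simp only [prod_lagDeriv, ← Complex.ofReal_mul]
    exact (memLp_mpow_mul_polyFun (q := p + k) (fun l => by simp) _).aestronglyMeasurable
  · filter_upwards [ae_mem_orthant d] with t ht
    simpa only [mul_left_comm] using (hasSum_lagDeriv hd hα0 ha p ht).mul_left
      (mpow t (fun l => ((p l : ℝ) + (k l : ℝ)) / 2) : ℂ)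
  · exact mul_nonneg hC (Finset.prod_nonneg fun l _ => mul_nonneg (Real.exp_pos _).le (hK0 l))
  · have h1 := eLpNorm_const_smul (a n) (fun t : Fin d → ℝ =>
      (mpow t (fun l => ((p l : ℝ) + (k l : ℝ)) / 2) : ℂ) * ∏ l, lagDeriv (n l) (p l) (t l)) 2
      (orthantMeasure d)
    refine h1.le.trans ?_
    rw [← ofReal_norm]
    refine (mul_le_mul_right (eLpNorm_mpow_mul_prod_lagDeriv_le n p k) _).trans ?_
    rw [← ENNReal.ofReal_mul (norm_nonneg _)]
    refine ENNReal.ofReal_le_ofReal ((mul_le_mul_of_nonneg_right (h n)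
      (Finset.prod_nonneg fun l _ => Real.sqrt_nonneg _)).trans ?_)
    rw [mul_assoc, ← Finset.prod_mul_distrib]
    refine mul_le_mul_of_nonneg_left (Finset.prod_le_prod (fun l _ => by positivity)
      fun l _ => ?_) hC
    calc Real.exp (-c * (n l : ℝ) ^ (1 / α)) * √(4 ^ k l * ((n l : ℝ) + p l + k l) ^ (p l + k l))
        = Real.exp (-(c / 2) * (n l : ℝ) ^ (1 / α)) * (Real.exp (-(c / 2) * (n l : ℝ) ^ (1 / α)) *
          √(4 ^ k l * ((n l : ℝ) + p l + k l) ^ (p l + k l))) := by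
          rw [← mul_assoc, ← Real.exp_add]
          congr 2; ring
      _ ≤ _ := mul_le_mul_of_nonneg_left (hB' _ _ _) (Real.exp_pos _).le

lemma IsG.memLp {β : ℝ} {f : (Fin d → ℝ) → ℂ} (hf : IsG α β f) :
    MemLp f 2 (orthantMeasure d) := by
  obtain ⟨A, -, C, h⟩ := hf.bound
  refine ⟨hf.schwartz.smooth.continuousOn.aestronglyMeasurable (measurableSet_orthant d), ?_⟩
  have h0 := h 0 0
  simp only [Pi.zero_apply, Nat.cast_zero, add_zero, zero_div, mpow_zero, Complex.ofReal_one,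
    one_mul] at h0
  have h1 : mderiv ℝ (0 : Fin d → ℕ) f = f := by simp [mderiv]
  rw [h1] at h0
  exact h0.trans_lt ENNReal.ofReal_lt_top

/-- Termwise integration, allowed by `∑ |a_n| < ∞`, and orthonormality. -/
lemma laguerreCoeff_lagSeries (hd : 1 ≤ d) (hα : 0 < α) (ha : CoeffDecay α a) (m : Fin d → ℕ) :
    laguerreCoeff (lagSeries a) m = a m := by
  have hint : ∀ n : Fin d → ℕ, Integrable
      (fun t => (laguerreFun n t : ℂ) * (laguerreFun m t : ℂ)) (orthantMeasure d) :=
    fun n => integrable_mul_laguerreFun (memLp_laguerreFun n) m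
  have h := hasSum_integral_of_summable_integral_norm (μ := orthantMeasure d)
    (F := fun (n : Fin d → ℕ) t => a n * ((laguerreFun n t : ℂ) * (laguerreFun m t : ℂ)))
    (fun n => (hint n).const_mul _) ?_
  · have h2 : ∀ n : Fin d → ℕ, ∫ t, a n * ((laguerreFun n t : ℂ) * (laguerreFun m t : ℂ))
        ∂orthantMeasure d = if n = m then a m else 0 := by
      intro n
      rw [integral_const_mul]
      simp only [← Complex.ofReal_mul]
      rw [integral_complex_ofReal, integral_laguerreFun_mul]
      split_ifs with hnm
      · simp [hnm]
      · simp
    simp only [h2] at h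
    rw [← h.unique (hasSum_ite_eq m (a m)), laguerreCoeff]
    refine integral_congr_ae ?_
    filter_upwards [ae_mem_orthant d] with t ht
    have h3 := (hasSum_lagDeriv hd hα ha 0 ht).mul_right (laguerreFun m t : ℂ)
    simp only [prod_lagDeriv_zero, mul_assoc] at h3
    rw [h3.tsum_eq]
    simp [mderiv]
  · refine Summable.of_nonneg_of_le (fun n => integral_nonneg fun t => norm_nonneg _)
      (fun n => ?_) (ha.summable_norm hd hα)
    simp only [norm_mul (a n)]
    rw [integral_const_mul]
    refine mul_le_of_le_one_right (norm_nonneg _) ?_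
    have := integral_norm_mul_laguerreFun_le (memLp_laguerreFun n) m
    rwa [eLpNorm_laguerreFun, ENNReal.toReal_one] at this

lemma exists_isG_of_coeffDecay (hd : 1 ≤ d) (hα : 1 ≤ α) (ha : CoeffDecay α a) :
    ∃ f : (Fin d → ℝ) → ℂ, IsG α α f ∧ (∀ n, a n = laguerreCoeff f n) ∧
      ∀ w ∈ polydisc d, FD f w = laguerreGen a w := by
  have hα0 : 0 < α := by linarith
  have hf := isG_lagSeries hd hα ha
  have hc : laguerreCoeff (lagSeries a) = a := funext (laguerreCoeff_lagSeries hd hα0 ha)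
  exact ⟨lagSeries a, hf, fun n => by rw [hc], fun w hw => by
    rw [FD_eq_laguerreGen hf.memLp hw, hc]⟩

end LaguerreSeries

/-! ### Uniqueness, analyticity of the transform, and the equivalences. -/

section Main

variable {d : ℕ} {α : ℝ} {f g : (Fin d → ℝ) → ℂ}

lemma laguerreCoeff_congr (h : f =ᵐ[orthantMeasure d] g) : laguerreCoeff f = laguerreCoeff g := by
  funext n
  refine integral_congr_ae ?_
  filter_upwards [h] with t ht
  rw [ht]

lemma ae_eq_of_laguerreCoeff_eq (hf : MemLp f 2 (orthantMeasure d))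
    (hg : MemLp g 2 (orthantMeasure d)) (h : ∀ n, laguerreCoeff f n = laguerreCoeff g n) :
    f =ᵐ[orthantMeasure d] g := by
  have h0 := ae_eq_zero_of_laguerreCoeff_eq_zero (hf.sub hg) fun n => by
    have : laguerreCoeff (f - g) n = laguerreCoeff f n - laguerreCoeff g n := by
      simp only [laguerreCoeff, Pi.sub_apply, sub_mul]
      exact integral_sub (integrable_mul_laguerreFun hf n) (integrable_mul_laguerreFun hg n)
    rw [this, h n, sub_self]
  filter_upwards [h0] with t ht
  exact sub_eq_zero.1 ht

lemma differentiableOn_FD (hf : MemLp f 2 (orthantMeasure d)) :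
    DifferentiableOn ℂ (FD f) (polydisc d) := by
  have hM := norm_laguerreCoeff_le hf
  obtain ⟨M, hM'⟩ := exists_bound_mixedDiff hM (List.finRange d)
  refine (differentiableOn_powSeries hM').congr fun w hw => ?_
  rw [FD_eq_laguerreGen hf hw, laguerreGen_eq_powSeries hM hw]

/-- Coefficient decay is the hub. The function of class `G` built from the coefficients of `f`
agrees with `f` almost everywhere by completeness. -/
lemma tfae_isG (hd : 1 ≤ d) (hα : 1 ≤ α) (hf : MemLp f 2 (orthantMeasure d)) :
    List.TFAE [CoeffDecay α (laguerreCoeff f),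
      ∃ g : (Fin d → ℝ) → ℂ, IsG α α g ∧ f =ᵐ[orthantMeasure d] g,
      DerivBound α (FD f) ∧ Tendsto (FD f) (𝓝[polydisc d] 1) (𝓝 0)] := by
  have hα0 : 0 < α := by linarith
  have hF : EqOn (FD f) (laguerreGen (laguerreCoeff f)) (polydisc d) :=
    fun w hw => FD_eq_laguerreGen hf hw
  tfae_have 1 → 2 := fun h => by
    obtain ⟨g, hg, hag, -⟩ := exists_isG_of_coeffDecay hd hα h
    exact ⟨g, hg, ae_eq_of_laguerreCoeff_eq hf hg.memLp hag⟩
  tfae_have 2 → 1 := fun ⟨g, hg, hfg⟩ => by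
    rw [laguerreCoeff_congr hfg]
    exact coeffDecay_of_isG hd hα hg
  tfae_have 1 → 3 := fun h =>
    ⟨derivBound_of_coeffDecay hd hα h hF, tendsto_of_coeffDecay hd hα0 h hF⟩
  tfae_have 3 → 1 := fun h => coeffDecay_of_derivBound hd hα (tendsto_laguerreCoeff hf) hF h.1
  tfae_finish

end Main

end LaguerreG

theorem theorem5p7 (d : ℕ) (hd : 1 ≤ d) (α : ℝ) (hα : 1 ≤ α) :
    -- for every `f` in `L²` of the orthant: the transform is holomorphic with the stated
    -- expansion, and the three conditions are equivalent
    (∀ f : (Fin d → ℝ) → ℂ, MemLp f 2 (LaguerreG.orthantMeasure d) →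
      DifferentiableOn ℂ (LaguerreG.FD f) (LaguerreG.polydisc d) ∧
      (∀ w ∈ LaguerreG.polydisc d,
        Summable (fun n : Fin d → ℕ => LaguerreG.laguerreCoeff f n * ∏ l, w l ^ n l) ∧
        LaguerreG.FD f w = LaguerreG.laguerreGen (LaguerreG.laguerreCoeff f) w) ∧
      List.TFAE [
        LaguerreG.CoeffDecay α (LaguerreG.laguerreCoeff f),
        ∃ g : (Fin d → ℝ) → ℂ, LaguerreG.IsG α α g ∧ f =ᵐ[LaguerreG.orthantMeasure d] g,
        LaguerreG.DerivBound α (LaguerreG.FD f) ∧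
          Tendsto (LaguerreG.FD f) (𝓝[LaguerreG.polydisc d] 1) (𝓝 0)]) ∧
    -- every sequence with the decay comes from a function in the space
    (∀ a : (Fin d → ℕ) → ℂ, LaguerreG.CoeffDecay α a →
      ∃ f : (Fin d → ℝ) → ℂ, LaguerreG.IsG α α f ∧
        (∀ n, a n = LaguerreG.laguerreCoeff f n) ∧
        ∀ w ∈ LaguerreG.polydisc d, LaguerreG.FD f w = LaguerreG.laguerreGen a w) ∧
    -- every holomorphic function of the given form with the derivative bounds comes from
    -- a function in the space
    (∀ (a : (Fin d → ℕ) → ℂ) (F : (Fin d → ℂ) → ℂ),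
      DifferentiableOn ℂ F (LaguerreG.polydisc d) →
      Tendsto a (comap LaguerreG.len atTop) (𝓝 0) →
      (∀ w ∈ LaguerreG.polydisc d, F w = LaguerreG.laguerreGen a w) →
      LaguerreG.DerivBound α F →
      ∃ f : (Fin d → ℝ) → ℂ, LaguerreG.IsG α α f ∧
        (∀ n, a n = LaguerreG.laguerreCoeff f n) ∧
        ∀ w ∈ LaguerreG.polydisc d, LaguerreG.FD f w = F w) := by
  refine ⟨fun f hf => ⟨LaguerreG.differentiableOn_FD hf, fun w hw =>
    ⟨(LaguerreG.hasSum_laguerreCoeff_mul_pow hf hw).summable, LaguerreG.FD_eq_laguerreGen hf hw⟩,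
    LaguerreG.tfae_isG hd hα hf⟩, fun a ha => LaguerreG.exists_isG_of_coeffDecay hd hα ha,
    fun a F _ ha hF hb => ?_⟩
  -- Only finitely many multi-indices have a given length, so convergence as `|n| → ∞` gives
  -- convergence along the cofinite filter.
  have ha' : Tendsto a cofinite (𝓝 0) :=
    ha.mono_left (tendsto_iff_comap.1 LaguerreG.tendsto_len_cofinite)
  obtain ⟨f, hf, hfa, hfF⟩ := LaguerreG.exists_isG_of_coeffDecay hd hα
    (LaguerreG.coeffDecay_of_derivBound hd hα ha' hF hb)
  exact ⟨f, hf, hfa, fun w hw => (hfF w hw).trans (hF w hw).symm⟩
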